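/- **Model.** We use a unit-cost word-RAM with word length $w$. Words are the integers in $[0,2^w)$. The machine has a fixed number of registers, a zero-initialized work memory of words addressed by words, two read-only input arrays (pattern and text), and a write-only output. Its instructions are: loading a constant; addition, subtraction and multiplication modulo $2^w$, integer division and remainder; bitwise and, or, xor; shifts; loads and stores; reading an input word; reporting a word; and jumps, unconditional or conditional on $=$ or $<$. Every instruction takes one unit of time. Space is the number of registers plus the number of work-memory cells up to the largest address accessed; input and output are not counted. The program is a fixed finite list of instructions. **Input.** $P$ and $Q$ are strings of lengths $m$ and $n$, with $1\le m\le n$ and $n\ge 2$, over the alphabet $\{0,\dots,\sigma-1\}$, $\sigma\ge 2$. They are given in packed representation: $k$ characters per word, each in a field of $\lceil\log_2\sigma\rceil$ bits. The numbers $n$, $m$, $\lceil \log_2\sigma\rceil$ and $k$ are initially in registers. The word length is $w=\Theta(\log n)$ and large enough to hold $n$, that is, $n<2^w$ and $w\le b\log_2 n$ for a constant $b$. Each word holds $k=\Theta(\log n/\log\sigma)$ characters, that is, $\kappa\log_\sigma n\le k$ for a constant $\kappa>0$, and $k\lceil\log_2\sigma\rceil\le w$. **Theorem.** For all constants $0<\varepsilon<1$,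 $b$ and $\kappa>0$ there are a program and a constant $C$ such that the following holds for all $n,m,\sigma,w,k$ and all strings $P,Q$ as above. The program halts, having reported every position of $Q$ at which an occurrence of $P$ starts exactly once and nothing else, in time at most $$C\left(\frac{n}{\log_\sigma n}+m+\mathrm{occ}\right)$$ and space at most $C\,(n^{\varepsilon}+m)$ words, where $\mathrm{occ}$ is the number of occurrences of $P$ in $Q$. -/

import Mathlib

namespace WordRAM

/-- The binary operations of the processor. -/
inductive BinOp where
  | add | sub | mul | div | mod | land | lor | xor | shl | shr

/-- Result of an operation on words of length `w`; words are the naturals below `2 ^ w`, and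
addition, subtraction, multiplication and left shift are taken modulo `2 ^ w`. -/
def BinOp.eval (w : ℕ) : BinOp → ℕ → ℕ → ℕ
  | .add, a, b => (a + b) % 2 ^ w
  | .sub, a, b => (a + (2 ^ w - b)) % 2 ^ w
  | .mul, a, b => (a * b) % 2 ^ w
  | .div, a, b => (a / b) % 2 ^ w
  | .mod, a, b => (a % b) % 2 ^ w
  | .land, a, b => (a &&& b) % 2 ^ w
  | .lor, a, b => (a ||| b) % 2 ^ w
  | .xor, a, b => (a ^^^ b) % 2 ^ w
  | .shl, a, b => (a <<< b) % 2 ^ w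
  | .shr, a, b => (a >>> b) % 2 ^ w

/-- The two read-only input arrays. -/
inductive Port where
  | pattern | text

/-- Instructions of a machine with `s` registers. All register arguments are direct; the work memory
and the input arrays are addressed through registers. -/
inductive Instr (s : ℕ) where
  /-- `reg d := c` (reduced modulo `2 ^ w`) -/
  | const (d : Fin s) (c : ℕ)
  /-- `reg d := reg a ∘ reg b` -/
  | op (f : BinOp) (d a b : Fin s)
  /-- `reg d := mem[reg a]` -/
  | load (d a : Fin s)
  /-- `mem[reg a] := reg b` -/
  | store (a b : Fin s)
  /-- `reg d := input[reg a]`, for one of the input arrays -/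
  | read (x : Port) (d a : Fin s)
  /-- append `reg a` to the output -/
  | report (a : Fin s)
  /-- continue at instruction `l` -/
  | jump (l : ℕ)
  /-- continue at instruction `l` if `reg a = reg b` -/
  | jumpEq (a b : Fin s) (l : ℕ)
  /-- continue at instruction `l` if `reg a < reg b` -/
  | jumpLt (a b : Fin s) (l : ℕ)
  /-- stop -/
  | halt

/-- A program is a finite list of instructions, numbered from `0`. -/
abbrev Program (s : ℕ) := List (Instr s)

/-- A configuration: program counter, registers, work memory, and write-only output. -/
structure Config (s : ℕ) where
  pc : ℕ
  reg : Fin s → ℕ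
  mem : ℕ → ℕ
  out : List ℕ

/-- Assign a value to a register and go on to the next instruction. -/
def Config.set {s : ℕ} (c : Config s) (d : Fin s) (v : ℕ) : Config s :=
  { c with pc := c.pc + 1, reg := Function.update c.reg d v }

/-- The effect of one instruction, for word length `w` and input arrays `input`. -/
def Instr.exec {s : ℕ} (w : ℕ) (input : Port → ℕ → ℕ) (c : Config s) : Instr s → Config s
  | .const d v => c.set d (v % 2 ^ w)
  | .op f d a b => c.set d (f.eval w (c.reg a) (c.reg b))
  | .load d a => c.set d (c.mem (c.reg a))
  | .store a b => { c with pc := c.pc + 1, mem := Function.update c.mem (c.reg a) (c.reg b) }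
  | .read x d a => c.set d (input x (c.reg a))
  | .report a => { c with pc := c.pc + 1, out := c.out ++ [c.reg a] }
  | .jump l => { c with pc := l }
  | .jumpEq a b l => { c with pc := if c.reg a = c.reg b then l else c.pc + 1 }
  | .jumpLt a b l => { c with pc := if c.reg a < c.reg b then l else c.pc + 1 }
  | .halt => c

/-- The instruction to be executed next; running past the end of the program stops the machine. -/
def current {s : ℕ} (prog : Program s) (c : Config s) : Instr s :=
  prog.getD c.pc .halt

/-- One step of the computation; it takes one unit of time. Halted configurations are fixed. -/
def step {s : ℕ} (prog : Program s) (w : ℕ) (input : Port → ℕ → ℕ) (c : Config s) : Config s :=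
  (current prog c).exec w input c

/-- Initially the parameters are in the first registers; all else is zero or empty. -/
def initial (s : ℕ) (params : List ℕ) : Config s where
  pc := 0
  reg i := params.getD i 0
  mem _ := 0
  out := []

/-- The configuration after `t` steps. -/
def run {s : ℕ} (prog : Program s) (w : ℕ) (input : Port → ℕ → ℕ) (params : List ℕ) (t : ℕ) :
    Config s :=
  (step prog w input)^[t] (initial s params)

/-- The machine has stopped. -/
def Halted {s : ℕ} (prog : Program s) (c : Config s) : Prop :=
  current prog c = .halt

/-- The next instruction reads or writes the cell `x` of the work memory. -/
def Accesses {s : ℕ} (prog : Program s) (c : Config s) (x : ℕ) : Prop :=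
  match current prog c with
  | .load _ a => c.reg a = x
  | .store a _ => c.reg a = x
  | _ => False

/-- The whole computation fits into `S` words: the `s` registers together with all cells of the
work memory up to the largest address that is ever accessed. Input and output do not count. -/
def SpaceWithin {s : ℕ} (prog : Program s) (w : ℕ) (input : Port → ℕ → ℕ) (params : List ℕ)
    (S : ℕ) : Prop :=
  s ≤ S ∧ ∀ t x, Accesses prog (run prog w input params t) x → s + (x + 1) ≤ S

end WordRAM

namespace PackedMatching

/-- Word number `j` of the packed representation of `A` with `k` characters per word, each in a
field of `⌈log₂ σ⌉` bits, the first character lowest; unused fields are zero. -/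
def packed {σ : ℕ} (k : ℕ) (A : List (Fin σ)) (j : ℕ) : ℕ :=
  ∑ i ∈ Finset.range k, (A.map Fin.val).getD (j * k + i) 0 * 2 ^ (Nat.clog 2 σ * i)

/-- The input arrays: packed pattern and packed text. -/
def packedInput {σ : ℕ} (k : ℕ) (P Q : List (Fin σ)) : WordRAM.Port → ℕ → ℕ
  | .pattern => packed k P
  | .text => packed k Q

/-- The numbers that describe the input format: the lengths of the text and of the pattern, the
number of bits per character and the number of characters per word. -/
def parameters {σ : ℕ} (k : ℕ) (P Q : List (Fin σ)) : List ℕ :=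
  [Q.length, P.length, Nat.clog 2 σ, k]

/-- The positions (counted from `0`) at which an occurrence of `P` in `Q` starts. -/
def occurrences {σ : ℕ} (P Q : List (Fin σ)) : Finset ℕ :=
  {i ∈ Finset.range (Q.length + 1) | P <+: Q.drop i}

/-- On this input the program stops after at most `T` steps, using at most `S` words of space, and
has then reported every occurrence of `P` in `Q` exactly once, and nothing else. -/
def SolvesWithin {s : ℕ} (prog : WordRAM.Program s) (w : ℕ) {σ : ℕ} (k : ℕ) (P Q : List (Fin σ))
    (T S : ℕ) : Prop :=
  let final := WordRAM.run prog w (packedInput k P Q) (parameters k P Q) T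
  WordRAM.Halted prog final ∧
  WordRAM.SpaceWithin prog w (packedInput k P Q) (parameters k P Q) S ∧
  final.out.Nodup ∧ final.out.toFinset = occurrences P Q

end PackedMatching

/-! The search is Knuth–Morris–Pratt, accelerated by table lookups so that it reads `t = k / 2 ^ a`
characters at a time. The state before text position `i` is a number `q ≤ m`: the alignment `s = i -
q` of the pattern agrees with the text before `i`, and no earlier alignment is still of interest.

Which alignments `s + d` with `d < t` survive the next block of `t` characters depends on little
data. The shift `d` must be a period of the prefix of length `q` (`Agrees.shift_iff`), which takes
one bit of a `t`-bit mask (`PeriodMask.of_border`). The rest is a comparison of the block with a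
part of the `2 * t` pattern characters around `q`, cut off where the pattern ends, so that only `min
t (m - q)` matters (`shiftHit_iff`). These data have `O(c * t)` bits, and a table indexed by them
gives the first surviving shift in constant time (`lookupShift_ends`). If no shift below `t`
survives and `q ≥ t`, the state falls back to the longest border that is shorter by at least `t`; if
`q < t`, only alignments starting inside the block remain, and a second table finds them
(`startHit_iff`, `startScan_ends`).

The time is amortised (`processBlock_round`, `blockSearch_ends`). A fallback moves the alignment by
at least `t`, so there are `O(n / t)` of them; every other lookup finishes a stage of the block or
finds a full match. Matches that lie partly behind the end of the text also cost time, but there are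
at most `m + t` of them (`fullMatches_le`). Since `k ≤ 2 ^ (a + 1) * t` for `t ≥ 1`, the number `n /
t` is `O(n / log_σ n)`. The borders and masks of the pattern are found in time `O(m)` by ordinary
Knuth–Morris–Pratt steps (`advance_ends`).

The constant `a` is chosen so that filling the tables costs `O(n ^ min ε (1 / 2))` (`table_sizes`,
`two_pow_le_rpow`), which is within both the space bound and, as `√n = O(n / log_σ n)`, the time
bound. If `t = 0`, then `log_σ n` is bounded; if `m > n / 16`, then `n = O(m)`; in both cases a
linear search is good enough.

To reason about the machine, programs are written as structured commands with exact step counts,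
compiled (`Runs.reaches`, `Ends.machine`), and verified by Hoare-style rules in which loop
invariants carry a potential (`Ends.loop`). -/

set_option linter.constructorNameAsVariable false

namespace WordRAM

set_option linter.unusedSectionVars false

/-! ### A structured language over the machine -/

/-- Registers (named by `V`), work memory and output. -/
structure Store (V : Type) where
  reg : V → ℕ
  mem : ℕ → ℕ
  out : List ℕ

/-- The instructions that do not jump. -/
inductive Basic (V : Type) where
  | const (d : V) (c : ℕ)
  | op (f : BinOp) (d a b : V)
  | load (d a : V)
  | store (a b : V)
  | read (x : Port) (d a : V)
  | report (a : V)

/-- The two tests on which the machine can branch. -/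
inductive Cond (V : Type) where
  | eq (a b : V)
  | lt (a b : V)

/-- Structured commands. -/
inductive Com (V : Type) where
  | block (l : List (Basic V))
  | seq (a b : Com V)
  | ite (q : Cond V) (a b : Com V)
  | loop (q : Cond V) (a : Com V)

/-- Word length, input arrays, and a bound on the addresses that may be accessed. -/
structure Env where
  w : ℕ
  input : Port → ℕ → ℕ
  bound : ℕ

variable {V : Type} [DecidableEq V]

def Store.set (st : Store V) (d : V) (v : ℕ) : Store V :=
  { st with reg := Function.update st.reg d v }

def Basic.exec (E : Env) (st : Store V) : Basic V → Store V
  | .const d v => st.set d (v % 2 ^ E.w)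
  | .op f d a b => st.set d (f.eval E.w (st.reg a) (st.reg b))
  | .load d a => st.set d (st.mem (st.reg a))
  | .store a b => { st with mem := Function.update st.mem (st.reg a) (st.reg b) }
  | .read x d a => st.set d (E.input x (st.reg a))
  | .report a => { st with out := st.out ++ [st.reg a] }

/-- The bound is a ghost quantity: execution ignores it, so the same program can be analysed with
different bounds. -/
def Basic.Safe (E : Env) (st : Store V) : Basic V → Prop
  | .load _ a => st.reg a < E.bound
  | .store a _ => st.reg a < E.bound
  | _ => True

def execAll (E : Env) : List (Basic V) → Store V → Store V
  | [], st => st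
  | i :: l, st => execAll E l (i.exec E st)

def SafeAll (E : Env) : List (Basic V) → Store V → Prop
  | [], _ => True
  | i :: l, st => i.Safe E st ∧ SafeAll E l (i.exec E st)

def Cond.Holds (st : Store V) : Cond V → Prop
  | .eq a b => st.reg a = st.reg b
  | .lt a b => st.reg a < st.reg b

attribute [simp] Store.set Basic.exec Basic.Safe execAll SafeAll Cond.Holds

/-- Big-step semantics with the exact number of machine steps. -/
inductive Runs (E : Env) : Com V → Store V → ℕ → Store V → Prop where
  | block (l st) : SafeAll E l st → Runs E (.block l) st l.length (execAll E l st)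
  | seq {a b st st' st'' T T'} : Runs E a st T st' → Runs E b st' T' st'' →
      Runs E (.seq a b) st (T + T') st''
  | iteTrue {q a b st st' T} : Cond.Holds st q → Runs E a st T st' →
      Runs E (.ite q a b) st (1 + T) st'
  | iteFalse {q a b st st' T} : ¬ Cond.Holds st q → Runs E b st T st' →
      Runs E (.ite q a b) st (1 + T + 1) st'
  | loopEnd {q a st} : ¬ Cond.Holds st q → Runs E (.loop q a) st 2 st
  | loopStep {q a st st' st'' T T'} : Cond.Holds st q → Runs E a st T st' →
      Runs E (.loop q a) st' T' st'' → Runs E (.loop q a) st (1 + T + 1 + T') st''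

/-! ### Compilation -/

/-- The number of instructions of the compiled command. -/
def Com.size : Com V → ℕ
  | .block l => l.length
  | .seq a b => a.size + b.size
  | .ite _ a b => 1 + b.size + 1 + a.size
  | .loop _ a => 2 + a.size + 1

section Compile

variable {s : ℕ} (e : V ≃ Fin s)

def Basic.compile : Basic V → Instr s
  | .const d v => .const (e d) v
  | .op f d a b => .op f (e d) (e a) (e b)
  | .load d a => .load (e d) (e a)
  | .store a b => .store (e a) (e b)
  | .read x d a => .read x (e d) (e a)
  | .report a => .report (e a)

def Cond.compile (l : ℕ) : Cond V → Instr s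
  | .eq a b => .jumpEq (e a) (e b) l
  | .lt a b => .jumpLt (e a) (e b) l

/-- The machine code of a command whose first instruction has number `off`. -/
def Com.compile : Com V → ℕ → Program s
  | .block l, _ => l.map (Basic.compile e)
  | .seq a b, off => a.compile off ++ b.compile (off + a.size)
  | .ite q a b, off =>
      [q.compile e (off + 1 + b.size + 1)] ++ b.compile (off + 1) ++
        [.jump (off + 1 + b.size + 1 + a.size)] ++ a.compile (off + 1 + b.size + 1)
  | .loop q a, off =>
      [q.compile e (off + 2), .jump (off + 2 + a.size + 1)] ++ a.compile (off + 2) ++ [.jump off]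

theorem Com.length_compile (c : Com V) (off : ℕ) : (c.compile e off).length = c.size := by
  induction c generalizing off with
  | block l => simp [Com.compile, Com.size]
  | seq a b iha ihb => simp [Com.compile, Com.size, iha, ihb]
  | ite q a b iha ihb => simp [Com.compile, Com.size, iha, ihb]; omega
  | loop q a ih => simp [Com.compile, Com.size, ih]; omega

def Store.config (st : Store V) (pc : ℕ) : Config s :=
  ⟨pc, st.reg ∘ e.symm, st.mem, st.out⟩

/-- `T` steps lead from `c` to `c'`, and only addresses below the bound are accessed. -/
def Reaches (E : Env) (prog : Program s) (c : Config s) (T : ℕ) (c' : Config s) : Prop :=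
  (step prog E.w E.input)^[T] c = c' ∧
    ∀ t < T, ∀ x, Accesses prog ((step prog E.w E.input)^[t] c) x → x < E.bound

theorem Reaches.refl (E : Env) (prog : Program s) (c : Config s) : Reaches E prog c 0 c :=
  ⟨rfl, by simp⟩

theorem Reaches.trans {E : Env} {prog : Program s} {c c' c'' : Config s} {T T' : ℕ}
    (h : Reaches E prog c T c') (h' : Reaches E prog c' T' c'') :
    Reaches E prog c (T + T') c'' := by
  refine ⟨by rw [add_comm, Function.iterate_add_apply, h.1, h'.1], fun t ht x hx => ?_⟩
  by_cases htT : t < T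
  · exact h.2 t htT x hx
  · obtain ⟨u, rfl⟩ := Nat.exists_eq_add_of_le (not_lt.mp htT)
    refine h'.2 u (by omega) x ?_
    rwa [add_comm, Function.iterate_add_apply, h.1] at hx

theorem Reaches.single {E : Env} {prog : Program s} {c c' : Config s}
    (h : step prog E.w E.input c = c') (hs : ∀ x, Accesses prog c x → x < E.bound) :
    Reaches E prog c 1 c' := by
  refine ⟨by simpa using h, fun t ht x hx => ?_⟩
  obtain rfl : t = 0 := by omega
  exact hs x hx

theorem current_append {pre post : Program s} {i : Instr s} {c : Config s}
    (h : c.pc = pre.length) : current (pre ++ i :: post) c = i := by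
  simp [current, h]

theorem reaches_jump {E : Env} {pre post : Program s} {l : ℕ} (st : Store V) :
    Reaches E (pre ++ .jump l :: post) (st.config e pre.length) 1 (st.config e l) := by
  have h : current (pre ++ .jump l :: post) (st.config e pre.length) = .jump l :=
    current_append rfl
  refine Reaches.single ?_ ?_
  · rw [step, h]; rfl
  · intro x hx; simp [Accesses, h] at hx

theorem reaches_cond {E : Env} {pre post : Program s} {l : ℕ} (q : Cond V) (st : Store V)
    [Decidable (q.Holds st)] :
    Reaches E (pre ++ q.compile e l :: post) (st.config e pre.length) 1
      (st.config e (if q.Holds st then l else pre.length + 1)) := by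
  have h : current (pre ++ q.compile e l :: post) (st.config e pre.length) = q.compile e l :=
    current_append rfl
  refine Reaches.single ?_ ?_
  · rw [step, h]
    cases q <;> simp only [Cond.compile, Instr.exec, Cond.Holds, Store.config] <;>
      simp only [Function.comp_apply, Equiv.symm_apply_apply] <;> congr
  · intro x hx
    rw [Accesses, h] at hx
    cases q <;> simp [Cond.compile] at hx

theorem reaches_basic {E : Env} {pre post : Program s} (i : Basic V) (st : Store V)
    (hi : i.Safe E st) :
    Reaches E (pre ++ i.compile e :: post) (st.config e pre.length) 1
      ((i.exec E st).config e (pre.length + 1)) := by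
  have h : current (pre ++ i.compile e :: post) (st.config e pre.length) = i.compile e :=
    current_append rfl
  refine Reaches.single ?_ ?_
  · rw [step, h]
    cases i <;> simp [Basic.compile, Instr.exec, Basic.exec, Store.config, Store.set, Config.set,
      Function.update_comp_equiv]
  · intro x hx
    rw [Accesses, h] at hx
    cases i <;> simp [Basic.compile, Store.config] at hx
    all_goals subst hx; exact hi

theorem reaches_block {E : Env} (l : List (Basic V)) {pre post : Program s} (st : Store V)
    (hl : SafeAll E l st) :
    Reaches E (pre ++ (l.map (Basic.compile e) ++ post)) (st.config e pre.length) l.length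
      ((execAll E l st).config e (pre.length + l.length)) := by
  induction l generalizing pre st with
  | nil => exact Reaches.refl _ _ _
  | cons i l ih =>
    have h1 := reaches_basic e (pre := pre) (post := l.map (Basic.compile e) ++ post) i st hl.1
    have h2 := ih (pre := pre ++ [i.compile e]) (i.exec E st) hl.2
    have h := h1.trans (by simpa using h2)
    simp only [List.map_cons, List.cons_append, List.length_cons]
    convert h using 1
    · omega
    · simp [execAll]; congr 1; omega

/-- The step counts of `Runs` mirror the code layout: a test jumps to the true branch, while the
false branch falls through and pays for a jump over the true one; a failed loop test falls through
to an exit jump, and each round ends with a jump back. The code is position-dependent, so the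
induction lets the surrounding program vary. -/
theorem Runs.reaches {E : Env} {c : Com V} {st st' : Store V} {T : ℕ} (h : Runs E c st T st')
    {prog pre post : Program s} (hp : prog = pre ++ (c.compile e pre.length ++ post)) :
    Reaches E prog (st.config e pre.length) T (st'.config e (pre.length + c.size)) := by
  classical
  induction h generalizing pre post with
  | block l st hl => subst hp; exact reaches_block e l st hl
  | @seq a b st st' st'' T T' _ _ iha ihb =>
    have h1 := iha (pre := pre) (post := b.compile e (pre.length + a.size) ++ post)
      (by simpa [Com.compile] using hp)
    have h2 := ihb (pre := pre ++ a.compile e pre.length) (post := post)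
      (by simpa [Com.compile, Com.length_compile] using hp)
    have := h1.trans (by simpa [Com.length_compile] using h2)
    simpa [Com.size, add_assoc] using this
  | @iteTrue q a b st st' T hq _ ih =>
    have h1 := reaches_cond e (E := E) (pre := pre) (l := pre.length + 1 + b.size + 1)
      (post := b.compile e (pre.length + 1) ++ (.jump (pre.length + 1 + b.size + 1 + a.size) ::
        (a.compile e (pre.length + 1 + b.size + 1) ++ post))) q st
    rw [if_pos hq] at h1
    have h2 := ih (pre := pre ++ (q.compile e (pre.length + 1 + b.size + 1) ::
      (b.compile e (pre.length + 1) ++ [.jump (pre.length + 1 + b.size + 1 + a.size)])))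
      (post := post) (by
        rw [hp]; simp [Com.compile, Com.length_compile, add_assoc, add_comm, add_left_comm])
    have hl : (pre ++ (q.compile e (pre.length + 1 + b.size + 1) ::
      (b.compile e (pre.length + 1) ++ [.jump (pre.length + 1 + b.size + 1 + a.size)]))).length
      = pre.length + 1 + b.size + 1 := by simp [Com.length_compile]; omega
    rw [hl] at h2
    rw [hp] at h2 ⊢
    have := h1.trans (by simpa [Com.compile] using h2)
    simpa [Com.size, Com.compile, add_assoc] using this
  | @iteFalse q a b st st' T hq _ ih =>
    have h1 := reaches_cond e (E := E) (pre := pre) (l := pre.length + 1 + b.size + 1)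
      (post := b.compile e (pre.length + 1) ++ (.jump (pre.length + 1 + b.size + 1 + a.size) ::
        (a.compile e (pre.length + 1 + b.size + 1) ++ post))) q st
    rw [if_neg hq] at h1
    have h2 := ih (pre := pre ++ [q.compile e (pre.length + 1 + b.size + 1)])
      (post := .jump (pre.length + 1 + b.size + 1 + a.size) ::
        (a.compile e (pre.length + 1 + b.size + 1) ++ post)) (by
        rw [hp]; simp [Com.compile])
    have h3 := reaches_jump e (E := E) (l := pre.length + 1 + b.size + 1 + a.size)
      (pre := pre ++ (q.compile e (pre.length + 1 + b.size + 1) :: b.compile e (pre.length + 1)))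
      (post := a.compile e (pre.length + 1 + b.size + 1) ++ post) st'
    have hl : (pre ++ (q.compile e (pre.length + 1 + b.size + 1) ::
      b.compile e (pre.length + 1))).length = pre.length + 1 + b.size := by
      simp [Com.length_compile]; omega
    rw [hl] at h3
    rw [hp] at h2 ⊢
    have := (h1.trans (by simpa [Com.compile] using h2)).trans (by simpa [Com.compile] using h3)
    simpa [Com.size, Com.compile, add_assoc] using this
  | @loopEnd q a st hq =>
    have h1 := reaches_cond e (E := E) (pre := pre) (l := pre.length + 2)
      (post := .jump (pre.length + 2 + a.size + 1) :: (a.compile e (pre.length + 2) ++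
        (.jump pre.length :: post))) q st
    rw [if_neg hq] at h1
    have h2 := reaches_jump e (E := E) (l := pre.length + 2 + a.size + 1)
      (pre := pre ++ [q.compile e (pre.length + 2)])
      (post := a.compile e (pre.length + 2) ++ (.jump pre.length :: post)) st
    rw [hp]
    have := h1.trans (by simpa using h2)
    simpa [Com.size, Com.compile, add_assoc] using this
  | @loopStep q a st st' st'' T T' hq _ _ iha ihl =>
    have h1 := reaches_cond e (E := E) (pre := pre) (l := pre.length + 2)
      (post := .jump (pre.length + 2 + a.size + 1) :: (a.compile e (pre.length + 2) ++
        (.jump pre.length :: post))) q st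
    rw [if_pos hq] at h1
    have h2 := iha (pre := pre ++ [q.compile e (pre.length + 2), .jump (pre.length + 2 + a.size + 1)])
      (post := .jump pre.length :: post) (by rw [hp]; simp [Com.compile])
    have h3 := reaches_jump e (E := E) (l := pre.length)
      (pre := pre ++ (q.compile e (pre.length + 2) :: .jump (pre.length + 2 + a.size + 1) ::
        a.compile e (pre.length + 2))) (post := post) st'
    have hl : (pre ++ (q.compile e (pre.length + 2) :: .jump (pre.length + 2 + a.size + 1) ::
        a.compile e (pre.length + 2))).length = pre.length + 2 + a.size := by
      simp [Com.length_compile]; omega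
    rw [hl] at h3
    have h4 := ihl hp
    rw [hp] at h2 h4 ⊢
    have := ((h1.trans (by simpa [Com.compile] using h2)).trans
      (by simpa [Com.compile] using h3)).trans (by simpa [Com.compile] using h4)
    simpa [Com.size, Com.compile] using this

end Compile

/-! ### Total correctness with time -/

/-- The command terminates, and its running time and final store satisfy `Q`. -/
def Ends (E : Env) (c : Com V) (st : Store V) (Q : ℕ → Store V → Prop) : Prop :=
  ∃ T st', Runs E c st T st' ∧ Q T st'

theorem Ends.mono {E : Env} {c : Com V} {st : Store V} {Q Q' : ℕ → Store V → Prop}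
    (h : Ends E c st Q) (hQ : ∀ T st', Q T st' → Q' T st') : Ends E c st Q' := by
  obtain ⟨T, st', hr, hq⟩ := h
  exact ⟨T, st', hr, hQ _ _ hq⟩

theorem Ends.block {E : Env} {l : List (Basic V)} {st : Store V} {Q : ℕ → Store V → Prop}
    (hs : SafeAll E l st) (hQ : Q l.length (execAll E l st)) : Ends E (.block l) st Q :=
  ⟨_, _, .block l st hs, hQ⟩

/-- Nesting the postcondition lets proofs execute a program symbolically from left to right while
the running time accumulates. -/
theorem Ends.seq {E : Env} {a b : Com V} {st : Store V} {Q : ℕ → Store V → Prop}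
    (h : Ends E a st fun T st' => Ends E b st' fun T' => Q (T + T')) :
    Ends E (.seq a b) st Q := by
  obtain ⟨T, st', hr, T', st'', hr', hq⟩ := h
  exact ⟨_, _, hr.seq hr', hq⟩

theorem Ends.ite {E : Env} {q : Cond V} {a b : Com V} {st : Store V} {Q : ℕ → Store V → Prop}
    (ht : q.Holds st → Ends E a st fun T => Q (1 + T))
    (hf : ¬ q.Holds st → Ends E b st fun T => Q (1 + T + 1)) :
    Ends E (.ite q a b) st Q := by
  by_cases hq : q.Holds st
  · obtain ⟨T, st', hr, h⟩ := ht hq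
    exact ⟨_, _, .iteTrue hq hr, h⟩
  · obtain ⟨T, st', hr, h⟩ := hf hq
    exact ⟨_, _, .iteFalse hq hr, h⟩

/-- A loop whose invariant carries a potential that pays for every round. -/
theorem Ends.loop {E : Env} {q : Cond V} {a : Com V} {I : ℕ → Store V → Prop}
    (hI : ∀ φ st, I φ st → q.Holds st →
      Ends E a st fun T st' => ∃ φ', I φ' st' ∧ φ' + T + 2 ≤ φ)
    {φ : ℕ} {st : Store V} (h : I φ st) {Q : ℕ → Store V → Prop}
    (hQ : ∀ T φ' st', I φ' st' → ¬ q.Holds st' → T + φ' ≤ φ + 2 → Q T st') :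
    Ends E (.loop q a) st Q := by
  -- The given `Q` refers to the initial potential, which changes during the induction; it is
  -- replaced by the strongest postcondition.
  refine Ends.mono (Q := fun T st' => ∃ φ', I φ' st' ∧ ¬ q.Holds st' ∧ T + φ' ≤ φ + 2) ?_
    fun T st' ⟨φ', h1, h2, h3⟩ => hQ T φ' st' h1 h2 h3
  clear hQ
  induction φ using Nat.strong_induction_on generalizing st with
  | _ φ ih =>
    by_cases hq : q.Holds st
    · obtain ⟨T, st', hr, φ', h', hle⟩ := hI φ st h hq
      obtain ⟨T', st'', hr', φ'', h'', hq', hle'⟩ := ih φ' (by omega) h'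
      exact ⟨_, _, .loopStep hq hr hr', φ'', h'', hq', by omega⟩
    · exact ⟨2, st, .loopEnd hq, φ, h, hq, by omega⟩

/-- The machine that runs the compiled command. -/
theorem Ends.machine {s : ℕ} (e : V ≃ Fin s) {E : Env} {c : Com V} {params : List ℕ}
    {Q : ℕ → Store V → Prop}
    (h : Ends E c ⟨fun v => params.getD (e v) 0, fun _ => 0, []⟩ Q) {T : ℕ}
    (hT : ∀ T' st, Q T' st → T' ≤ T) :
    ∃ T' st, Q T' st ∧ (run (c.compile e 0) E.w E.input params T).out = st.out ∧
      Halted (c.compile e 0) (run (c.compile e 0) E.w E.input params T) ∧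
      SpaceWithin (c.compile e 0) E.w E.input params (s + E.bound) := by
  obtain ⟨T', st', hr, hq⟩ := h
  have hR := hr.reaches e (prog := c.compile e 0) (pre := []) (post := []) (by simp)
  simp only [List.length_nil, zero_add] at hR
  have hinit : (Store.config e ⟨fun v => params.getD (e v) 0, fun _ => 0, []⟩ 0 : Config s) =
      initial s params := by
    simp only [Store.config, initial]; congr 1; funext i; simp
  rw [hinit] at hR
  -- Compiled code contains no halt instruction; it stops by running past its end.
  have hhalt : current (c.compile e 0) (st'.config e c.size) = .halt := by
    simp [current, Store.config, Com.length_compile]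
  have hfix : ∀ u, (step (c.compile e 0) E.w E.input)^[u] (st'.config e c.size) =
      st'.config e c.size := fun u => Function.iterate_fixed (by rw [step, hhalt]; rfl) u
  have hafter : ∀ t, T' ≤ t → run (c.compile e 0) E.w E.input params t = st'.config e c.size := by
    intro t ht
    obtain ⟨u, rfl⟩ := Nat.exists_eq_add_of_le ht
    rw [run, add_comm, Function.iterate_add_apply, hR.1, hfix]
  refine ⟨T', st', hq, by rw [hafter T (hT _ _ hq)]; rfl, ?_, by omega, fun t x hx => ?_⟩
  · rw [hafter T (hT _ _ hq)]; exact hhalt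
  · by_cases ht : t < T'
    · have := hR.2 t ht x hx; omega
    · rw [hafter t (by omega)] at hx
      simp [Accesses, hhalt] at hx

end WordRAM

namespace PackedMatching

/-! ### Packed substrings -/

/-- The number whose base-`2 ^ c` digits are `a i, …, a (i + L - 1)`, lowest first. -/
def chunk (c : ℕ) (a : ℕ → ℕ) (i L : ℕ) : ℕ :=
  ∑ r ∈ Finset.range L, a (i + r) * 2 ^ (c * r)

theorem chunk_one (c : ℕ) (a : ℕ → ℕ) (i : ℕ) : chunk c a i 1 = a i := by simp [chunk]

theorem chunk_add (c : ℕ) (a : ℕ → ℕ) (i L L' : ℕ) :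
    chunk c a i (L + L') = chunk c a i L + 2 ^ (c * L) * chunk c a (i + L) L' := by
  simp only [chunk, Finset.sum_range_add, Finset.mul_sum]
  congr 1
  refine Finset.sum_congr rfl fun r _ => ?_
  rw [mul_add, pow_add, add_assoc]; ring

section

variable {c : ℕ} {a b : ℕ → ℕ}

theorem chunk_lt (ha : ∀ i, a i < 2 ^ c) (i L : ℕ) : chunk c a i L < 2 ^ (c * L) := by
  induction L generalizing i with
  | zero => simp [chunk]
  | succ L ih =>
    rw [chunk_add, chunk_one, mul_add, pow_add, mul_one]
    have h1 := ih i
    have h2 : a (i + L) + 1 ≤ 2 ^ c := ha _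
    nlinarith [Nat.zero_le (2 ^ (c * L))]

theorem chunk_mod (ha : ∀ i, a i < 2 ^ c) (i : ℕ) {L L' : ℕ} (h : L ≤ L') :
    chunk c a i L' % 2 ^ (c * L) = chunk c a i L := by
  obtain ⟨d, rfl⟩ := Nat.exists_eq_add_of_le h
  rw [chunk_add, Nat.add_mul_mod_self_left, Nat.mod_eq_of_lt (chunk_lt ha _ _)]

theorem chunk_div (ha : ∀ i, a i < 2 ^ c) (i : ℕ) {L L' : ℕ} (h : L ≤ L') :
    chunk c a i L' / 2 ^ (c * L) = chunk c a (i + L) (L' - L) := by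
  obtain ⟨d, rfl⟩ := Nat.exists_eq_add_of_le h
  rw [chunk_add, Nat.add_mul_div_left _ _ (by positivity), Nat.div_eq_of_lt (chunk_lt ha _ _)]
  simp

/-- Digits in a fixed base are unique. This turns one comparison of words into a comparison of
strings. -/
theorem chunk_eq_chunk (ha : ∀ i, a i < 2 ^ c) (hb : ∀ i, b i < 2 ^ c) (i j L : ℕ) :
    chunk c a i L = chunk c b j L ↔ ∀ r < L, a (i + r) = b (j + r) := by
  constructor
  · intro h r hr
    have key : ∀ (a : ℕ → ℕ), (∀ i, a i < 2 ^ c) → ∀ i,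
        chunk c a i L / 2 ^ (c * r) % 2 ^ (c * 1) = a (i + r) := by
      intro a ha i
      rw [chunk_div ha _ hr.le, chunk_mod ha _ (by omega), chunk_one]
    rw [← key a ha, ← key b hb, h]
  · intro h
    exact Finset.sum_congr rfl fun r hr => by rw [h r (Finset.mem_range.mp hr)]

theorem mod_two_pow_div_mod (x : ℕ) {N B L : ℕ} (h : B + L ≤ N) :
    x % 2 ^ N / 2 ^ B % 2 ^ L = x / 2 ^ B % 2 ^ L := by
  apply Nat.eq_of_testBit_eq
  intro j
  simp only [Nat.testBit_mod_two_pow, Nat.testBit_div_two_pow]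
  by_cases hj : j < L
  · simp [hj, show j + B < N by omega]
  · simp [hj]

/-- Fetching `L` consecutive characters from two neighbouring words. -/
theorem fetch_value (ha : ∀ i, a i < 2 ^ c) {w k i L : ℕ} (hk : 1 ≤ k) (hw : k * c ≤ w)
    (hi : i < 2 ^ w) (hL : L ≤ k) :
    ((chunk c a (i / k * k) k >>> (c * (i % k))) +
      (chunk c a ((i / k + 1) % 2 ^ w * k) k <<< (c * (k - i % k))) % 2 ^ w) % 2 ^ w
        &&& (2 ^ (c * L) - 1) = chunk c a i L := by
  have hr : i % k < k := Nat.mod_lt _ hk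
  have hik : i / k * k + i % k = i := by rw [mul_comm]; exact Nat.div_add_mod i k
  have hcL : c * L ≤ w := by nlinarith
  have hd : 2 ^ (c * L) ∣ 2 ^ w := pow_dvd_pow _ hcL
  rw [Nat.and_two_pow_sub_one_eq_mod, Nat.add_mod_mod, Nat.mod_mod_of_dvd _ hd,
    Nat.shiftRight_eq_div_pow, Nat.shiftLeft_eq, chunk_div ha _ hr.le, hik]
  -- At a word boundary the second word is shifted by all `k` fields, so it vanishes modulo `2 ^ (c
  -- * L)`, even if its index wrapped around.
  rcases Nat.eq_zero_or_pos (i % k) with h0 | h0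
  · rw [h0, Nat.sub_zero]
    have : 2 ^ (c * L) ∣ chunk c a ((i / k + 1) % 2 ^ w * k) k * 2 ^ (c * k) :=
      Dvd.dvd.mul_left (pow_dvd_pow _ (by nlinarith)) _
    rw [Nat.add_mod, Nat.mod_eq_zero_of_dvd this, add_zero, Nat.mod_mod, chunk_mod ha _ hL]
  -- Here `k ≥ 2`, so the index of the second word does not overflow.
  · have hlt : i / k + 1 < 2 ^ w := by nlinarith [Nat.zero_le (i / k)]
    rw [Nat.mod_eq_of_lt hlt]
    have hpos : (i / k + 1) * k = i + (k - i % k) := by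
      rw [add_mul]; omega
    rw [hpos, mul_comm (chunk _ _ _ k), ← chunk_add, chunk_mod ha _ (by omega)]

end

/-- The `2 * t` characters around position `q` of `p`, the positions before the start of `p`
being filled with zeros. -/
def window (c t : ℕ) (p : ℕ → ℕ) (q : ℕ) : ℕ :=
  if q < t then (chunk c p 0 (2 * t) <<< (c * (t - q))) % 2 ^ (c * (2 * t))
  else chunk c p (q - t) (2 * t)

theorem window_lt {c t : ℕ} {p : ℕ → ℕ} (hp : ∀ i, p i < 2 ^ c) (q : ℕ) :
    window c t p q < 2 ^ (c * (2 * t)) := by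
  unfold window
  split_ifs
  · exact Nat.mod_lt _ (by positivity)
  · exact chunk_lt hp _ _

/-- One window serves all shifts: a shift by `d` merely selects another field of it. The zero
filling is never seen because `d ≤ q`. -/
theorem window_shift {c t : ℕ} {p : ℕ → ℕ} (hp : ∀ i, p i < 2 ^ c) {q d L : ℕ} (hq : d ≤ q)
    (hd : d ≤ t) (hL : L ≤ t) :
    window c t p q / 2 ^ (c * (t - d)) % 2 ^ (c * L) = chunk c p (q - d) L := by
  unfold window
  split_ifs with h
  · rw [mod_two_pow_div_mod _ (by rw [← mul_add]; exact Nat.mul_le_mul_left _ (by omega)),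
      Nat.shiftLeft_eq]
    have : c * (t - d) = c * (t - q) + c * (q - d) := by rw [← mul_add]; congr 1; omega
    rw [this, pow_add, mul_comm (chunk _ _ _ _), Nat.mul_div_mul_left _ _ (by positivity),
      chunk_div hp _ (by omega), chunk_mod hp _ (by omega), zero_add]
  · rw [chunk_div hp _ (by omega), chunk_mod hp _ (by omega)]
    congr 1; omega

/-! ### Alignments of a pattern with a text -/

/-- The pattern `p`, aligned with position `s` of `f`, agrees with `f` before position `i`. -/
def Agrees (p f : ℕ → ℕ) (s i : ℕ) : Prop :=
  s ≤ i ∧ ∀ r, s + r < i → f (s + r) = p r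

section

variable {p f : ℕ → ℕ} {s s' i j : ℕ}

theorem agrees_self (p f : ℕ → ℕ) (i : ℕ) : Agrees p f i i := ⟨le_rfl, fun r hr => by omega⟩

theorem agrees_zero (p : ℕ → ℕ) (i : ℕ) : Agrees p p 0 i := ⟨Nat.zero_le _, fun r _ => by simp⟩

theorem Agrees.anti (h : Agrees p f s i) (hs : s ≤ j) (hj : j ≤ i) : Agrees p f s j :=
  ⟨hs, fun r hr => h.2 r (by omega)⟩

/-- Where one alignment agrees, the text is a copy of the pattern, so a later alignment compares the
pattern with itself. Thus `s' - s` must be a period of the matched prefix, whatever the text is. -/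
theorem Agrees.shift_iff (h : Agrees p f s i) (hs : s ≤ s') :
    Agrees p f s' i ↔ Agrees p p (s' - s) (i - s) := by
  obtain ⟨d, rfl⟩ := Nat.exists_eq_add_of_le hs
  obtain ⟨e, rfl⟩ := Nat.exists_eq_add_of_le h.1
  simp only [Agrees, Nat.add_sub_cancel_left]
  refine and_congr (by omega) (forall_congr' fun r => ?_)
  rw [show s + d + r < s + e ↔ d + r < e by omega]
  refine imp_congr_right fun hr => ?_
  rw [add_assoc, h.2 (d + r) (by omega)]

theorem agrees_add_iff (L : ℕ) (hs : s ≤ i) :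
    Agrees p f s (i + L) ↔ Agrees p f s i ∧ ∀ r < L, p (i - s + r) = f (i + r) := by
  constructor
  · intro h
    refine ⟨h.anti hs (by omega), fun r hr => ?_⟩
    have := h.2 (i - s + r) (by omega)
    rw [← this]; congr 1; omega
  · rintro ⟨h, h'⟩
    refine ⟨by omega, fun r hr => ?_⟩
    by_cases hi : s + r < i
    · exact h.2 r hi
    · have := h' (s + r - i) (by omega)
      rw [show i + (s + r - i) = s + r by omega, show i - s + (s + r - i) = r by omega] at this
      exact this.symm

end

/-! ### Borders and periods of prefixes -/

/-- `v` is the length of the longest border of the prefix of length `q` of `p` that is shorter than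
the prefix by at least `o`. -/
def Border (p : ℕ → ℕ) (o q v : ℕ) : Prop :=
  v + o ≤ q ∧ Agrees p p (q - v) q ∧ ∀ s, o ≤ s → s + v < q → ¬ Agrees p p s q

/-- The `d`-th bit of `D` tells whether `d < t` is a period of the prefix of length `q` of `p`. -/
def PeriodMask (p : ℕ → ℕ) (t q D : ℕ) : Prop :=
  ∀ d, D.testBit d ↔ d < t ∧ Agrees p p d q

theorem PeriodMask.lt {p : ℕ → ℕ} {t q D : ℕ} (h : PeriodMask p t q D) : D < 2 ^ t := by
  apply Nat.lt_pow_two_of_testBit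
  intro i hi
  rw [← Bool.not_eq_true, h i]
  omega

theorem periodMask_zero {p : ℕ → ℕ} {t : ℕ} (ht : 1 ≤ t) : PeriodMask p t 0 1 := by
  intro d
  rw [Nat.testBit_one_eq_true_iff_self_eq_zero]
  constructor
  · rintro rfl; exact ⟨ht, agrees_self _ _ _⟩
  · rintro ⟨_, h⟩; exact Nat.le_zero.mp h.1

/-- The smallest positive period is `q - v`, and a period `d ≥ q - v` corresponds to the period `d -
(q - v)` of the longest border. So the mask is that of the border, shifted, together with the
trivial period `0`. Overflowing bits lie at or above `t ≤ w` and are masked out anyway. -/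
theorem PeriodMask.of_border {p : ℕ → ℕ} {t q v D w : ℕ} (hw : t ≤ w) (hv : Border p 1 q v)
    (h : PeriodMask p t v D) :
    PeriodMask p t q ((1 ||| (D <<< (q - v)) % 2 ^ w) &&& (2 ^ t - 1)) := by
  intro d
  obtain ⟨h1, h2, h3⟩ := hv
  rw [Nat.and_two_pow_sub_one_eq_mod, Nat.testBit_mod_two_pow, Nat.testBit_or,
    Nat.testBit_mod_two_pow, Nat.testBit_shiftLeft]
  by_cases hd : d < t
  · simp only [hd, decide_true, Bool.true_and, true_and, show d < w by omega, Bool.or_eq_true,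
      Nat.testBit_one_eq_true_iff_self_eq_zero, Bool.and_eq_true, decide_eq_true_eq, ge_iff_le]
    rcases Nat.eq_zero_or_pos d with rfl | h0
    · simp [agrees_zero]
    · by_cases hqv : q - v ≤ d
      · rw [h2.shift_iff hqv, h (d - (q - v)), show q - (q - v) = v by omega]
        constructor
        · rintro (h' | h')
          · omega
          · exact h'.2.2
        · intro h'; exact Or.inr ⟨hqv, by omega, h'⟩
      · constructor
        · rintro (h' | h')
          · omega
          · exact absurd h'.1 hqv
        · intro h'; exact absurd h' (h3 d h0 (by omega))
  · simp [hd]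

/-! ### Candidates for one block of the text -/

/-- `v` is the first number from `lo` on that is at least `t` or satisfies `H`. -/
def IsFirst (H : ℕ → Prop) (lo t v : ℕ) : Prop :=
  v ≤ t ∧ (v < t → lo ≤ v ∧ H v) ∧ ∀ d, lo ≤ d → d < v → ¬ H d

/-- Shifting the pattern by `d`, which is allowed by `D`, makes its window `x` agree with the block
`u`, as far as the pattern reaches; `h` characters are left of it, or more if `h = t`. -/
def ShiftHit (c t h D x u d : ℕ) : Prop :=
  D.testBit d ∧ x / 2 ^ (c * (t - d)) % 2 ^ (c * min t (h + d)) = u % 2 ^ (c * min t (h + d))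

/-- The pattern, which starts with `y`, may start inside the block `u` at offset `d`. -/
def StartHit (c t m y u d : ℕ) : Prop :=
  u / 2 ^ (c * d) % 2 ^ (c * min m (t - d)) = y % 2 ^ (c * min m (t - d))

section

variable {c : ℕ} {p f : ℕ → ℕ}

/-- The mask settles the agreement before `i` by `Agrees.shift_iff`, and the window settles the
block. The shifted pattern has `m - q + d` characters from `i` on; capping `m - q` at `t` is
harmless because only `t` of them can meet the block. -/
theorem shiftHit_iff (hp : ∀ i, p i < 2 ^ c) (hf : ∀ i, f i < 2 ^ c) {t m s q i d D : ℕ}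
    (hi : s + q = i) (hq : q ≤ m) (hD : PeriodMask p t q D) (hs : Agrees p f s i) (hd : d < t) :
    ShiftHit c t (min t (m - q)) D (window c t p q) (chunk c f i t) d ↔
      s + d ≤ i ∧ Agrees p f (s + d) (min (i + t) (s + d + m)) := by
  have hL : min t (min t (m - q) + d) ≤ t := min_le_left _ _
  have hmin : d ≤ q → min (i + t) (s + d + m) = i + min t (min t (m - q) + d) := by
    intro h; omega
  unfold ShiftHit
  rw [hD d, chunk_mod hf _ hL]
  constructor
  · rintro ⟨⟨_, h1⟩, h2⟩
    have hdq : d ≤ q := h1.1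
    refine ⟨by omega, ?_⟩
    rw [window_shift hp hdq hd.le hL, chunk_eq_chunk hp hf] at h2
    rw [hmin hdq, agrees_add_iff _ (by omega)]
    refine ⟨(hs.shift_iff (by omega)).mpr ?_, fun r hr => ?_⟩
    · rwa [Nat.add_sub_cancel_left, ← hi, Nat.add_sub_cancel_left]
    · rw [← h2 r hr]; congr 2; omega
  · rintro ⟨h0, h1⟩
    have hdq : d ≤ q := by omega
    rw [hmin hdq, agrees_add_iff _ (by omega)] at h1
    refine ⟨⟨hd, ?_⟩, ?_⟩
    · have := (hs.shift_iff (show s ≤ s + d by omega)).mp h1.1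
      rwa [Nat.add_sub_cancel_left, ← hi, Nat.add_sub_cancel_left] at this
    · rw [window_shift hp hdq hd.le hL, chunk_eq_chunk hp hf]
      intro r hr
      rw [← h1.2 r hr]; congr 2; omega

/-- Nothing precedes such an alignment, so a prefix of the pattern is compared with the block from
offset `d` on, as far as both reach. -/
theorem startHit_iff (hp : ∀ i, p i < 2 ^ c) (hf : ∀ i, f i < 2 ^ c) {t m i d : ℕ} (hd : d ≤ t) :
    StartHit c t m (chunk c p 0 t) (chunk c f i t) d ↔
      Agrees p f (i + d) (min (i + t) (i + d + m)) := by
  have hmin : min (i + t) (i + d + m) = i + d + min m (t - d) := by omega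
  unfold StartHit
  rw [hmin, agrees_add_iff _ le_rfl, chunk_div hf _ hd, chunk_mod hf _ (min_le_right _ _),
    chunk_mod hp _ (by omega), eq_comm, chunk_eq_chunk hp hf]
  simp [agrees_self]

end

end PackedMatching

/-! ### Machine arithmetic without overflow -/

namespace WordRAM

theorem eval_add {w a b : ℕ} (h : a + b < 2 ^ w) : BinOp.eval w .add a b = a + b :=
  Nat.mod_eq_of_lt h

theorem eval_sub {w a b : ℕ} (h : b ≤ a) (ha : a < 2 ^ w) : BinOp.eval w .sub a b = a - b := by
  rw [BinOp.eval, show a + (2 ^ w - b) = a - b + 2 ^ w by omega, Nat.add_mod_right]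
  exact Nat.mod_eq_of_lt (by omega)

theorem eval_mul {w a b : ℕ} (h : a * b < 2 ^ w) : BinOp.eval w .mul a b = a * b :=
  Nat.mod_eq_of_lt h

theorem eval_div {w a b : ℕ} (h : a < 2 ^ w) : BinOp.eval w .div a b = a / b :=
  Nat.mod_eq_of_lt (lt_of_le_of_lt (Nat.div_le_self _ _) h)

theorem eval_mod {w a b : ℕ} (h : a < 2 ^ w) : BinOp.eval w .mod a b = a % b :=
  Nat.mod_eq_of_lt (lt_of_le_of_lt (Nat.mod_le _ _) h)

theorem eval_shr {w a b : ℕ} (h : a < 2 ^ w) : BinOp.eval w .shr a b = a / 2 ^ b := by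
  rw [BinOp.eval, Nat.shiftRight_eq_div_pow]
  exact Nat.mod_eq_of_lt (lt_of_le_of_lt (Nat.div_le_self _ _) h)

theorem eval_land {w a b : ℕ} (h : a < 2 ^ w) : BinOp.eval w .land a b = a &&& b :=
  Nat.mod_eq_of_lt (lt_of_le_of_lt Nat.and_le_left h)

theorem eval_shl {w a b : ℕ} (h : a * 2 ^ b < 2 ^ w) : BinOp.eval w .shl a b = a * 2 ^ b := by
  rw [BinOp.eval, Nat.shiftLeft_eq]
  exact Nat.mod_eq_of_lt h

/-- The bit mask `2 ^ b - 1` also comes out right when `2 ^ b` overflows. -/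
theorem eval_mask {w b : ℕ} (hw : 1 ≤ w) (h : b ≤ w) :
    BinOp.eval w .sub (BinOp.eval w .shl 1 b) 1 = 2 ^ b - 1 := by
  have h1 : 1 < 2 ^ w := Nat.one_lt_two_pow (by omega)
  rcases h.lt_or_eq with h | rfl
  · have := Nat.pow_lt_pow_right (a := 2) (by norm_num) h
    rw [eval_shl (by simpa using this), one_mul, eval_sub Nat.one_le_two_pow this]
  · simp only [BinOp.eval, Nat.shiftLeft_eq, one_mul, Nat.mod_self, zero_add]
    exact Nat.mod_eq_of_lt (by omega)

end WordRAM

/-! ### Registers, frame conditions and reading packed characters -/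

namespace PackedMatching

open WordRAM

/-- The registers. -/
inductive Var where
  | n | m | c | k | zero | one | t | ct | cw | maskC | maskT | maskW | maskD
  | baseD | baseJ | baseT | baseU | head | lim | base
  | f₁ | f₂ | f₃ | q | x | y | go | i | idx | d | res | u | dm | h | lo | len | z | v
  | pos | rem | more
  deriving DecidableEq

/-- The order of the constructors matters: the first four registers receive the input parameters,
and all others start as zero. -/
def Var.equiv : Var ≃ Fin 41 where
  toFun v := ⟨v.ctorIdx, by cases v <;> decide⟩
  invFun i := Var.ofNat i
  left_inv v := by cases v <;> rfl
  right_inv i := by revert i; decide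

/-- All registers outside `l` have the same content. -/
def Keeps (l : List Var) (st st' : Store Var) : Prop :=
  ∀ r, r ∉ l → st'.reg r = st.reg r

theorem Keeps.refl (l : List Var) (st : Store Var) : Keeps l st st := fun _ _ => rfl

theorem Keeps.trans {l l' L : List Var} {st st' st'' : Store Var} (h : Keeps l st st')
    (h' : Keeps l' st' st'') (hl : l ⊆ L) (hl' : l' ⊆ L) : Keeps L st st'' := fun r hr => by
  rw [h' r fun hr' => hr (hl' hr'), h r fun hr' => hr (hl hr')]

/-- The register that is written by an instruction. -/
def target : Basic Var → List Var
  | .const d _ => [d]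
  | .op _ d _ _ => [d]
  | .load d _ => [d]
  | .store _ _ => []
  | .read _ d _ => [d]
  | .report _ => []

/-- A frame rule whose premise is syntactic and can be discharged by `simp`. -/
theorem keeps_execAll (E : Env) (b : List (Basic Var)) {L : List Var} (st : Store Var)
    (h : b.flatMap target ⊆ L) : Keeps L st (execAll E b st) := by
  induction b generalizing st with
  | nil => exact Keeps.refl _ _
  | cons a b ih =>
    rw [List.flatMap_cons, List.append_subset] at h
    refine Keeps.trans (l := L) (l' := L) (fun r hr => ?_) (ih (a.exec E st) h.2) (List.Subset.refl _)
      (List.Subset.refl _)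
    cases a <;> simp only [Basic.exec, Store.set, Function.update_apply, ite_eq_right_iff] <;>
      rintro rfl <;> exact absurd (h.1 (by simp [target])) hr

/-- A problem instance on a machine: pattern `p` of length `m` and text `f` of length `n`, both
continued by arbitrary characters. -/
structure Instance (E : Env) (n m c k : ℕ) (p f : ℕ → ℕ) : Prop where
  p_lt : ∀ i, p i < 2 ^ c
  f_lt : ∀ i, f i < 2 ^ c
  pattern : ∀ j, E.input .pattern j = chunk c p (j * k) k
  text : ∀ j, E.input .text j = chunk c f (j * k) k
  one_le_c : 1 ≤ c
  one_le_k : 1 ≤ k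
  word : k * c ≤ E.w
  one_le_m : 1 ≤ m
  m_le : m ≤ n
  n_lt : n < 2 ^ E.w
  m_lt_bound : m < E.bound
  bound_le : E.bound ≤ 2 ^ E.w

/-- The registers that are set at the beginning. -/
structure Basics (n m c k : ℕ) (st : Store Var) : Prop where
  reg_n : st.reg .n = n
  reg_m : st.reg .m = m
  reg_c : st.reg .c = c
  reg_k : st.reg .k = k
  reg_zero : st.reg .zero = 0
  reg_one : st.reg .one = 1
  reg_maskC : st.reg .maskC = 2 ^ c - 1

theorem Basics.congr {n m c k : ℕ} {st st' : Store Var} (h : Basics n m c k st)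
    (h' : ∀ r ∈ [Var.n, .m, .c, .k, .zero, .one, .maskC], st'.reg r = st.reg r) :
    Basics n m c k st' := by
  simp only [List.mem_cons, List.not_mem_nil, or_false, forall_eq_or_imp, forall_eq] at h'
  obtain ⟨h1, h2, h3, h4, h5, h6, h7⟩ := h'
  exact ⟨h1 ▸ h.reg_n, h2 ▸ h.reg_m, h3 ▸ h.reg_c, h4 ▸ h.reg_k, h5 ▸ h.reg_zero, h6 ▸ h.reg_one,
    h7 ▸ h.reg_maskC⟩

theorem Instance.w_pos {E : Env} {n m c k : ℕ} {p f : ℕ → ℕ} (h : Instance E n m c k p f) :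
    1 ≤ E.w := by
  have := h.word; have := h.one_le_c; have := h.one_le_k; nlinarith

/-- Fetch the characters of an input array from position `pos` on that are covered by `mask`. -/
def fetch (x : Port) (dst pos mask : Var) : Com Var :=
  .block [.op .div .f₁ pos .k, .op .mod .f₂ pos .k, .read x dst .f₁, .op .mul .f₃ .c .f₂,
    .op .shr dst dst .f₃, .op .add .f₁ .f₁ .one, .read x .f₁ .f₁, .op .sub .f₂ .k .f₂,
    .op .mul .f₂ .c .f₂, .op .shl .f₁ .f₁ .f₂, .op .add dst dst .f₁, .op .land dst dst mask]

/-- The side conditions exclude harmful aliasing. The position register may coincide with the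
destination, since it is read before the destination is written. -/
theorem fetch_ends {E : Env} {n m c k w : ℕ} {p : ℕ → ℕ} {st : Store Var} (hB : Basics n m c k st)
    {x : Port} {dst pos mask : Var} (hw : E.w = w) (hp : ∀ i, p i < 2 ^ c)
    (hx : ∀ j, E.input x j = chunk c p (j * k) k)
    (hk : 1 ≤ k) (hc : 1 ≤ c) (hkw : k * c ≤ w)
    {i L : ℕ} (hpos : st.reg pos = i) (hi : i < 2 ^ w) (hmask : st.reg mask = 2 ^ (c * L) - 1)
    (hL : L ≤ k)
    (h1 : pos ∉ [Var.f₁, .f₂, .f₃]) (h2 : mask ∉ [dst, Var.f₁, .f₂, .f₃])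
    (h3 : dst ∉ [Var.f₁, .f₂, .f₃, .k, .c, .one])
    {Q : ℕ → Store Var → Prop}
    (hQ : ∀ st', st'.reg dst = chunk c p i L → Keeps [dst, .f₁, .f₂, .f₃] st st' →
      st'.mem = st.mem → st'.out = st.out → Q 12 st') :
    Ends E (fetch x dst pos mask) st Q := by
  subst hw
  have hkw' : k < 2 ^ E.w := lt_of_le_of_lt (by nlinarith) (Nat.lt_two_pow_self (n := E.w))
  have hck : ∀ r, r ≤ k → c * r < 2 ^ E.w := fun r hr =>
    lt_of_le_of_lt (by nlinarith) (Nat.lt_two_pow_self (n := E.w))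
  have hmod : i % k < k := Nat.mod_lt _ hk
  have hwlt : ∀ j, chunk c p j k < 2 ^ E.w := fun j =>
    lt_of_lt_of_le (chunk_lt hp j k) (Nat.pow_le_pow_right (by norm_num) (by nlinarith))
  have e1 := hck (i % k) hmod.le
  have e2 := hck (k - i % k) (Nat.sub_le _ _)
  refine Ends.block (by simp [SafeAll, Basic.Safe]) (hQ _ ?_ ?_ ?_ ?_)
  · simp only [List.mem_cons, List.not_mem_nil, or_false, not_or] at h1 h2 h3
    have key := fetch_value hp hk hkw hi hL
    have l1 := hwlt (i / k * k)
    simp only [execAll, Basic.exec, Store.set, Function.update_apply, h1, h2, h3, hB.reg_k, hB.reg_c, hB.reg_one,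
      hpos, hmask, Ne.symm h3.1, Ne.symm h3.2.1, Ne.symm h3.2.2.1, Ne.symm h3.2.2.2.1,
      Ne.symm h3.2.2.2.2.1, Ne.symm h3.2.2.2.2.2, if_true, if_false, reduceCtorEq, hx]
    rw [eval_div hi, eval_mod hi, eval_mul e1, eval_sub hmod.le hkw', eval_mul e2,
      eval_land (by exact Nat.mod_lt _ (by positivity)), ← key]
    simp only [BinOp.eval]
    rw [Nat.mod_eq_of_lt (a := _ >>> _)]
    exact lt_of_le_of_lt (Nat.shiftRight_le _ _) l1
  · intro r hr
    simp only [List.mem_cons, List.not_mem_nil, or_false, not_or] at hr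
    simp [execAll, Basic.exec, Store.set, Function.update_apply, hr]
  · simp [execAll, Basic.exec, Store.set]
  · simp [execAll, Basic.exec, Store.set]

/-- Fetch a single character. -/
theorem fetch_char_ends {E : Env} {n m c k : ℕ} {p f g : ℕ → ℕ} (hI : Instance E n m c k p f)
    {st : Store Var} (hB : Basics n m c k st) {x : Port} (hg : ∀ i, g i < 2 ^ c)
    (hx : ∀ j, E.input x j = chunk c g (j * k) k) {dst pos : Var} {i : ℕ}
    (hpos : st.reg pos = i) (hi : i < 2 ^ E.w) (h1 : pos ∉ [Var.f₁, .f₂, .f₃])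
    (h2 : Var.maskC ∉ [dst, Var.f₁, .f₂, .f₃]) (h3 : dst ∉ [Var.f₁, .f₂, .f₃, .k, .c, .one])
    {Q : ℕ → Store Var → Prop}
    (hQ : ∀ st', st'.reg dst = g i → Keeps [dst, .f₁, .f₂, .f₃] st st' →
      st'.mem = st.mem → st'.out = st.out → Q 12 st') :
    Ends E (fetch x dst pos .maskC) st Q := by
  refine fetch_ends hB rfl hg hx hI.one_le_k hI.one_le_c hI.word hpos hi (L := 1)
    (by rw [mul_one]; exact hB.reg_maskC) hI.one_le_k h1 h2 h3 ?_
  simpa only [chunk_one] using hQ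

/-! ### One step of the Knuth–Morris–Pratt automaton -/

/-- Read the character `x` in the state `q < m`, with the failure function at address `0`. -/
def advance : Com Var :=
  .seq (.block [.const .go 1])
    (.loop (.lt .zero .go)
      (.seq (fetch .pattern .y .q .maskC)
        (.ite (.eq .y .x) (.block [.op .add .q .q .one, .const .go 0])
          (.ite (.eq .q .zero) (.block [.const .go 0]) (.block [.load .q .q])))))

/-- Among the alignments from `o` on, the first one that is still possible before position `i` leaves
a matched prefix of length `q`. -/
def Leads (p g : ℕ → ℕ) (m o i q : ℕ) : Prop :=
  ∃ s, s + q = i ∧ o ≤ s ∧ Agrees p g s i ∧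
    ∀ s', o ≤ s' → s' < s → i ≤ s' + m → ¬ Agrees p g s' i

/-- The usual amortisation: following the failure function lowers `q`, and a character raises it by
at most one. The premise excludes only earlier alignments that extend beyond `i`, because after a
report the completed alignment is dropped although it agrees. The failure function is needed only up
to `q`, so that the step can be used while the table is being built. -/
theorem advance_ends {E : Env} {n m c k : ℕ} {p f : ℕ → ℕ} (hI : Instance E n m c k p f)
    {st : Store Var} (hB : Basics n m c k st) {g : ℕ → ℕ} {o i q : ℕ}
    (hx : st.reg .x = g i) (hq : st.reg .q = q) (hqm : q < m)
    (hl : ∃ s, s + q = i ∧ o ≤ s ∧ Agrees p g s i ∧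
      ∀ s', o ≤ s' → s' < s → i < s' + m → ¬ Agrees p g s' i)
    (hπ : ∀ j, 1 ≤ j → j ≤ q → Border p 1 j (st.mem j)) {Q : ℕ → Store Var → Prop}
    (hQ : ∀ T st' q', st'.reg .q = q' → q' ≤ m → Leads p g m o (i + 1) q' →
      Keeps [.q, .y, .go, .f₁, .f₂, .f₃] st st' → st'.mem = st.mem → st'.out = st.out →
      T + 20 * q' ≤ 20 * q + 43 → Q T st') :
    Ends E advance st Q := by
  have h2w : 1 < 2 ^ E.w := Nat.one_lt_two_pow (by have := hI.w_pos; omega)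
  have hmn := hI.m_le
  have hnw := hI.n_lt
  refine Ends.seq (Ends.block (by simp [SafeAll, Basic.Safe]) ?_)
  -- While `go` is set, no alignment before `s` that extends beyond `i` can also match character
  -- `i`. A unit of `q` pays for one failure step, and the 40 for the last round including the new
  -- unit of `q`.
  refine Ends.loop (φ := 20 * q + 40) (I := fun φ st' =>
    ∃ q' a, st'.reg .q = q' ∧ st'.reg .go = a ∧ φ = 20 * q' + 40 * a ∧ a ≤ 1 ∧
      Keeps [.q, .y, .go, .f₁, .f₂, .f₃] st st' ∧ st'.mem = st.mem ∧ st'.out = st.out ∧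
      (a = 0 → q' ≤ m ∧ Leads p g m o (i + 1) q') ∧
      (a = 1 → q' ≤ q ∧ ∃ s, s + q' = i ∧ o ≤ s ∧ Agrees p g s i ∧
        ∀ s', o ≤ s' → s' < s → i < s' + m → ¬ Agrees p g s' (i + 1))) ?_ ?_ ?_
  · rintro φ st' ⟨q', a, hq', ha, rfl, ha1, hK, hM, hO, -, hl'⟩ hgo
    have hz : st'.reg .zero = 0 := by rw [hK _ (by simp), hB.reg_zero]
    simp only [Cond.Holds, hz, ha] at hgo
    obtain rfl : a = 1 := by omega
    obtain ⟨hqq, s, hs, hos, hag, hno⟩ := hl' rfl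
    have hB' : Basics n m c k st' := hB.congr (by simp; simp [hK _])
    refine Ends.seq (fetch_char_ends hI hB' hI.p_lt hI.pattern hq' (by omega) (by simp) (by simp)
      (by simp) fun st₂ hy hK₂ hM₂ hO₂ => ?_)
    have hx₂ : st₂.reg .x = g i := by rw [hK₂ _ (by simp), hK _ (by simp), hx]
    have hq₂ : st₂.reg .q = q' := by rw [hK₂ _ (by simp), hq']
    have hz₂ : st₂.reg .zero = 0 := by rw [hK₂ _ (by simp), hz]
    have h1₂ : st₂.reg .one = 1 := by rw [hK₂ _ (by simp), hK _ (by simp), hB.reg_one]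
    have hKK : ∀ r, r ∉ [Var.q, .y, .go, .f₁, .f₂, .f₃] → st₂.reg r = st.reg r := by
      intro r hr
      rw [hK₂ r (by simp at hr ⊢; tauto), hK r hr]
    refine Ends.ite (fun hc => ?_) (fun hc => Ends.ite (fun hc' => ?_) (fun hc' => ?_))
    · simp only [Cond.Holds, hy, hx₂] at hc
      refine Ends.block (by simp [SafeAll, Basic.Safe]) ⟨20 * (q' + 1), ⟨q' + 1, 0, ?_, ?_, by ring, by omega,
        ?_, ?_, ?_, fun _ => ⟨by omega, s, by omega, hos, ?_, ?_⟩, by simp⟩, ?_⟩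
      · simp [execAll, Basic.exec, Store.set, hq₂, h1₂, eval_add (show q' + 1 < 2 ^ E.w by omega)]
      · simp [execAll, Basic.exec, Store.set]
      · intro r hr
        rw [← hKK r hr]
        simp only [List.mem_cons, List.not_mem_nil, or_false, not_or] at hr
        simp [execAll, Basic.exec, Store.set, hr]
      · simp [execAll, Basic.exec, Store.set, hM₂, hM]
      · simp [execAll, Basic.exec, Store.set, hO₂, hO]
      · rw [agrees_add_iff _ (by omega)]
        refine ⟨hag, fun r hr => ?_⟩
        obtain rfl : r = 0 := by omega
        rw [add_zero, add_zero, ← hc]; congr 1; omega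
      · intro s' h1 h2 h3; exact hno s' h1 h2 (by omega)
      · simp; omega
    · simp only [Cond.Holds, hy, hx₂] at hc
      simp only [Cond.Holds, hq₂, hz₂] at hc'
      subst hc'
      refine Ends.block (by simp [SafeAll, Basic.Safe]) ⟨0, ⟨0, 0, ?_, ?_, by ring, by omega,
        ?_, ?_, ?_, fun _ => ⟨by omega, i + 1, by omega, by omega, agrees_self _ _ _, ?_⟩, by simp⟩, ?_⟩
      · simp [execAll, Basic.exec, Store.set, hq₂]
      · simp [execAll, Basic.exec, Store.set]
      · intro r hr
        rw [← hKK r hr]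
        simp only [List.mem_cons, List.not_mem_nil, or_false, not_or] at hr
        simp [execAll, Basic.exec, Store.set, hr]
      · simp [execAll, Basic.exec, Store.set, hM₂, hM]
      · simp [execAll, Basic.exec, Store.set, hO₂, hO]
      · intro s' h1 h2 h3 h4
        rcases (show s' < s ∨ s' = s by omega) with h5 | rfl
        · exact hno s' h1 h5 (by omega) h4
        · have := h4.2 0 (by omega)
          rw [← this] at hc; apply hc; congr 1
      · simp
    · simp only [Cond.Holds, hy, hx₂] at hc
      simp only [Cond.Holds, hq₂, hz₂] at hc'
      have hb := hπ q' (by omega) hqq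
      set v := st.mem q' with hv
      obtain ⟨hb1, hb2, hb3⟩ := hb
      refine Ends.block ?_ ⟨20 * v + 40, ⟨v, 1, ?_, ?_, by ring, by omega,
        ?_, ?_, ?_, by simp, fun _ => ⟨by omega, i - v, by omega, by omega, ?_, ?_⟩⟩, ?_⟩
      · simp [SafeAll, Basic.Safe, hq₂]; have := hI.m_lt_bound; omega
      · simp [execAll, Basic.exec, Store.set, hq₂, hM₂, hM, hv]
      · simp [execAll, Basic.exec, Store.set, hK₂ .go (by simp), ha]
      · intro r hr
        rw [← hKK r hr]
        simp only [List.mem_cons, List.not_mem_nil, or_false, not_or] at hr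
        simp [execAll, Basic.exec, Store.set, hr]
      · simp [execAll, Basic.exec, Store.set, hM₂, hM]
      · simp [execAll, Basic.exec, Store.set, hO₂, hO]
      · rw [hag.shift_iff (by omega), show i - v - s = q' - v by omega, show i - s = q' by omega]
        exact hb2
      · intro s' h1 h2 h3 h4
        rcases (show s' < s ∨ s' = s ∨ s < s' by omega) with h5 | rfl | h5
        · exact hno s' h1 h5 h3 h4
        · have := h4.2 q' (by omega)
          rw [← this] at hc; apply hc; congr 1
        -- An alignment strictly between the old one and the new one would give a longer border.
        · refine hb3 (s' - s) (by omega) (by omega) ?_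
          have := (hag.shift_iff h5.le).mp (h4.anti (by omega) (by omega))
          rwa [show i - s = q' by omega] at this
      · simp; omega
  · obtain ⟨s, hs, hos, hag, hno⟩ := hl
    refine ⟨q, 1, ?_, ?_, by ring, by omega, ?_, ?_, ?_, by simp, fun _ => ⟨le_rfl, s, hs, hos, hag,
      fun s' h1 h2 h3 h4 => hno s' h1 h2 h3 (h4.anti (by omega) (by omega))⟩⟩
    · simp [execAll, Basic.exec, Store.set, hq]
    · simp [execAll, Basic.exec, Store.set, Nat.mod_eq_of_lt h2w]
    · intro r hr
      simp only [List.mem_cons, List.not_mem_nil, or_false, not_or] at hr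
      simp [execAll, Basic.exec, Store.set, hr]
    · simp [execAll, Basic.exec, Store.set]
    · simp [execAll, Basic.exec, Store.set]
  · rintro T φ' st' ⟨q', a, hq', ha, rfl, ha1, hK, hM, hO, hfin, -⟩ hgo hT
    have hz : st'.reg .zero = 0 := by rw [hK _ (by simp), hB.reg_zero]
    simp only [Cond.Holds, hz, ha] at hgo
    obtain rfl : a = 0 := by omega
    obtain ⟨h1, h2⟩ := hfin rfl
    exact hQ _ st' q' hq' h1 h2 hK hM hO (by simp; omega)

/-! ### Border tables -/

/-- Borders of prefixes are the states of the automaton when the pattern is matched against itself,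
with only alignments from `o` on admitted. -/
theorem border_iff_leads {p : ℕ → ℕ} {m o i q : ℕ} (hi : i ≤ m) :
    Border p o i q ↔ Leads p p m o i q := by
  constructor
  · rintro ⟨h1, h2, h3⟩
    exact ⟨i - q, by omega, by omega, h2, fun s' h h' _ => h3 s' h (by omega)⟩
  · rintro ⟨s, rfl, h2, h3, h4⟩
    exact ⟨by omega, by simpa using h3, fun s' h h' => h4 s' h (by omega) (by omega)⟩

/-- Store, for all prefixes of length at least `i`, the longest border that is shorter than the
prefix by at least the initial value of `i`. -/
def borderTable : Com Var :=
  .seq (.block [.const .q 0, .op .add .f₁ .base .i, .store .f₁ .zero])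
    (.loop (.lt .i .m)
      (.seq (fetch .pattern .x .i .maskC)
        (.seq advance
          (.block [.op .add .i .i .one, .op .add .f₁ .base .i, .store .f₁ .q]))))

/-- With `o = 1` this is the failure function, which reads the table while building it; with `o = t`
it gives the fallbacks of the block search and reads the finished failure function. If `o > m`, one
entry is still written, at `bs + o`, hence the maximum in the memory bound. -/
theorem borderTable_ends {E : Env} {n m c k : ℕ} {p f : ℕ → ℕ} (hI : Instance E n m c k p f)
    {st : Store Var} (hB : Basics n m c k st) {o bs : ℕ} (hi : st.reg .i = o)
    (hbs : st.reg .base = bs) (ho : 1 ≤ o) (hb : bs + max o m < E.bound)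
    (hπ : (bs = 0 ∧ o = 1) ∨ (m < bs ∧ ∀ j, 1 ≤ j → j ≤ m → Border p 1 j (st.mem j)))
    {Q : ℕ → Store Var → Prop}
    (hQ : ∀ T st', (∀ j, o ≤ j → j ≤ m → Border p o j (st'.mem (bs + j))) →
      (∀ a, a < bs + o ∨ bs + max o m < a → st'.mem a = st.mem a) →
      Keeps [.q, .x, .y, .go, .i, .f₁, .f₂, .f₃] st st' → st'.out = st.out →
      T ≤ 60 * m + 5 → Q T st') :
    Ends E borderTable st Q := by
  have hbw := hI.bound_le
  have hnw := hI.n_lt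
  have hmn := hI.m_le
  have hadd : BinOp.eval E.w .add bs o = bs + o := eval_add (by omega)
  refine Ends.seq (Ends.block ?_ ?_)
  · simp [hbs, hi, hadd]; omega
  refine Ends.loop (I := fun φ st' =>
    ∃ i q, st'.reg .i = i ∧ st'.reg .q = q ∧ φ = 60 * (m - i) + 20 * q ∧ o ≤ i ∧
      (i = o ∨ i ≤ m) ∧ Border p o i q ∧
      (∀ j, o ≤ j → j ≤ i → Border p o j (st'.mem (bs + j))) ∧
      (∀ a, a < bs + o ∨ bs + i < a → st'.mem a = st.mem a) ∧
      Keeps [.q, .x, .y, .go, .i, .f₁, .f₂, .f₃] st st' ∧ st'.out = st.out)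
    (φ := 60 * (m - o)) ?_ ?_ ?_
  · rintro φ st₁ ⟨i, q, hi₁, hq₁, rfl, hoi, him, hbo, htab, hmem, hK, hO⟩ hc
    have hB₁ : Basics n m c k st₁ := hB.congr (by simp; simp [hK _])
    simp only [Cond.Holds, hi₁, hB₁.reg_m] at hc
    refine Ends.seq (fetch_char_ends hI hB₁ hI.p_lt hI.pattern hi₁ (by omega) (by simp) (by simp)
      (by simp) fun st₂ hx₂ hK₂ hM₂ hO₂ => ?_)
    have hB₂ : Basics n m c k st₂ := hB₁.congr (by simp; simp [hK₂ _])
    have hπ₂ : ∀ j, 1 ≤ j → j ≤ q → Border p 1 j (st₂.mem j) := by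
      intro j hj hjq
      rw [hM₂]
      have hqi := hbo.1
      -- In the first case the entries up to `q` are already there because a border is shorter than
      -- its prefix by at least `o = 1`.
      rcases hπ with ⟨rfl, rfl⟩ | ⟨h1, h2⟩
      · simpa using htab j hj (by omega)
      · rw [hmem j (by omega)]; exact h2 j hj (by omega)
    refine Ends.seq (advance_ends hI hB₂ hx₂ (by rw [hK₂ _ (by simp), hq₁])
      (by have := hbo.1; omega) (o := o) ?_ hπ₂ ?_)
    · obtain ⟨s, h1, h2, h3, h4⟩ := (border_iff_leads hc.le).mp hbo
      exact ⟨s, h1, h2, h3, fun s' h h' h'' => h4 s' h h' h''.le⟩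
    intro T st₃ q' hq₃ hq'm hl₃ hK₃ hM₃ hO₃ hT
    have hi₃ : st₃.reg .i = i := by rw [hK₃ _ (by simp), hK₂ _ (by simp), hi₁]
    have h1₃ : st₃.reg .one = 1 := by rw [hK₃ _ (by simp), hB₂.reg_one]
    have hbs₃ : st₃.reg .base = bs := by
      rw [hK₃ _ (by simp), hK₂ _ (by simp), hK _ (by simp), hbs]
    have e1 : BinOp.eval E.w .add i 1 = i + 1 := eval_add (by omega)
    have e2 : BinOp.eval E.w .add bs (i + 1) = bs + (i + 1) := eval_add (by omega)
    have hbo₃ : Border p o (i + 1) q' := (border_iff_leads (m := m) (by omega)).mpr hl₃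
    refine Ends.block ?_ ⟨60 * (m - (i + 1)) + 20 * q', ⟨i + 1, q', ?_, ?_, rfl, by omega, by omega, hbo₃,
      ?_, ?_, ?_, ?_⟩, ?_⟩
    · simp [hi₃, h1₃, hbs₃, e1, e2]; omega
    · simp [hi₃, h1₃, e1]
    · simp [hq₃]
    · intro j hj hj'
      simp only [execAll, Basic.exec, Store.set, Function.update_apply, hi₃, h1₃, hbs₃, e1, e2, hq₃,
        reduceCtorEq, if_true, if_false]
      split_ifs with h
      · obtain rfl : j = i + 1 := by omega
        exact hbo₃
      · rw [hM₃, hM₂]; exact htab j hj (by omega)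
    · intro a ha
      simp only [execAll, Basic.exec, Store.set, Function.update_apply, hi₃, h1₃, hbs₃, e1, e2, hq₃,
        reduceCtorEq, if_true, if_false]
      rw [if_neg (by omega), hM₃, hM₂, hmem a (by omega)]
    · exact (hK.trans hK₂ (L := [.q, .x, .y, .go, .i, .f₁, .f₂, .f₃]) (by simp) (by simp)).trans
        (hK₃.trans (keeps_execAll E _ st₃ (L := [.q, .x, .y, .go, .i, .f₁, .f₂, .f₃]) (by simp [target]))
          (L := [.q, .x, .y, .go, .i, .f₁, .f₂, .f₃]) (by simp) (by simp)) (by simp) (by simp)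
    · simp [hO₃, hO₂, hO]
    · simp; omega
  · refine ⟨o, 0, by simp [hi], by simp, by ring, le_rfl, Or.inl rfl, ?_, ?_, ?_, ?_, by simp⟩
    · exact ⟨by omega, by simpa using agrees_self p p o, fun s h h' => by omega⟩
    · intro j h1 h2
      obtain rfl : j = o := by omega
      simp only [execAll, Basic.exec, Store.set, Function.update_apply, hi, hbs, hadd,
        reduceCtorEq, if_true, if_false, hB.reg_zero]
      exact ⟨by omega, by simpa using agrees_self p p j, fun s h h' => by omega⟩
    · intro a ha
      simp only [execAll, Basic.exec, Store.set, Function.update_apply, hi, hbs, hadd,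
        reduceCtorEq, if_true, if_false, hB.reg_zero]
      rw [if_neg (by omega)]
    · exact keeps_execAll E _ st (by simp [target])
  · rintro T φ' st' ⟨i, q, hi₁, hq₁, rfl, hoi, him, hbo, htab, hmem, hK, hO⟩ hc hT
    have hm : st'.reg .m = m := by rw [hK _ (by simp), hB.reg_m]
    simp only [Cond.Holds, hi₁, hm] at hc
    refine hQ _ _ (fun j h1 h2 => htab j h1 (by omega)) (fun a ha => hmem a (by omega)) hK hO ?_
    simp; omega

/-! ### Period masks -/

/-- Store the period masks of all prefixes. -/
def periodTable : Com Var :=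
  .seq (.block [.store .baseD .one, .const .i 0])
    (.loop (.lt .i .m)
      (.block [.op .add .i .i .one, .load .x .i, .op .sub .y .i .x, .op .add .x .x .baseD,
        .load .x .x, .op .shl .x .x .y, .op .lor .x .one .x, .op .land .x .x .maskD,
        .op .add .y .baseD .i, .store .y .x]))

/-- The mask of each prefix comes from that of its longest border, already stored, by a constant
number of word operations (`PeriodMask.of_border`). -/
theorem periodTable_ends {E : Env} {n m c k : ℕ} {p f : ℕ → ℕ} (hI : Instance E n m c k p f)
    {st : Store Var} (hB : Basics n m c k st) {t : ℕ} (ht : 1 ≤ t) (htw : t ≤ E.w)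
    (hb : 2 * m + 1 < E.bound)
    (hD : st.reg .baseD = m + 1) (hmD : st.reg .maskD = 2 ^ t - 1)
    (hπ : ∀ j, 1 ≤ j → j ≤ m → Border p 1 j (st.mem j))
    {Q : ℕ → Store Var → Prop}
    (hQ : ∀ T st', (∀ j, j ≤ m → PeriodMask p t j (st'.mem (m + 1 + j))) →
      (∀ a, a ≤ m → st'.mem a = st.mem a) →
      Keeps [.x, .y, .i] st st' → st'.out = st.out → T ≤ 12 * m + 4 → Q T st') :
    Ends E periodTable st Q := by
  have hbw := hI.bound_le
  have h2w : 1 < 2 ^ E.w := Nat.one_lt_two_pow (by have := hI.w_pos; omega)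
  refine Ends.seq (Ends.block (by simp [hD]; omega) ?_)
  refine Ends.loop (φ := 12 * m) (I := fun φ st' =>
    ∃ i, st'.reg .i = i ∧ φ = 12 * (m - i) ∧ i ≤ m ∧
      (∀ j, j ≤ i → PeriodMask p t j (st'.mem (m + 1 + j))) ∧
      (∀ a, a ≤ m → st'.mem a = st.mem a) ∧
      Keeps [.x, .y, .i] st st' ∧ st'.out = st.out) ?_ ?_ ?_
  · rintro φ st₁ ⟨i, hi₁, rfl, him, htab, hmem, hK, hO⟩ hc
    have hB₁ : Basics n m c k st₁ := hB.congr (by simp; simp [hK _])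
    simp only [Cond.Holds, hi₁, hB₁.reg_m] at hc
    have hb1 := hπ (i + 1) (by omega) (by omega)
    rw [← hmem (i + 1) (by omega)] at hb1
    have hv := hb1.1
    have hPM := htab _ (show st₁.mem (i + 1) ≤ i by omega)
    have hnew := PeriodMask.of_border htw hb1 hPM
    have e1 : BinOp.eval E.w .add i 1 = i + 1 := eval_add (by omega)
    have e2 : BinOp.eval E.w .sub (i + 1) (st₁.mem (i + 1)) = i + 1 - st₁.mem (i + 1) :=
      eval_sub (by omega) (by omega)
    have e3 : BinOp.eval E.w .add (st₁.mem (i + 1)) (m + 1) = m + 1 + st₁.mem (i + 1) := by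
      rw [add_comm (m + 1)]; exact eval_add (by omega)
    have e4 : BinOp.eval E.w .add (m + 1) (i + 1) = m + 1 + (i + 1) := eval_add (by omega)
    have hD₁ : st₁.reg .baseD = m + 1 := by rw [hK _ (by simp), hD]
    have hmD₁ : st₁.reg .maskD = 2 ^ t - 1 := by rw [hK _ (by simp), hmD]
    have e5 : BinOp.eval E.w .land (BinOp.eval E.w .lor 1 (BinOp.eval E.w .shl
        (st₁.mem (m + 1 + st₁.mem (i + 1))) (i + 1 - st₁.mem (i + 1)))) (2 ^ t - 1) =
        (1 ||| (st₁.mem (m + 1 + st₁.mem (i + 1)) <<< (i + 1 - st₁.mem (i + 1))) % 2 ^ E.w)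
          &&& (2 ^ t - 1) := by
      have hor : 1 ||| (st₁.mem (m + 1 + st₁.mem (i + 1)) <<< (i + 1 - st₁.mem (i + 1))) % 2 ^ E.w
          < 2 ^ E.w := Nat.or_lt_two_pow h2w (Nat.mod_lt _ (by positivity))
      rw [eval_land (by exact Nat.mod_lt _ (by positivity))]
      simp only [BinOp.eval]
      rw [Nat.mod_eq_of_lt hor]
    refine Ends.block ?_ ⟨12 * (m - (i + 1)), ⟨i + 1, ?_, rfl, by omega, ?_, ?_, ?_, ?_⟩, ?_⟩
    · simp [hi₁, hB₁.reg_one, hD₁, e1, e2, e3, e4]; omega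
    · simp [hi₁, hB₁.reg_one, e1]
    · intro j hj
      simp only [execAll, Basic.exec, Store.set, Function.update_apply, hi₁, hB₁.reg_one, hD₁, hmD₁,
        e1, e2, e3, e4, e5, reduceCtorEq, if_true, if_false]
      split_ifs with h
      · obtain rfl : j = i + 1 := by omega
        exact hnew
      · exact htab j (by omega)
    · intro a ha
      simp only [execAll, Basic.exec, Store.set, Function.update_apply, hi₁, hB₁.reg_one, hD₁, hmD₁,
        e1, e2, e3, e4, e5, reduceCtorEq, if_true, if_false]
      rw [if_neg (by omega), hmem a ha]
    · exact hK.trans (keeps_execAll E _ st₁ (L := [.x, .y, .i]) (by simp [target])) (by simp)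
        (by simp)
    · simp [hO]
    · simp; omega
  · refine ⟨0, by simp, by simp, by omega, ?_, ?_, keeps_execAll E _ st (by simp [target]), by simp⟩
    · intro j hj
      obtain rfl : j = 0 := by omega
      simpa [hD, hB.reg_one] using periodMask_zero ht
    · intro a ha
      simp only [execAll, Basic.exec, Store.set, Function.update_apply, hD]
      rw [if_neg (by omega)]
  · rintro T φ' st' ⟨i, hi₁, rfl, him, htab, hmem, hK, hO⟩ hc hT
    have hm : st'.reg .m = m := by rw [hK _ (by simp), hB.reg_m]
    simp only [Cond.Holds, hi₁, hm] at hc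
    refine hQ _ _ (fun j h => htab j (by omega)) hmem hK hO ?_
    simp; omega

/-! ### The list of occurrences -/

/-- An occurrence of `p`, of length `m`, at position `s` of the text `f` of length `n`. -/
def Occurs (p f : ℕ → ℕ) (n m s : ℕ) : Prop :=
  Agrees p f s (s + m) ∧ s + m ≤ n

open Classical in
/-- The occurrences before position `S`, in increasing order. -/
noncomputable def occList (p f : ℕ → ℕ) (n m S : ℕ) : List ℕ :=
  (List.range S).filter fun s => Occurs p f n m s

theorem occList_succ (p f : ℕ → ℕ) (n m S : ℕ) [Decidable (Occurs p f n m S)] :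
    occList p f n m (S + 1) =
      if Occurs p f n m S then occList p f n m S ++ [S] else occList p f n m S := by
  simp only [occList, List.range_succ, List.filter_append, List.filter_singleton]
  split_ifs <;> simp_all

/-- Skipping dead alignments does not change the required output; this is how every search proof
justifies moving its alignment forward. -/
theorem occList_eq_of_le {p f : ℕ → ℕ} {n m S S' : ℕ} (h : S ≤ S')
    (hn : ∀ s, S ≤ s → s < S' → ¬ Occurs p f n m s) :
    occList p f n m S' = occList p f n m S := by
  classical
  induction S', h using Nat.le_induction with
  | base => rfl
  | succ S' h ih =>
    rw [occList_succ, if_neg (hn S' h (by omega)), ih fun s h1 h2 => hn s h1 (by omega)]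

/-! ### The Knuth–Morris–Pratt algorithm -/

/-- Search character by character, with the failure function at address `0`. -/
def charSearch : Com Var :=
  .seq (.block [.const .i 0, .const .q 0])
    (.loop (.lt .i .n)
      (.seq (fetch .text .x .i .maskC)
        (.seq advance
          (.seq (.block [.op .add .i .i .one])
            (.ite (.eq .q .m) (.block [.op .sub .y .i .m, .report .y, .load .q .m])
              (.block []))))))

/-- The potential gives 62 units to each unread character and 20 to each matched one, so failure
steps and reports are paid for in advance. The state is kept below `m` by passing to the longest
border after a report. -/
theorem charSearch_ends {E : Env} {n m c k : ℕ} {p f : ℕ → ℕ} (hI : Instance E n m c k p f)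
    {st : Store Var} (hB : Basics n m c k st)
    (hπ : ∀ j, 1 ≤ j → j ≤ m → Border p 1 j (st.mem j)) (hout : st.out = [])
    {Q : ℕ → Store Var → Prop}
    (hQ : ∀ T st', st'.out = occList p f n m (n + 1) → T ≤ 62 * n + 4 → Q T st') :
    Ends E charSearch st Q := by
  classical
  have hbw := hI.bound_le
  have hnw := hI.n_lt
  have hmn := hI.m_le
  have hm1 := hI.one_le_m
  refine Ends.seq (Ends.block (by simp) ?_)
  refine Ends.loop (I := fun φ st' =>
    ∃ i q s, st'.reg .i = i ∧ st'.reg .q = q ∧ φ = 62 * (n - i) + 20 * q ∧ i ≤ n ∧ q < m ∧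
      s + q = i ∧ Agrees p f s i ∧ (∀ s' < s, i < s' + m → ¬ Agrees p f s' i) ∧
      st'.out = occList p f n m s ∧ st'.mem = st.mem ∧
      Keeps [.q, .x, .y, .go, .i, .f₁, .f₂, .f₃] st st') (φ := 62 * n) ?_ ?_ ?_
  · rintro φ st₁ ⟨i, q, s, hi₁, hq₁, rfl, hin, hqm, hsi, hag, hno, hO, hM, hK⟩ hc
    have hB₁ : Basics n m c k st₁ := hB.congr (by simp; simp [hK _])
    simp only [Cond.Holds, hi₁, hB₁.reg_n] at hc
    refine Ends.seq (fetch_char_ends hI hB₁ hI.f_lt hI.text hi₁ (by omega) (by simp) (by simp)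
      (by simp) fun st₂ hx₂ hK₂ hM₂ hO₂ => ?_)
    have hB₂ : Basics n m c k st₂ := hB₁.congr (by simp; simp [hK₂ _])
    refine Ends.seq (advance_ends hI hB₂ hx₂ (by rw [hK₂ _ (by simp), hq₁]) hqm (o := 0)
      ⟨s, hsi, by omega, hag, fun s' _ => hno s'⟩
      (fun j h1 h2 => by rw [hM₂, hM]; exact hπ j h1 (by omega)) ?_)
    rintro T st₃ q' hq₃ hq'm ⟨s₃, hs₃, -, hag₃, hno₃⟩ hK₃ hM₃ hO₃ hT
    have hi₃ : st₃.reg .i = i := by rw [hK₃ _ (by simp), hK₂ _ (by simp), hi₁]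
    have h1₃ : st₃.reg .one = 1 := by rw [hK₃ _ (by simp), hB₂.reg_one]
    have hm₃ : st₃.reg .m = m := by rw [hK₃ _ (by simp), hB₂.reg_m]
    have e1 : BinOp.eval E.w .add i 1 = i + 1 := eval_add (by omega)
    have e2 : m ≤ i + 1 → BinOp.eval E.w .sub (i + 1) m = i + 1 - m := fun h =>
      eval_sub h (by omega)
    -- Excluded alignments stay excluded, so the alignment never moves back.
    have hss : s ≤ s₃ := by
      by_contra hlt
      exact hno s₃ (by omega) (by omega) (hag₃.anti (by omega) (by omega))
    have hout₃ : occList p f n m s₃ = occList p f n m s := by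
      refine occList_eq_of_le hss fun s' h1 h2 h3 => ?_
      exact hno₃ s' (by omega) h2 (by omega) (h3.1.anti (by omega) (by omega))
    have hKK : Keeps [.q, .x, .y, .go, .i, .f₁, .f₂, .f₃] st st₃ :=
      (hK.trans hK₂ (L := [.q, .x, .y, .go, .i, .f₁, .f₂, .f₃]) (by simp) (by simp)).trans
        hK₃ (by simp) (by simp)
    refine Ends.seq (Ends.block (by simp) (Ends.ite (fun hc' => ?_) (fun hc' => ?_)))
    · simp [hq₃, hm₃] at hc'
      subst hc'
      have hb := hπ q' hm1 le_rfl
      set v := st.mem q' with hv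
      obtain ⟨hb1, hb2, hb3⟩ := hb
      refine Ends.block ?_ ⟨62 * (n - (i + 1)) + 20 * v, ⟨i + 1, v, i + 1 - v, ?_, ?_, rfl,
        by omega, by omega, by omega, ?_, ?_, ?_, ?_, ?_⟩, ?_⟩
      · simp [hm₃]; exact hI.m_lt_bound
      · simp [hi₃, h1₃, e1]
      · simp [hm₃, hM₃, hM₂, hM, hv]
      · rw [hag₃.shift_iff (by omega), show i + 1 - v - s₃ = q' - v by omega,
          show i + 1 - s₃ = q' by omega]
        exact hb2
      · intro s' h1 h2 h3
        rcases (show s' < s₃ ∨ s₃ < s' by omega) with h5 | h5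
        · exact hno₃ s' (by omega) h5 h2.le h3
        · refine hb3 (s' - s₃) (by omega) (by omega) ?_
          have := (hag₃.shift_iff h5.le).mp h3
          rwa [show i + 1 - s₃ = q' by omega] at this
      -- The next occurrence overlaps this one in at most its longest border.
      · have hstep : occList p f n q' (i + 1 - v) = occList p f n q' (s₃ + 1) := by
          refine occList_eq_of_le (by omega) fun s' h1 h2 h3 => ?_
          refine hb3 (s' - s₃) (by omega) (by omega) ?_
          have := (hag₃.shift_iff (show s₃ ≤ s' by omega)).mp (h3.1.anti (by omega) (by omega))
          rwa [show i + 1 - s₃ = q' by omega] at this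
        rw [hstep, occList_succ, if_pos ⟨by rwa [hs₃], by omega⟩, hout₃, ← hO]
        simp [hi₃, h1₃, hm₃, e1, e2 (by omega), hO₃, hO₂]
        omega
      · simp [hM₃, hM₂, hM]
      · exact hKK.trans (l' := [.q, .y, .i]) (fun r hr => by
          simp only [List.mem_cons, List.not_mem_nil, or_false, not_or] at hr; simp [hr])
          (by simp) (by simp)
      · simp; omega
    · simp [hq₃, hm₃] at hc'
      refine Ends.block (by simp) ⟨62 * (n - (i + 1)) + 20 * q', ⟨i + 1, q', s₃, ?_, ?_, rfl,
        by omega, by omega, by omega, hag₃, ?_, ?_, ?_, ?_⟩, ?_⟩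
      · simp [hi₃, h1₃, e1]
      · simp [hq₃]
      · exact fun s' h1 h2 => hno₃ s' (by omega) h1 h2.le
      · rw [hout₃, ← hO]; simp [hO₃, hO₂]
      · simp [hM₃, hM₂, hM]
      · exact hKK.trans (l' := [.i]) (fun r hr => by
          simp only [List.mem_cons, List.not_mem_nil, or_false] at hr; simp [hr])
          (by simp) (by simp)
      · simp; omega
  · refine ⟨0, 0, 0, by simp, by simp, by simp, by omega, by omega, rfl, agrees_self _ _ _, by simp,
      by simp [hout, occList], by simp, keeps_execAll E _ st (by simp [target])⟩
  · rintro T φ' st' ⟨i, q, s, hi₁, hq₁, rfl, hin, hqm, hsi, hag, hno, hO, hM, hK⟩ hc hT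
    have hn : st'.reg .n = n := by rw [hK _ (by simp), hB.reg_n]
    simp only [Cond.Holds, hi₁, hn] at hc
    refine hQ _ _ ?_ (by simp; omega)
    rw [hO]
    refine (occList_eq_of_le (by omega) fun s' h1 h2 h3 => ?_).symm
    have := h3.2
    omega

/-! ### Tabulation -/

/-- Compute in `res` the first `d < t` for which `hit` sets `res`, and `t` if there is none. -/
def firstHit (hit : Com Var) : Com Var :=
  .seq (.block [.op .add .res .zero .t, .op .add .d .zero .t])
    (.loop (.lt .zero .d) (.seq (.block [.op .sub .d .d .one]) hit))

/-- The candidates are tested downwards, so the last one written to `res` is the smallest. -/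
theorem firstHit_ends {E : Env} {hit : Com Var} {G : ℕ → Prop} {t K : ℕ} {L : List Var}
    {st : Store Var} (hz : st.reg .zero = 0) (h1 : st.reg .one = 1) (ht : st.reg .t = t)
    (htw : t < 2 ^ E.w) (hL : .d ∉ L ∧ .zero ∉ L ∧ .one ∉ L)
    (hhit : ∀ st' d, Keeps (.d :: .res :: L) st st' → st'.reg .d = d → d < t →
      Ends E hit st' fun T st'' => (G d → st''.reg .res = d) ∧
        (¬ G d → st''.reg .res = st'.reg .res) ∧ Keeps (.res :: L) st' st'' ∧
        st''.mem = st'.mem ∧ st''.out = st'.out ∧ T ≤ K)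
    {Q : ℕ → Store Var → Prop}
    (hQ : ∀ T st', IsFirst G 0 t (st'.reg .res) → Keeps (.d :: .res :: L) st st' →
      st'.mem = st.mem → st'.out = st.out → T ≤ (K + 3) * t + 4 → Q T st') :
    Ends E (firstHit hit) st Q := by
  have e0 : BinOp.eval E.w .add 0 t = t := by rw [eval_add] <;> omega
  refine Ends.seq (Ends.block (by simp) ?_)
  refine Ends.loop (I := fun φ st' => ∃ d, st'.reg .d = d ∧ d ≤ t ∧ φ = (K + 3) * d ∧
      st'.reg .res ≤ t ∧ (st'.reg .res < t → d ≤ st'.reg .res ∧ G (st'.reg .res)) ∧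
      (∀ a, d ≤ a → a < st'.reg .res → ¬ G a) ∧ Keeps (.d :: .res :: L) st st' ∧
      st'.mem = st.mem ∧ st'.out = st.out) (φ := (K + 3) * t) ?_ ?_ ?_
  · rintro φ st₁ ⟨d, hd₁, hdt, rfl, hr1, hr2, hr3, hK, hM, hO⟩ hc
    have hz₁ : st₁.reg .zero = 0 := by rw [hK _ (by simp [hL]), hz]
    have h1₁ : st₁.reg .one = 1 := by rw [hK _ (by simp [hL]), h1]
    simp only [Cond.Holds, hz₁, hd₁] at hc
    have e1 : BinOp.eval E.w .sub d 1 = d - 1 := eval_sub (by omega) (by omega)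
    refine Ends.seq (Ends.block (by simp) ?_)
    have hK₂ : Keeps (.d :: .res :: L) st
        (execAll E [Basic.op .sub .d .d .one] st₁) :=
      hK.trans (keeps_execAll E _ st₁ (L := [.d]) (by simp [target])) (by simp) (by simp)
    refine (hhit _ (d - 1) hK₂ (by simp [hd₁, h1₁, e1]) (by omega)).mono ?_
    rintro T st₃ ⟨hG, hnG, hK₃, hM₃, hO₃, hT⟩
    refine ⟨(K + 3) * (d - 1), ⟨d - 1, ?_, by omega, rfl, ?_⟩, ?_⟩
    · rw [hK₃ _ (by simp [hL])]; simp [hd₁, h1₁, e1]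
    · have hrest : Keeps (.d :: .res :: L) st st₃ ∧ st₃.mem = st.mem ∧ st₃.out = st.out :=
        ⟨hK₂.trans hK₃ (List.Subset.refl _) (List.subset_cons_self _ _), by simp [hM₃, hM],
          by simp [hO₃, hO]⟩
      by_cases hg : G (d - 1)
      · rw [hG hg]
        exact ⟨by omega, fun _ => ⟨le_rfl, hg⟩, fun a h1 h2 => by omega, hrest⟩
      · have hres : st₃.reg .res = st₁.reg .res := by rw [hnG hg]; simp
        rw [hres]
        refine ⟨hr1, fun h => ⟨by have := (hr2 h).1; omega, (hr2 h).2⟩, fun a h1 h2 => ?_, hrest⟩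
        rcases (show a = d - 1 ∨ d ≤ a by omega) with rfl | h3
        · exact hg
        · exact hr3 a h3 h2
    · obtain ⟨d, rfl⟩ : ∃ d', d = d' + 1 := ⟨d - 1, by omega⟩
      simp only [List.length_cons, List.length_nil, Nat.add_sub_cancel, mul_add]
      omega
  · refine ⟨t, by simp [hz, ht, e0], le_rfl, rfl, by simp [hz, ht, e0],
      by simp [hz, ht, e0], fun a h2 h3 => ?_, ?_, by simp, by simp⟩
    · simp [hz, ht, e0] at h3; omega
    · exact keeps_execAll E _ st (by simp [target])
  · rintro T φ' st' ⟨d, hd₁, hdt, rfl, hr1, hr2, hr3, hK, hM, hO⟩ hc hT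
    have hz₁ : st'.reg .zero = 0 := by rw [hK _ (by simp [hL]), hz]
    simp only [Cond.Holds, hz₁, hd₁] at hc
    obtain rfl : d = 0 := by omega
    exact hQ _ _ ⟨hr1, fun h => hr2 h, fun a _ => hr3 a (by omega)⟩ hK hM hO (by simp; omega)

/-- Fill a table at address `base` with the results of `entry` for all `idx < lim`. -/
def fill (entry : Com Var) : Com Var :=
  .seq (.block [.const .idx 0])
    (.loop (.lt .idx .lim)
      (.seq entry (.block [.op .add .f₁ .base .idx, .store .f₁ .res, .op .add .idx .idx .one])))

theorem fill_ends {E : Env} {entry : Com Var} {R : ℕ → ℕ → Prop} {bs N K : ℕ} {L : List Var}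
    {st : Store Var} (h1 : st.reg .one = 1) (hbs : st.reg .base = bs) (hN : st.reg .lim = N)
    (hb : bs + N ≤ E.bound) (hbw : E.bound ≤ 2 ^ E.w) (hNw : N < 2 ^ E.w)
    (hL : .idx ∉ L ∧ .one ∉ L ∧ .base ∉ L ∧ .lim ∉ L)
    (hentry : ∀ st' a, Keeps (.idx :: .f₁ :: L) st st' → st'.reg .idx = a → a < N →
      Ends E entry st' fun T st'' => R a (st''.reg .res) ∧ Keeps L st' st'' ∧
        st''.mem = st'.mem ∧ st''.out = st'.out ∧ T ≤ K)
    {Q : ℕ → Store Var → Prop}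
    (hQ : ∀ T st', (∀ a < N, R a (st'.mem (bs + a))) → (∀ a < bs, st'.mem a = st.mem a) →
      Keeps (.idx :: .f₁ :: L) st st' → st'.out = st.out → T ≤ (K + 5) * N + 3 → Q T st') :
    Ends E (fill entry) st Q := by
  refine Ends.seq (Ends.block (by simp) ?_)
  refine Ends.loop (I := fun φ st' => ∃ a, st'.reg .idx = a ∧ a ≤ N ∧ φ = (K + 5) * (N - a) ∧
      (∀ j < a, R j (st'.mem (bs + j))) ∧ (∀ j < bs, st'.mem j = st.mem j) ∧
      Keeps (.idx :: .f₁ :: L) st st' ∧ st'.out = st.out) (φ := (K + 5) * N) ?_ ?_ ?_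
  · rintro φ st₁ ⟨a, ha₁, haN, rfl, htab, hM, hK, hO⟩ hc
    have hN₁ : st₁.reg .lim = N := by rw [hK _ (by simp [hL]), hN]
    simp only [Cond.Holds, hN₁, ha₁] at hc
    refine Ends.seq ((hentry st₁ a hK ha₁ hc).mono ?_)
    rintro T st₂ ⟨hR, hK₂, hM₂, hO₂, hT⟩
    have hKK : Keeps (.idx :: .f₁ :: L) st st₂ :=
      hK.trans hK₂ (List.Subset.refl _) 
        (fun r hr => List.mem_cons_of_mem _ (List.mem_cons_of_mem _ hr))
    have h1₂ : st₂.reg .one = 1 := by rw [hKK _ (by simp [hL]), h1]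
    have hbs₂ : st₂.reg .base = bs := by rw [hKK _ (by simp [hL]), hbs]
    have ha₂ : st₂.reg .idx = a := by rw [hK₂ _ (by simp [hL]), ha₁]
    have e1 : BinOp.eval E.w .add bs a = bs + a := eval_add (by omega)
    have e2 : BinOp.eval E.w .add a 1 = a + 1 := eval_add (by omega)
    refine Ends.block ?_ ⟨(K + 5) * (N - (a + 1)), ⟨a + 1, ?_, by omega, rfl, ?_, ?_, ?_, ?_⟩, ?_⟩
    · simp [hbs₂, ha₂, e1]; omega
    · simp [h1₂, ha₂, e2]
    · intro j hj
      simp only [execAll, Basic.exec, Store.set, Function.update_apply, hbs₂, ha₂, e1,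
        reduceCtorEq, if_true, if_false]
      split_ifs with h
      · obtain rfl : j = a := by omega
        exact hR
      · rw [hM₂]; exact htab j (by omega)
    · intro j hj
      simp only [execAll, Basic.exec, Store.set, Function.update_apply, hbs₂, ha₂, e1,
        reduceCtorEq, if_true, if_false]
      rw [if_neg (by omega), hM₂, hM j hj]
    · exact hKK.trans (keeps_execAll E _ st₂ (L := [.idx, .f₁]) (by simp [target]))
        (List.Subset.refl _) (by simp)
    · simp [hO₂, hO]
    · obtain ⟨e, rfl⟩ : ∃ e, N = a + 1 + e := ⟨N - (a + 1), by omega⟩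
      rw [Nat.add_sub_cancel_left, show a + 1 + e - a = e + 1 by omega, mul_add]
      simp; omega
  · exact ⟨0, by simp, by omega, by simp, by simp, by simp,
      keeps_execAll E _ st (by simp [target]), by simp⟩
  · rintro T φ' st' ⟨a, ha₁, haN, rfl, htab, hM, hK, hO⟩ hc hT
    have hN₁ : st'.reg .lim = N := by rw [hK _ (by simp [hL]), hN]
    simp only [Cond.Holds, hN₁, ha₁] at hc
    exact hQ _ _ (fun j hj => htab j (by omega)) hM hK hO (by simp; omega)

/-! ### The tables for blocks of `t` characters -/

/-- Size of the table of shifts, indexed by `h`, the mask, the window and the block. -/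
def shiftSize (c t : ℕ) : ℕ := 2 ^ (c * t + c * (2 * t) + t + t)

/-- Size of the table of starts, indexed by a lower bound and the block. -/
def startSize (c t : ℕ) : ℕ := 2 ^ (c * t + t)

/-- The block length `t` is admissible and the tables fit into the memory. -/
structure Fits (E : Env) (m k c t : ℕ) : Prop where
  one_le_t : 1 ≤ t
  two_t_le : 2 * t ≤ k
  bound_eq : E.bound = 3 * (m + 1) + shiftSize c t + startSize c t

/-- The registers that are set before the tables are computed. -/
structure Layout (m c t : ℕ) (p : ℕ → ℕ) (st : Store Var) : Prop where
  reg_t : st.reg .t = t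
  reg_ct : st.reg .ct = c * t
  reg_cw : st.reg .cw = c * (2 * t)
  reg_maskT : st.reg .maskT = 2 ^ (c * t) - 1
  reg_maskW : st.reg .maskW = 2 ^ (c * (2 * t)) - 1
  reg_maskD : st.reg .maskD = 2 ^ t - 1
  reg_baseD : st.reg .baseD = m + 1
  reg_baseJ : st.reg .baseJ = 2 * (m + 1)
  reg_baseT : st.reg .baseT = 3 * (m + 1)
  reg_baseU : st.reg .baseU = 3 * (m + 1) + shiftSize c t
  reg_head : st.reg .head = chunk c p 0 t

theorem Layout.congr {m c t : ℕ} {p : ℕ → ℕ} {st st' : Store Var} (h : Layout m c t p st)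
    (h' : ∀ r ∈ [Var.t, .ct, .cw, .maskT, .maskW, .maskD, .baseD, .baseJ, .baseT, .baseU, .head],
      st'.reg r = st.reg r) : Layout m c t p st' := by
  simp only [List.mem_cons, List.not_mem_nil, or_false, forall_eq_or_imp, forall_eq] at h'
  obtain ⟨h1, h2, h3, h4, h5, h6, h7, h8, h9, h10, h11⟩ := h'
  exact ⟨h1 ▸ h.reg_t, h2 ▸ h.reg_ct, h3 ▸ h.reg_cw, h4 ▸ h.reg_maskT, h5 ▸ h.reg_maskW,
    h6 ▸ h.reg_maskD, h7 ▸ h.reg_baseD, h8 ▸ h.reg_baseJ, h9 ▸ h.reg_baseT, h10 ▸ h.reg_baseU,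
    h11 ▸ h.reg_head⟩

section

variable {E : Env} {n m c k t : ℕ} {p f : ℕ → ℕ}

theorem Instance.mul_lt (hI : Instance E n m c k p f) {r : ℕ} (hr : r ≤ k) :
    c * r ≤ E.w ∧ c * r < 2 ^ E.w := by
  have h : c * r ≤ E.w := by nlinarith [hI.word]
  exact ⟨h, lt_of_le_of_lt h Nat.lt_two_pow_self⟩

theorem Fits.two_t_le_word (hI : Instance E n m c k p f) (hF : Fits E m k c t) : 2 * t ≤ E.w := by
  have := hF.two_t_le; have := hI.word; have := hI.one_le_c; nlinarith

theorem Fits.two_pow_add_lt (hI : Instance E n m c k p f) (hF : Fits E m k c t) :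
    2 ^ t + t < 2 ^ E.w := by
  have h1 := hF.two_t_le_word hI
  have h2 := hF.one_le_t
  have h3 : 2 ^ (t + 1) ≤ 2 ^ E.w := Nat.pow_le_pow_right (by norm_num) (by omega)
  have h4 : t < 2 ^ t := Nat.lt_two_pow_self
  rw [pow_succ] at h3
  omega

theorem Fits.t_lt (hI : Instance E n m c k p f) (hF : Fits E m k c t) : t < 2 ^ E.w :=
  lt_of_le_of_lt (Nat.le_add_left _ _) (hF.two_pow_add_lt hI)

/-- Replace `dst` by its minimum with `lim`. -/
def cap (dst lim : Var) : Com Var :=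
  .ite (.lt lim dst) (.block [.op .add dst .zero lim]) (.block [])

theorem cap_ends {dst lim : Var} {st : Store Var} (hz : st.reg .zero = 0)
    (hl : st.reg lim < 2 ^ E.w) {Q : ℕ → Store Var → Prop}
    (hQ : ∀ st', st'.reg dst = min (st.reg lim) (st.reg dst) → Keeps [dst] st st' →
      st'.mem = st.mem → st'.out = st.out → Q 2 st') :
    Ends E (cap dst lim) st Q := by
  have e : BinOp.eval E.w .add 0 (st.reg lim) = st.reg lim := by rw [eval_add] <;> omega
  refine Ends.ite (fun hc => Ends.block (by simp) (hQ _ ?_ ?_ ?_ ?_))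
    (fun hc => Ends.block (by simp) (hQ _ ?_ (Keeps.refl _ _) rfl rfl))
  · simp only [Cond.Holds] at hc
    simp [hz, e]; omega
  · exact keeps_execAll E _ st (by simp [target])
  · simp
  · simp
  · simp only [Cond.Holds] at hc
    simp; omega

/-- Set `res` to `d` if the shift by `d` fits. -/
def shiftTest : Com Var :=
  .seq (.block [.op .add .len .h .d])
    (.seq (cap .len .t)
      (.seq (.block [.op .sub .y .t .d, .op .mul .y .c .y, .op .shr .y .x .y, .op .mul .len .c .len,
          .op .shl .z .one .len, .op .sub .z .z .one, .op .land .y .y .z, .op .land .z .u .z,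
          .op .shr .len .dm .d, .op .land .len .len .one])
        (.ite (.eq .y .z)
          (.ite (.eq .len .one) (.block [.op .add .res .zero .d]) (.block []))
          (.block []))))

/-- The table is filled for every index, including combinations that no state produces. Hence the
arguments are arbitrary numbers of the right size and need not come from a pattern. -/
theorem shiftTest_ends (hI : Instance E n m c k p f) (hF : Fits E m k c t) {st : Store Var}
    (hB : Basics n m c k st) (hl : st.reg .t = t) {h D x u d : ℕ} (hh : st.reg .h = h)
    (hD : st.reg .dm = D) (hx : st.reg .x = x) (hu : st.reg .u = u) (hd : st.reg .d = d)
    (hdt : d < t) (hhw : h < 2 ^ t) (hDw : D < 2 ^ E.w) (hxw : x < 2 ^ E.w) (huw : u < 2 ^ E.w) :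
    Ends E shiftTest st fun T st' => (ShiftHit c t h D x u d → st'.reg .res = d) ∧
      (¬ ShiftHit c t h D x u d → st'.reg .res = st.reg .res) ∧
      Keeps (.res :: [.len, .z, .y]) st st' ∧ st'.mem = st.mem ∧ st'.out = st.out ∧ T ≤ 18 := by
  have hw := hF.two_pow_add_lt hI
  have htw := hF.t_lt hI
  have htk : t ≤ k := by have := hF.two_t_le; omega
  have hw1 := hI.w_pos
  have hdw : d < 2 ^ E.w := by omega
  have e1 : BinOp.eval E.w .add h d = h + d := eval_add (by omega)
  have e3 : BinOp.eval E.w .sub t d = t - d := eval_sub hdt.le (by omega)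
  have e4 : BinOp.eval E.w .mul c (t - d) = c * (t - d) := eval_mul (hI.mul_lt (by omega)).2
  have e5 : BinOp.eval E.w .add 0 d = d := by rw [eval_add] <;> omega
  have hxw' : x / 2 ^ (c * (t - d)) < 2 ^ E.w := lt_of_le_of_lt (Nat.div_le_self _ _) hxw
  have hDw' : D / 2 ^ d < 2 ^ E.w := lt_of_le_of_lt (Nat.div_le_self _ _) hDw
  have hbit : D / 2 ^ d &&& 1 = 1 ↔ D.testBit d := by
    rw [Nat.and_one_is_mod, Nat.testBit_eq_decide_div_mod_eq, decide_eq_true_iff]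
  refine Ends.seq (Ends.block (by simp) (Ends.seq (cap_ends (by simp [hB.reg_zero])
    (by simp [hl]; omega) fun st₂ hlen hK₂ hM₂ hO₂ => ?_)))
  replace hK₂ : Keeps [.len] st st₂ :=
    (keeps_execAll E _ st (L := [.len]) (by simp [target])).trans hK₂ (by simp) (by simp)
  replace hM₂ : st₂.mem = st.mem := by simp [hM₂]
  replace hO₂ : st₂.out = st.out := by simp [hO₂]
  simp [hl, hh, hd, e1] at hlen
  set L := min t (h + d) with hL
  have e6 : BinOp.eval E.w .mul c L = c * L := eval_mul (hI.mul_lt (by omega)).2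
  have e7 := eval_mask hw1 (hI.mul_lt (show L ≤ k by omega)).1
  have r1 : st₂.reg .t = t := by rw [hK₂ _ (by simp), hl]
  have r2 : st₂.reg .d = d := by rw [hK₂ _ (by simp), hd]
  have r3 : st₂.reg .c = c := by rw [hK₂ _ (by simp), hB.reg_c]
  have r4 : st₂.reg .x = x := by rw [hK₂ _ (by simp), hx]
  have r5 : st₂.reg .one = 1 := by rw [hK₂ _ (by simp), hB.reg_one]
  have r6 : st₂.reg .u = u := by rw [hK₂ _ (by simp), hu]
  have r7 : st₂.reg .dm = D := by rw [hK₂ _ (by simp), hD]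
  have r8 : st₂.reg .zero = 0 := by rw [hK₂ _ (by simp), hB.reg_zero]
  have r9 : st₂.reg .res = st.reg .res := hK₂ _ (by simp)
  have hiff : ShiftHit c t h D x u d ↔ D / 2 ^ d &&& 1 = 1 ∧
      x / 2 ^ (c * (t - d)) &&& 2 ^ (c * L) - 1 = u &&& 2 ^ (c * L) - 1 := by
    rw [hbit, Nat.and_two_pow_sub_one_eq_mod, Nat.and_two_pow_sub_one_eq_mod]; rfl
  refine Ends.seq (Ends.block (by simp) ?_)
  set st₃ := execAll E [Basic.op .sub .y .t .d, .op .mul .y .c .y, .op .shr .y .x .y,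
          .op .mul .len .c .len, .op .shl .z .one .len, .op .sub .z .z .one, .op .land .y .y .z,
          .op .land .z .u .z, .op .shr .len .dm .d, .op .land .len .len .one] st₂ with hst₃
  have hK₃ : Keeps (.res :: [.len, .z, .y]) st st₃ :=
    hK₂.trans (keeps_execAll E _ st₂ (L := [.len, .z, .y]) (by simp [target])) (by simp) (by simp)
  have s1 : st₃.reg .y = x / 2 ^ (c * (t - d)) &&& 2 ^ (c * L) - 1 := by
    simp [hst₃, r1, r2, r3, r4, r5, e3, e4, e6, e7, hlen, eval_shr hxw, eval_land hxw']
  have s2 : st₃.reg .z = u &&& 2 ^ (c * L) - 1 := by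
    simp [hst₃, r3, r5, r6, e6, e7, hlen, eval_land huw]
  have s3 : st₃.reg .len = D / 2 ^ d &&& 1 := by
    simp [hst₃, r2, r5, r7, eval_shr hDw, eval_land hDw']
  have s4 : st₃.reg .one = 1 := by simp [hst₃, r5]
  have s5 : st₃.reg .zero = 0 := by simp [hst₃, r8]
  have s6 : st₃.reg .d = d := by simp [hst₃, r2]
  have s7 : st₃.reg .res = st.reg .res := by simp [hst₃, r9]
  have s8 : st₃.mem = st.mem := by simp [hst₃, hM₂]
  have s9 : st₃.out = st.out := by simp [hst₃, hO₂]
  clear_value st₃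
  refine Ends.ite (fun hc => Ends.ite (fun hc' => ?_) (fun hc' => ?_)) (fun hc => ?_)
  · simp only [Cond.Holds, s1, s2] at hc
    simp only [Cond.Holds, s3, s4] at hc'
    exact Ends.block (by simp) ⟨fun _ => by simp [s5, s6, e5],
      fun hn => absurd (hiff.mpr ⟨hc', hc⟩) hn,
      hK₃.trans (keeps_execAll E _ st₃ (L := [.res]) (by simp [target])) (by simp) (by simp),
      by simp [s8], by simp [s9], by simp⟩
  · simp only [Cond.Holds, s3, s4] at hc'
    exact Ends.block (by simp) ⟨fun hn => absurd (hiff.mp hn).1 hc', fun _ => by simp [s7],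
      hK₃, by simp [s8], by simp [s9], by simp⟩
  · simp only [Cond.Holds, s1, s2] at hc
    exact Ends.block (by simp) ⟨fun hn => absurd (hiff.mp hn).2 hc, fun _ => by simp [s7],
      hK₃, by simp [s8], by simp [s9], by simp⟩

/-- Set `res` to `d` if the pattern may start at offset `d`, at least `lo`, of the block. -/
def startTest : Com Var :=
  .seq (.block [.op .sub .len .t .d])
    (.seq (cap .len .m)
      (.seq (.block [.op .mul .y .c .d, .op .shr .y .u .y, .op .mul .len .c .len,
          .op .shl .z .one .len, .op .sub .z .z .one, .op .land .y .y .z, .op .land .z .head .z])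
        (.ite (.eq .y .z)
          (.ite (.lt .d .lo) (.block []) (.block [.op .add .res .zero .d]))
          (.block []))))

theorem startTest_ends (hI : Instance E n m c k p f) (hF : Fits E m k c t) {st : Store Var}
    (hB : Basics n m c k st) (hl : st.reg .t = t) {a x u d : ℕ} (ha : st.reg .lo = a)
    (hx : st.reg .head = x) (hu : st.reg .u = u) (hd : st.reg .d = d)
    (hdt : d < t) (hxw : x < 2 ^ E.w) (huw : u < 2 ^ E.w) :
    Ends E startTest st fun T st' => (a ≤ d ∧ StartHit c t m x u d → st'.reg .res = d) ∧
      (¬ (a ≤ d ∧ StartHit c t m x u d) → st'.reg .res = st.reg .res) ∧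
      Keeps (.res :: [.len, .z, .y]) st st' ∧ st'.mem = st.mem ∧ st'.out = st.out ∧ T ≤ 18 := by
  have hw := hF.two_pow_add_lt hI
  have htw := hF.t_lt hI
  have htk : t ≤ k := by have := hF.two_t_le; omega
  have hw1 := hI.w_pos
  have hnw := hI.n_lt
  have hmn := hI.m_le
  have e3 : BinOp.eval E.w .sub t d = t - d := eval_sub hdt.le (by omega)
  have e4 : BinOp.eval E.w .mul c d = c * d := eval_mul (hI.mul_lt (by omega)).2
  have e5 : BinOp.eval E.w .add 0 d = d := by rw [eval_add] <;> omega
  have huw' : u / 2 ^ (c * d) < 2 ^ E.w := lt_of_le_of_lt (Nat.div_le_self _ _) huw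
  refine Ends.seq (Ends.block (by simp) (Ends.seq (cap_ends (by simp [hB.reg_zero])
    (by simp [hB.reg_m]; omega) fun st₂ hlen hK₂ hM₂ hO₂ => ?_)))
  replace hK₂ : Keeps [.len] st st₂ :=
    (keeps_execAll E _ st (L := [.len]) (by simp [target])).trans hK₂ (by simp) (by simp)
  replace hM₂ : st₂.mem = st.mem := by simp [hM₂]
  replace hO₂ : st₂.out = st.out := by simp [hO₂]
  simp [hl, hd, hB.reg_m, e3] at hlen
  set L := min m (t - d) with hL
  have e6 : BinOp.eval E.w .mul c L = c * L := eval_mul (hI.mul_lt (by omega)).2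
  have e7 := eval_mask hw1 (hI.mul_lt (show L ≤ k by omega)).1
  have r2 : st₂.reg .d = d := by rw [hK₂ _ (by simp), hd]
  have r3 : st₂.reg .c = c := by rw [hK₂ _ (by simp), hB.reg_c]
  have r4 : st₂.reg .head = x := by rw [hK₂ _ (by simp), hx]
  have r5 : st₂.reg .one = 1 := by rw [hK₂ _ (by simp), hB.reg_one]
  have r6 : st₂.reg .u = u := by rw [hK₂ _ (by simp), hu]
  have r7 : st₂.reg .lo = a := by rw [hK₂ _ (by simp), ha]
  have r8 : st₂.reg .zero = 0 := by rw [hK₂ _ (by simp), hB.reg_zero]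
  have r9 : st₂.reg .res = st.reg .res := hK₂ _ (by simp)
  have hiff : StartHit c t m x u d ↔
      u / 2 ^ (c * d) &&& 2 ^ (c * L) - 1 = x &&& 2 ^ (c * L) - 1 := by
    rw [Nat.and_two_pow_sub_one_eq_mod, Nat.and_two_pow_sub_one_eq_mod]; rfl
  refine Ends.seq (Ends.block (by simp) ?_)
  set st₃ := execAll E [Basic.op .mul .y .c .d, .op .shr .y .u .y, .op .mul .len .c .len,
      .op .shl .z .one .len, .op .sub .z .z .one, .op .land .y .y .z, .op .land .z .head .z] st₂
    with hst₃
  have hK₃ : Keeps (.res :: [.len, .z, .y]) st st₃ :=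
    hK₂.trans (keeps_execAll E _ st₂ (L := [.len, .z, .y]) (by simp [target])) (by simp) (by simp)
  have s1 : st₃.reg .y = u / 2 ^ (c * d) &&& 2 ^ (c * L) - 1 := by
    simp [hst₃, r2, r3, r5, r6, e4, e6, e7, hlen, eval_shr huw, eval_land huw']
  have s2 : st₃.reg .z = x &&& 2 ^ (c * L) - 1 := by
    simp [hst₃, r3, r4, r5, e6, e7, hlen, eval_land hxw]
  have s4 : st₃.reg .lo = a := by simp [hst₃, r7]
  have s5 : st₃.reg .zero = 0 := by simp [hst₃, r8]
  have s6 : st₃.reg .d = d := by simp [hst₃, r2]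
  have s7 : st₃.reg .res = st.reg .res := by simp [hst₃, r9]
  have s8 : st₃.mem = st.mem := by simp [hst₃, hM₂]
  have s9 : st₃.out = st.out := by simp [hst₃, hO₂]
  clear_value st₃
  refine Ends.ite (fun hc => Ends.ite (fun hc' => ?_) (fun hc' => ?_)) (fun hc => ?_)
  · simp only [Cond.Holds, s4, s6] at hc'
    exact Ends.block (by simp) ⟨fun hn => by omega, fun _ => by simp [s7],
      hK₃, by simp [s8], by simp [s9], by simp⟩
  · simp only [Cond.Holds, s1, s2] at hc
    simp only [Cond.Holds, s4, s6] at hc'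
    exact Ends.block (by simp) ⟨fun _ => by simp [s5, s6, e5],
      fun hn => absurd ⟨by omega, hiff.mpr hc⟩ hn,
      hK₃.trans (keeps_execAll E _ st₃ (L := [.res]) (by simp [target])) (by simp) (by simp),
      by simp [s8], by simp [s9], by simp⟩
  · simp only [Cond.Holds, s1, s2] at hc
    exact Ends.block (by simp) ⟨fun hn => absurd (hiff.mp hn.2) hc, fun _ => by simp [s7],
      hK₃, by simp [s8], by simp [s9], by simp⟩

/-- What the entry number `a` of the table of shifts says. -/
def ShiftEntry (c t a r : ℕ) : Prop :=
  IsFirst (ShiftHit c t (a / 2 ^ (c * t) / 2 ^ (c * (2 * t)) / 2 ^ t)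
    (a / 2 ^ (c * t) / 2 ^ (c * (2 * t)) % 2 ^ t) (a / 2 ^ (c * t) % 2 ^ (c * (2 * t)))
    (a % 2 ^ (c * t))) 0 t r

/-- What the entry number `a` of the table of starts says. -/
def StartEntry (c t m y a r : ℕ) : Prop :=
  IsFirst (StartHit c t m y (a % 2 ^ (c * t))) (a / 2 ^ (c * t)) t r

/-- From the lowest bits on, an index consists of the block, the window, the mask and the number of
characters left. -/
def shiftEntry : Com Var :=
  .seq (.block [.op .land .u .idx .maskT, .op .shr .z .idx .ct, .op .land .x .z .maskW,
      .op .shr .z .z .cw, .op .land .dm .z .maskD, .op .shr .h .z .t])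
    (firstHit shiftTest)

def startEntry : Com Var :=
  .seq (.block [.op .land .u .idx .maskT, .op .shr .lo .idx .ct]) (firstHit startTest)

theorem shiftEntry_ends (hI : Instance E n m c k p f) (hF : Fits E m k c t) {st : Store Var}
    (hB : Basics n m c k st) (hl : Layout m c t p st) {a : ℕ} (ha : st.reg .idx = a)
    (haN : a < shiftSize c t) :
    Ends E shiftEntry st fun T st' => ShiftEntry c t a (st'.reg .res) ∧
      Keeps [.u, .z, .x, .dm, .h, .lo, .d, .res, .len, .y] st st' ∧ st'.mem = st.mem ∧
      st'.out = st.out ∧ T ≤ 21 * t + 10 := by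
  have hw := hF.two_pow_add_lt hI
  have htw := hF.t_lt hI
  have hNw : shiftSize c t ≤ 2 ^ E.w := by have := hF.bound_eq; have := hI.bound_le; omega
  have haw : a < 2 ^ E.w := by omega
  have hdiv : ∀ x y : ℕ, x < 2 ^ E.w → x / y < 2 ^ E.w := fun x y h =>
    lt_of_le_of_lt (Nat.div_le_self _ _) h
  have hmod : ∀ x y : ℕ, x < 2 ^ E.w → x % y < 2 ^ E.w := fun x y h =>
    lt_of_le_of_lt (Nat.mod_le _ _) h
  have ha1 := hdiv _ (2 ^ (c * t)) haw
  have ha2 := hdiv _ (2 ^ (c * (2 * t))) ha1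
  have hh : a / 2 ^ (c * t) / 2 ^ (c * (2 * t)) / 2 ^ t < 2 ^ t := by
    rw [Nat.div_div_eq_div_mul, Nat.div_div_eq_div_mul, Nat.div_lt_iff_lt_mul (by positivity),
      ← pow_add, ← pow_add, ← pow_add]
    refine haN.trans_le (le_of_eq ?_)
    rw [shiftSize]; congr 1; ring
  refine Ends.seq (Ends.block (by simp) ?_)
  set st₁ := execAll E [Basic.op .land .u .idx .maskT, .op .shr .z .idx .ct, .op .land .x .z .maskW,
      .op .shr .z .z .cw, .op .land .dm .z .maskD, .op .shr .h .z .t] st with hst₁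
  have hK₁ : Keeps [.u, .z, .x, .dm, .h] st st₁ := keeps_execAll E _ st (by simp [target])
  have hB₁ : Basics n m c k st₁ := hB.congr (by simp; simp [hK₁ _])
  have r1 : st₁.reg .t = t := by rw [hK₁ _ (by simp), hl.reg_t]
  have r2 : st₁.reg .u = a % 2 ^ (c * t) := by
    simp [hst₁, ha, hl.reg_maskT, eval_land haw, Nat.and_two_pow_sub_one_eq_mod]
  have r3 : st₁.reg .x = a / 2 ^ (c * t) % 2 ^ (c * (2 * t)) := by
    simp [hst₁, ha, hl.reg_ct, hl.reg_maskW, eval_shr haw, eval_land ha1,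
      Nat.and_two_pow_sub_one_eq_mod]
  have r4 : st₁.reg .dm = a / 2 ^ (c * t) / 2 ^ (c * (2 * t)) % 2 ^ t := by
    simp [hst₁, ha, hl.reg_ct, hl.reg_cw, hl.reg_maskD, eval_shr haw, eval_shr ha1, eval_land ha2,
      Nat.and_two_pow_sub_one_eq_mod]
  have r5 : st₁.reg .h = a / 2 ^ (c * t) / 2 ^ (c * (2 * t)) / 2 ^ t := by
    simp [hst₁, ha, hl.reg_ct, hl.reg_cw, hl.reg_t, eval_shr haw, eval_shr ha1, eval_shr ha2]
  have s8 : st₁.mem = st.mem := by simp [hst₁]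
  have s9 : st₁.out = st.out := by simp [hst₁]
  clear_value st₁
  refine firstHit_ends (L := [.len, .z, .y]) (K := 18) hB₁.reg_zero hB₁.reg_one r1 (by omega)
    (by simp) ?_ ?_
    (G := ShiftHit c t (a / 2 ^ (c * t) / 2 ^ (c * (2 * t)) / 2 ^ t)
    (a / 2 ^ (c * t) / 2 ^ (c * (2 * t)) % 2 ^ t) (a / 2 ^ (c * t) % 2 ^ (c * (2 * t)))
    (a % 2 ^ (c * t)))
  · intro st' d hK' hd hdt
    exact shiftTest_ends hI hF (hB₁.congr (by simp; simp [hK' _])) (by rw [hK' _ (by simp), r1])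
      (by rw [hK' _ (by simp), r5]) (by rw [hK' _ (by simp), r4]) (by rw [hK' _ (by simp), r3])
      (by rw [hK' _ (by simp), r2]) hd hdt hh (hmod _ _ ha2) (hmod _ _ ha1) (hmod _ _ haw)
  · intro T st' hf hK' hM' hO' hT
    exact ⟨hf, hK₁.trans hK' (by simp) (by simp), by rw [hM', s8], by rw [hO', s9], by simp; omega⟩

theorem startEntry_ends (hI : Instance E n m c k p f) (hF : Fits E m k c t) {st : Store Var}
    (hB : Basics n m c k st) (hl : Layout m c t p st) {a : ℕ} (ha : st.reg .idx = a)
    (haN : a < startSize c t) :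
    Ends E startEntry st fun T st' => StartEntry c t m (chunk c p 0 t) a (st'.reg .res) ∧
      Keeps [.u, .z, .x, .dm, .h, .lo, .d, .res, .len, .y] st st' ∧ st'.mem = st.mem ∧
      st'.out = st.out ∧ T ≤ 21 * t + 10 := by
  have hw := hF.two_pow_add_lt hI
  have htw := hF.t_lt hI
  have hNw : startSize c t ≤ 2 ^ E.w := by have := hF.bound_eq; have := hI.bound_le; omega
  have haw : a < 2 ^ E.w := by omega
  refine Ends.seq (Ends.block (by simp) ?_)
  set st₁ := execAll E [Basic.op .land .u .idx .maskT, .op .shr .lo .idx .ct] st with hst₁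
  have hK₁ : Keeps [.u, .lo] st st₁ := keeps_execAll E _ st (by simp [target])
  have hB₁ : Basics n m c k st₁ := hB.congr (by simp; simp [hK₁ _])
  have r1 : st₁.reg .t = t := by rw [hK₁ _ (by simp), hl.reg_t]
  have r2 : st₁.reg .u = a % 2 ^ (c * t) := by
    simp [hst₁, ha, hl.reg_maskT, eval_land haw, Nat.and_two_pow_sub_one_eq_mod]
  have r3 : st₁.reg .lo = a / 2 ^ (c * t) := by
    simp [hst₁, ha, hl.reg_ct, eval_shr haw]
  have r4 : st₁.reg .head = chunk c p 0 t := by rw [hK₁ _ (by simp), hl.reg_head]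
  have s8 : st₁.mem = st.mem := by simp [hst₁]
  have s9 : st₁.out = st.out := by simp [hst₁]
  clear_value st₁
  have hcw : chunk c p 0 t < 2 ^ E.w := (chunk_lt hI.p_lt 0 t).trans_le
    (Nat.pow_le_pow_right (by norm_num) (hI.mul_lt (by have := hF.two_t_le; omega)).1)
  refine firstHit_ends (L := [.len, .z, .y]) (K := 18) hB₁.reg_zero hB₁.reg_one r1 (by omega)
    (by simp) (G := fun d => a / 2 ^ (c * t) ≤ d ∧
      StartHit c t m (chunk c p 0 t) (a % 2 ^ (c * t)) d) ?_ ?_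
  · intro st' d hK' hd hdt
    exact startTest_ends hI hF (hB₁.congr (by simp; simp [hK' _])) (by rw [hK' _ (by simp), r1])
      (by rw [hK' _ (by simp), r3]) (by rw [hK' _ (by simp), r4]) (by rw [hK' _ (by simp), r2]) hd
      hdt hcw (lt_of_le_of_lt (Nat.mod_le _ _) haw)
  · intro T st' hf hK' hM' hO' hT
    -- The test already includes the lower bound, so the search from `0` finds the first hit from
    -- the bound on.
    exact ⟨⟨hf.1, fun h => (hf.2.1 h).2, fun d h1 h2 h3 => hf.2.2 d (by omega) h2 ⟨h1, h3⟩⟩,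
      hK₁.trans hK' (by simp) (by simp), by rw [hM', s8], by rw [hO', s9], by simp; omega⟩

end

/-! ### Searching block by block -/

/-- All tables have been computed. -/
structure Tables (m c t : ℕ) (p mem : ℕ → ℕ) : Prop where
  masks : ∀ j ≤ m, PeriodMask p t j (mem (m + 1 + j))
  borders : ∀ j, t ≤ j → j ≤ m → Border p t j (mem (2 * (m + 1) + j))
  shifts : ∀ a < shiftSize c t, ShiftEntry c t a (mem (3 * (m + 1) + a))
  starts : ∀ a < startSize c t,
    StartEntry c t m (chunk c p 0 t) a (mem (3 * (m + 1) + shiftSize c t + a))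

/-- As far as the block of `t` characters at position `i` reaches, the pattern agrees with the text
when aligned with position `s`. -/
def Survives (p f : ℕ → ℕ) (t m i s : ℕ) : Prop :=
  Agrees p f s (min (i + t) (s + m))

/-- Survival concerns only the part of the pattern that the block reaches. Its failure therefore
rules out both an occurrence and a partial match at the end of the block. -/
theorem not_occurs_of_not_survives {p f : ℕ → ℕ} {t m n i s : ℕ} (hs : s ≤ i + t)
    (h : ¬ Survives p f t m i s) : ¬ Occurs p f n m s := fun h' =>
  h (h'.1.anti (by omega) (by omega))

theorem not_agrees_of_not_survives {p f : ℕ → ℕ} {t m i s : ℕ}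
    (h : ¬ Survives p f t m i s) : ¬ Agrees p f s (i + t) := fun h' =>
  h (h'.anti (by have := h'.1; omega) (by omega))

/-- Shifting right and back clears the bits below a lower bound; the table of shifts thus needs no
index for that bound. -/
theorem testBit_div_mul_two_pow (D a d : ℕ) :
    (D / 2 ^ a * 2 ^ a).testBit d ↔ a ≤ d ∧ D.testBit d := by
  rw [← Nat.shiftLeft_eq, ← Nat.shiftRight_eq_div_pow, Nat.testBit_shiftLeft, Nat.testBit_shiftRight]
  by_cases h : a ≤ d
  · simp [h]
  · simp [h]

theorem mul_add_lt_mul {a b r N : ℕ} (ha : a < N) (hr : r < b) : a * b + r < N * b := by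
  have : (a + 1) * b ≤ N * b := Nat.mul_le_mul_right _ ha
  rw [add_mul] at this; omega

theorem mul_add_div_of_lt {a b r : ℕ} (hr : r < b) : (a * b + r) / b = a := by
  rw [mul_comm, Nat.mul_add_div (by omega), Nat.div_eq_of_lt hr, add_zero]

theorem mul_add_mod_of_lt {a b r : ℕ} (hr : r < b) : (a * b + r) % b = r := by
  rw [add_comm, Nat.add_mul_mod_self_right, Nat.mod_eq_of_lt hr]

/-- The index is a number in mixed radix, so each component can be recovered by division and
remainder. -/
theorem shiftEntry_index {c t h D x u : ℕ} (hh : h < 2 ^ t) (hD : D < 2 ^ t)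
    (hx : x < 2 ^ (c * (2 * t))) (hu : u < 2 ^ (c * t)) :
    ((h * 2 ^ t + D) * 2 ^ (c * (2 * t)) + x) * 2 ^ (c * t) + u < shiftSize c t ∧
      ∀ r, ShiftEntry c t (((h * 2 ^ t + D) * 2 ^ (c * (2 * t)) + x) * 2 ^ (c * t) + u) r ↔
        IsFirst (ShiftHit c t h D x u) 0 t r := by
  constructor
  · have := mul_add_lt_mul (mul_add_lt_mul (mul_add_lt_mul hh hD) hx) hu
    refine this.trans_le (le_of_eq ?_)
    rw [shiftSize, ← pow_add, ← pow_add, ← pow_add]; congr 1; ring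
  · intro r
    rw [ShiftEntry, mul_add_div_of_lt hu, mul_add_mod_of_lt hu, mul_add_div_of_lt hx,
      mul_add_mod_of_lt hx, mul_add_div_of_lt hD, mul_add_mod_of_lt hD]

section

variable {E : Env} {n m c k t : ℕ} {p f : ℕ → ℕ}

/-- Load the window around position `q` of the pattern. -/
def fetchWindow : Com Var :=
  .ite (.lt .q .t)
    (.seq (fetch .pattern .x .zero .maskW)
      (.block [.op .sub .y .t .q, .op .mul .y .c .y, .op .shl .x .x .y, .op .land .x .x .maskW]))
    (.seq (.block [.op .sub .y .q .t]) (fetch .pattern .x .y .maskW))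

theorem fetchWindow_ends (hI : Instance E n m c k p f) (hF : Fits E m k c t) {st : Store Var}
    (hB : Basics n m c k st) (hl : Layout m c t p st) {q : ℕ} (hq : st.reg .q = q) (hqm : q ≤ m)
    {Q : ℕ → Store Var → Prop}
    (hQ : ∀ T st', st'.reg .x = window c t p q → Keeps [.x, .y, .f₁, .f₂, .f₃] st st' →
      st'.mem = st.mem → st'.out = st.out → T ≤ 17 → Q T st') :
    Ends E fetchWindow st Q := by
  have htw := hF.t_lt hI
  have hnw := hI.n_lt
  have hmn := hI.m_le
  have htk := hF.two_t_le
  refine Ends.ite (fun hc => Ends.seq ?_) (fun hc => Ends.seq (Ends.block (by simp) ?_))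
  · simp only [Cond.Holds, hq, hl.reg_t] at hc
    refine fetch_ends hB rfl hI.p_lt hI.pattern hI.one_le_k hI.one_le_c hI.word hB.reg_zero
      (by positivity) hl.reg_maskW htk (by simp) (by simp) (by simp) fun st₁ hx hK hM hO => ?_
    have r1 : st₁.reg .q = q := by rw [hK _ (by simp), hq]
    have r2 : st₁.reg .t = t := by rw [hK _ (by simp), hl.reg_t]
    have r3 : st₁.reg .c = c := by rw [hK _ (by simp), hB.reg_c]
    have r4 : st₁.reg .maskW = 2 ^ (c * (2 * t)) - 1 := by rw [hK _ (by simp), hl.reg_maskW]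
    have e1 : BinOp.eval E.w .sub t q = t - q := eval_sub hc.le htw
    have e2 : BinOp.eval E.w .mul c (t - q) = c * (t - q) := eval_mul (hI.mul_lt (by omega)).2
    refine Ends.block (by simp) (hQ _ _ ?_ ?_ (by simp [hM]) (by simp [hO]) (by simp))
    · simp only [execAll, Basic.exec, Store.set, Function.update_apply, reduceCtorEq, if_true,
        if_false, r1, r2, r3, r4, e1, e2, hx]
      -- The left shift may overflow the word, but the window keeps only lower bits.
      rw [eval_land (by exact Nat.mod_lt _ (by positivity)), BinOp.eval,
        Nat.and_two_pow_sub_one_eq_mod, Nat.mod_mod_of_dvd _ (pow_dvd_pow _ (hI.mul_lt htk).1),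
        window, if_pos hc]
    · exact hK.trans (keeps_execAll E _ st₁ (L := [.x, .y]) (by simp [target])) (by simp) (by simp)
  · simp only [Cond.Holds, hq, hl.reg_t] at hc
    have hK₁ : Keeps [.y] st (execAll E [Basic.op .sub .y .q .t] st) :=
      keeps_execAll E _ st (by simp [target])
    have e1 : BinOp.eval E.w .sub q t = q - t := eval_sub (by omega) (by omega)
    refine fetch_ends (hB.congr (by simp)) rfl hI.p_lt hI.pattern hI.one_le_k hI.one_le_c
      hI.word (i := q - t) (L := 2 * t) (by simp [hq, hl.reg_t, e1]) (by omega)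
      (by simp [hl.reg_maskW]) htk (by simp) (by simp) (by simp) fun st₁ hx hK hM hO => ?_
    refine hQ _ _ ?_ (hK₁.trans hK (by simp) (by simp)) (by simp [hM]) (by simp [hO]) (by simp)
    rw [hx, window, if_neg hc]

/-- Look up the first shift, at least `lo`, that survives the block `u` in the state `q`. -/
def lookupShift : Com Var :=
  .seq (.block [.op .sub .h .m .q])
    (.seq (cap .h .t)
      (.seq fetchWindow
        (.block [.op .add .z .baseD .q, .load .dm .z, .op .shr .dm .dm .lo, .op .shl .dm .dm .lo,
          .op .shl .v .h .t, .op .add .v .v .dm, .op .shl .v .v .cw, .op .add .v .v .x,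
          .op .shl .v .v .ct, .op .add .v .v .u, .op .add .v .baseT .v, .load .v .v])))

/-- A single table entry answers a question about the actual alignments. The condition `s + d ≤ i`
stays in the answer because a shift beyond `q` leaves no matched prefix; such alignments belong to
the table of starts. -/
theorem lookupShift_ends (hI : Instance E n m c k p f) (hF : Fits E m k c t) {st : Store Var}
    (hB : Basics n m c k st) (hl : Layout m c t p st) (hT : Tables m c t p st.mem) {q a s i : ℕ}
    (hq : st.reg .q = q) (hqm : q ≤ m) (ha : st.reg .lo = a)
    (hu : st.reg .u = chunk c f i t) (hi : s + q = i) (hs : Agrees p f s i)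
    {Q : ℕ → Store Var → Prop}
    (hQ : ∀ T st' v, st'.reg .v = v → st'.reg .h = min t (m - q) →
      IsFirst (fun d => s + d ≤ i ∧ Survives p f t m i (s + d)) a t v →
      Keeps [.h, .x, .y, .z, .dm, .v, .f₁, .f₂, .f₃] st st' → st'.mem = st.mem →
      st'.out = st.out → T ≤ 32 → Q T st') :
    Ends E lookupShift st Q := by
  have htw := hF.t_lt hI
  have hnw := hI.n_lt
  have hmn := hI.m_le
  have htk := hF.two_t_le
  have hbw := hI.bound_le
  have hbd := hF.bound_eq
  have e1 : BinOp.eval E.w .sub m q = m - q := eval_sub hqm (by omega)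
  refine Ends.seq (Ends.block (by simp) (Ends.seq (cap_ends (by simp [hB.reg_zero])
    (by simp [hl.reg_t]; omega) fun st₁ hh₁ hK₁ hM₁ hO₁ => ?_)))
  replace hK₁ : Keeps [.h] st st₁ :=
    (keeps_execAll E _ st (L := [.h]) (by simp [target])).trans hK₁ (by simp) (by simp)
  replace hM₁ : st₁.mem = st.mem := by simp [hM₁]
  replace hO₁ : st₁.out = st.out := by simp [hO₁]
  simp [hl.reg_t, hB.reg_m, hq, e1] at hh₁
  refine Ends.seq (fetchWindow_ends hI hF (hB.congr (by simp; simp [hK₁ _]))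
    (hl.congr (by simp; simp [hK₁ _])) (by rw [hK₁ _ (by simp), hq]) hqm
    fun T st₂ hx₂ hK₂ hM₂ hO₂ hT₂ => ?_)
  replace hh₁ : st₂.reg .h = min t (m - q) := by rw [hK₂ _ (by simp), hh₁]
  replace hK₂ : Keeps [.h, .x, .y, .f₁, .f₂, .f₃] st st₂ := hK₁.trans hK₂ (by simp) (by simp)
  replace hM₂ : st₂.mem = st.mem := by rw [hM₂, hM₁]
  replace hO₂ : st₂.out = st.out := by rw [hO₂, hO₁]
  have hmask := hT.masks q hqm
  set D := st.mem (m + 1 + q) with hD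
  set D' := D / 2 ^ a * 2 ^ a with hD'
  have hDt : D < 2 ^ t := hmask.lt
  have hD't : D' < 2 ^ t := lt_of_le_of_lt (Nat.div_mul_le_self _ _) hDt
  have hht : min t (m - q) < 2 ^ t := lt_of_le_of_lt (min_le_left _ _) Nat.lt_two_pow_self
  have hx := window_lt (t := t) hI.p_lt q
  have hut := chunk_lt hI.f_lt i t
  obtain ⟨hidx, hentry⟩ := shiftEntry_index (c := c) hht hD't hx hut
  set h := min t (m - q) with hh
  set x := window c t p q with hxd
  set u := chunk c f i t with hud
  have htwo : 2 ^ t ≤ 2 ^ E.w :=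
    Nat.pow_le_pow_right (by norm_num) (by have := hF.two_t_le_word hI; omega)
  -- All intermediate results are at most the final index, so none of them overflows.
  have b1 : (h * 2 ^ t + D') ≤ (h * 2 ^ t + D') * 2 ^ (c * (2 * t)) :=
    Nat.le_mul_of_pos_right _ (by positivity)
  have b2 : (h * 2 ^ t + D') * 2 ^ (c * (2 * t)) + x ≤
    ((h * 2 ^ t + D') * 2 ^ (c * (2 * t)) + x) * 2 ^ (c * t) :=
    Nat.le_mul_of_pos_right _ (by positivity)
  have r1 : st₂.reg .q = q := by rw [hK₂ _ (by simp), hq]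
  have r2 : st₂.reg .baseD = m + 1 := by rw [hK₂ _ (by simp), hl.reg_baseD]
  have r3 : st₂.reg .lo = a := by rw [hK₂ _ (by simp), ha]
  have r4 : st₂.reg .t = t := by rw [hK₂ _ (by simp), hl.reg_t]
  have r5 : st₂.reg .cw = c * (2 * t) := by rw [hK₂ _ (by simp), hl.reg_cw]
  have r6 : st₂.reg .ct = c * t := by rw [hK₂ _ (by simp), hl.reg_ct]
  have r7 : st₂.reg .u = u := by rw [hK₂ _ (by simp), hu]
  have r8 : st₂.reg .baseT = 3 * (m + 1) := by rw [hK₂ _ (by simp), hl.reg_baseT]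
  have g1 : BinOp.eval E.w .add (m + 1) q = m + 1 + q := eval_add (by omega)
  have g2 : BinOp.eval E.w .shr D a = D / 2 ^ a := eval_shr (by omega)
  have g3 : BinOp.eval E.w .shl (D / 2 ^ a) a = D' := eval_shl (by omega)
  have g4 : BinOp.eval E.w .shl h t = h * 2 ^ t := eval_shl (by omega)
  have g5 : BinOp.eval E.w .add (h * 2 ^ t) D' = h * 2 ^ t + D' := eval_add (by omega)
  have g6 : BinOp.eval E.w .shl (h * 2 ^ t + D') (c * (2 * t)) =
    (h * 2 ^ t + D') * 2 ^ (c * (2 * t)) := eval_shl (by omega)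
  have g7 : BinOp.eval E.w .add ((h * 2 ^ t + D') * 2 ^ (c * (2 * t))) x =
    (h * 2 ^ t + D') * 2 ^ (c * (2 * t)) + x := eval_add (by omega)
  have g8 : BinOp.eval E.w .shl ((h * 2 ^ t + D') * 2 ^ (c * (2 * t)) + x) (c * t) =
    ((h * 2 ^ t + D') * 2 ^ (c * (2 * t)) + x) * 2 ^ (c * t) := eval_shl (by omega)
  set j := ((h * 2 ^ t + D') * 2 ^ (c * (2 * t)) + x) * 2 ^ (c * t) + u with hj
  have g9 : BinOp.eval E.w .add (((h * 2 ^ t + D') * 2 ^ (c * (2 * t)) + x) * 2 ^ (c * t)) u = j :=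
    eval_add (by omega)
  have g10 : BinOp.eval E.w .add (3 * (m + 1)) j = 3 * (m + 1) + j := eval_add (by omega)
  have hv := (hentry _).mp (hT.shifts j hidx)
  refine Ends.block ?_ (hQ _ _ (st.mem (3 * (m + 1) + j)) ?_ ?_ ?_ ?_ ?_ ?_ ?_)
  · simp [hM₂, r1, r2, r3, r4, r5, r6, r7, r8, hh₁, hx₂, g1, ← hD, g2, g3, g4, g5, g6, g7, g8, g9,
      g10]
    omega
  · simp [hM₂, r1, r2, r3, r4, r5, r6, r7, r8, hh₁, hx₂, g1, ← hD, g2, g3, g4, g5, g6, g7, g8, g9,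
      g10]
  · simp [hh₁]
  · have key : ∀ d < t, ShiftHit c t h D' x u d ↔
        a ≤ d ∧ s + d ≤ i ∧ Survives p f t m i (s + d) := by
      intro d hd
      rw [Survives, ← shiftHit_iff hI.p_lt hI.f_lt hi hqm hmask hs hd, ShiftHit, ShiftHit,
        testBit_div_mul_two_pow, and_assoc]
    refine ⟨hv.1, fun h1 => ?_, fun d h1 h2 h3 => ?_⟩
    · exact (key _ h1).mp (hv.2.1 h1).2
    · exact hv.2.2 d (by omega) h2 ((key d (by have := hv.1; omega)).mpr ⟨h1, h3⟩)
  · exact hK₂.trans (keeps_execAll E _ st₂ (L := [.z, .dm, .v]) (by simp [target])) (by simp)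
      (by simp)
  · simp [hM₂]
  · simp [hO₂]
  · simp; omega

/-- Look up the first start, at least `lo`, that survives the block `u`. -/
def lookupStart : List (Basic Var) :=
  [.op .shl .v .lo .ct, .op .add .v .v .u, .op .add .v .baseU .v, .load .v .v, .op .add .y .v .m]

theorem lookupStart_exec (hI : Instance E n m c k p f) (hF : Fits E m k c t) {st : Store Var}
    (hB : Basics n m c k st) (hl : Layout m c t p st) (hT : Tables m c t p st.mem) {a i : ℕ}
    (ha : st.reg .lo = a) (hat : a ≤ t) (hu : st.reg .u = chunk c f i t) :
    SafeAll E lookupStart st ∧ ∃ v, (execAll E lookupStart st).reg .v = v ∧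
      (execAll E lookupStart st).reg .y = v + m ∧
      IsFirst (fun d => Survives p f t m i (i + d)) a t v := by
  have htw := hF.t_lt hI
  have hbw := hI.bound_le
  have hbd := hF.bound_eq
  have hut := chunk_lt hI.f_lt i t
  set u := chunk c f i t with hud
  have hidx : a * 2 ^ (c * t) + u < startSize c t := by
    rw [startSize, add_comm (c * t), pow_add]
    exact mul_add_lt_mul (lt_of_le_of_lt hat Nat.lt_two_pow_self) hut
  have hv := hT.starts _ hidx
  rw [StartEntry, mul_add_div_of_lt hut, mul_add_mod_of_lt hut] at hv
  -- The entry is at most `t`, hence below the table size, and adding `m` to it stays below the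
  -- memory bound.
  have htS : t < shiftSize c t := by
    refine lt_of_lt_of_le Nat.lt_two_pow_self (Nat.pow_le_pow_right (by norm_num) (by omega))
  have g1 : BinOp.eval E.w .shl a (c * t) = a * 2 ^ (c * t) := eval_shl (by omega)
  have g2 : BinOp.eval E.w .add (a * 2 ^ (c * t)) u = a * 2 ^ (c * t) + u := eval_add (by omega)
  set j := a * 2 ^ (c * t) + u with hj
  have g3 : BinOp.eval E.w .add (3 * (m + 1) + shiftSize c t) j =
    3 * (m + 1) + shiftSize c t + j := eval_add (by omega)
  set v := st.mem (3 * (m + 1) + shiftSize c t + j) with hvd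
  have hvt := hv.1
  have g4 : BinOp.eval E.w .add v m = v + m := eval_add (by omega)
  refine ⟨?_, v, ?_, ?_, hvt, fun h => ?_, fun d h1 h2 h3 => ?_⟩
  · simp [lookupStart, ha, hl.reg_ct, hu, hl.reg_baseU, g1, g2, g3]; omega
  · simp [lookupStart, ha, hl.reg_ct, hu, hl.reg_baseU, g1, g2, g3, hvd]
  · simp [lookupStart, ha, hl.reg_ct, hu, hl.reg_baseU, hB.reg_m, g1, g2, g3, ← hvd, g4]
  · exact ⟨(hv.2.1 h).1, (startHit_iff hI.p_lt hI.f_lt hvt).mp (hv.2.1 h).2⟩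
  · exact hv.2.2 d h1 h2 ((startHit_iff hI.p_lt hI.f_lt (by omega)).mpr h3)

end

open Classical in
/-- The number of alignments in `[S, X)` with a full match, possibly beyond the end of the text. -/
noncomputable def fullMatches (p f : ℕ → ℕ) (m X S : ℕ) : ℕ :=
  ((Finset.Ico S X).filter fun s => Agrees p f s (s + m)).card

theorem fullMatches_anti (p f : ℕ → ℕ) (m X : ℕ) {S S' : ℕ} (h : S ≤ S') :
    fullMatches p f m X S' ≤ fullMatches p f m X S := by
  classical
  exact Finset.card_le_card (Finset.filter_subset_filter _ (Finset.Ico_subset_Ico_left h))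

/-- Passing a full match releases one unit of potential, which pays for the lookup that found it.
This also holds for matches beyond the end of the text, which are not reported. -/
theorem fullMatches_succ {p f : ℕ → ℕ} {m X S : ℕ} (hX : S < X) (h : Agrees p f S (S + m)) :
    fullMatches p f m X (S + 1) + 1 ≤ fullMatches p f m X S := by
  classical
  unfold fullMatches
  rw [← Finset.insert_Ico_add_one_left_eq_Ico hX, Finset.filter_insert, if_pos h,
    Finset.card_insert_of_notMem (by simp)]

section

variable {E : Env} {n m c k t : ℕ} {p f : ℕ → ℕ}

/-- Report the occurrences inside the block `u`, and pass to the state after the block. -/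
def startScan : Com Var :=
  .seq (.block (.const .lo 1 :: lookupStart))
    (.seq (.loop (.lt .y .t)
        (.seq (.ite (.lt .rem .y) (.block []) (.block [.op .add .z .pos .v, .report .z]))
          (.block (.op .add .lo .v .one :: lookupStart))))
      (.block [.op .sub .q .t .v]))

/-- The state `q` after reading the text up to position `i`: all alignments up to `i - q` have been
dealt with. -/
structure State (p f : ℕ → ℕ) (n m i : ℕ) (st : Store Var) (s : ℕ) : Prop where
  add_eq : s + st.reg .q = i
  q_le : st.reg .q ≤ m
  agrees : Agrees p f s i
  dead : ∀ s' < s, i ≤ s' + m → ¬ Agrees p f s' i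
  out_eq : st.out = occList p f n m s

/-- An alignment completed strictly inside the block satisfies `v + m < t`; it is reported if it
fits into the text, and the scan continues behind it. The first survivor that reaches the end of the
block gives the next state, and the default entry `t` gives the empty state. -/
theorem startScan_ends (hI : Instance E n m c k p f) (hF : Fits E m k c t) {st : Store Var}
    (hB : Basics n m c k st) (hl : Layout m c t p st) (hT : Tables m c t p st.mem) {i X : ℕ}
    (hu : st.reg .u = chunk c f i t) (hin : i ≤ n) (hX : i + t ≤ X) (hpos : st.reg .pos = i)
    (hrem : st.reg .rem = n - i) (hout : st.out = occList p f n m (i + 1))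
    (hdead : ∀ s' < i + 1, i + t ≤ s' + m → ¬ Agrees p f s' (i + t)) {Q : ℕ → Store Var → Prop}
    (hQ : ∀ T st' s, State p f n m (i + t) st' s → i + 1 ≤ s →
      Keeps [.lo, .v, .y, .z, .q] st st' → st'.mem = st.mem →
      T + 60 * fullMatches p f m X s ≤ 60 * fullMatches p f m X (i + 1) + 10 → Q T st') :
    Ends E startScan st Q := by
  classical
  have htw := hF.t_lt hI
  have hnw := hI.n_lt
  have hmn := hI.m_le
  have ht1 := hF.one_le_t
  have h2w : 1 < 2 ^ E.w := Nat.one_lt_two_pow (by have := hI.w_pos; omega)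
  -- Offset `0` is the shift by `q`, which the table of shifts has already covered; so the starts
  -- begin at `1`.
  set st₁ := execAll E [Basic.const .lo 1] st with hst₁
  have hK₁ : Keeps [.lo] st st₁ := keeps_execAll E _ st (by simp [target])
  obtain ⟨hsafe, v, hv, hy, hfirst⟩ := lookupStart_exec hI hF (hB.congr (by simp; simp [hK₁ _]))
    (hl.congr (by simp; simp [hK₁ _])) (st := st₁) (by simpa [hst₁] using hT) (a := 1) (i := i)
    (by simp [hst₁, Nat.mod_eq_of_lt h2w]) ht1 (by rw [hK₁ _ (by simp), hu])
  refine Ends.seq (Ends.block ⟨by simp, hsafe⟩ (Ends.seq ?_))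
  refine Ends.loop (I := fun φ st' => ∃ a v, st'.reg .v = v ∧ st'.reg .y = v + m ∧
      IsFirst (fun d => Survives p f t m i (i + d)) a t v ∧ 1 ≤ a ∧ a ≤ t ∧
      φ = 60 * fullMatches p f m X (i + a) ∧ st'.out = occList p f n m (i + a) ∧
      (∀ s' < i + a, i + t ≤ s' + m → ¬ Agrees p f s' (i + t)) ∧
      Keeps [.lo, .v, .y, .z, .q] st st' ∧ st'.mem = st.mem)
    (φ := 60 * fullMatches p f m X (i + 1)) ?_ ?_ ?_
  · rintro φ st₂ ⟨a, v, hv₂, hy₂, hf₂, ha1, hat, rfl, hO₂, hd₂, hK₂, hM₂⟩ hc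
    have hB₂ : Basics n m c k st₂ := hB.congr (by simp; simp [hK₂ _])
    have hl₂ : Layout m c t p st₂ := hl.congr (by simp; simp [hK₂ _])
    simp only [Cond.Holds, hy₂, hl₂.reg_t] at hc
    have hva := (hf₂.2.1 (by omega)).1
    have hsur : Survives p f t m i (i + v) := (hf₂.2.1 (by omega)).2
    rw [Survives, min_eq_right (by omega)] at hsur
    have hpos₂ : st₂.reg .pos = i := by rw [hK₂ _ (by simp), hpos]
    have hrem₂ : st₂.reg .rem = n - i := by rw [hK₂ _ (by simp), hrem]
    have hcnt : fullMatches p f m X (i + (v + 1)) + 1 ≤ fullMatches p f m X (i + a) :=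
      (fullMatches_succ (by omega) hsur).trans (fullMatches_anti _ _ _ _ (by omega))
    have hns : ∀ s', i + a ≤ s' → s' < i + v → ¬ Survives p f t m i s' := by
      intro s' h1 h2
      have : ¬ Survives p f t m i (i + (s' - i)) := hf₂.2.2 (s' - i) (by omega) (by omega)
      rwa [show i + (s' - i) = s' by omega] at this
    have hocc : occList p f n m (i + v) = occList p f n m (i + a) :=
      occList_eq_of_le (by omega) fun s' h1 h2 => not_occurs_of_not_survives (t := t) (i := i)
        (by omega) (hns s' h1 h2)
    have hdead' : ∀ s' < i + (v + 1), i + t ≤ s' + m → ¬ Agrees p f s' (i + t) := by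
      intro s' h1 h2
      rcases (show s' < i + a ∨ (i + a ≤ s' ∧ s' < i + v) ∨ s' = i + v by omega) with h3 | h3 | h3
      · exact hd₂ s' h3 h2
      · exact not_agrees_of_not_survives (hns s' h3.1 h3.2)
      · omega
    -- Shared by the cases with and without a report; `T₀` is the time already spent in the round.
    have step : ∀ st₃ : Store Var, Keeps [.z] st₂ st₃ → st₃.mem = st₂.mem →
        st₃.out = occList p f n m (i + (v + 1)) → ∀ T₀ ≤ 5,
        Ends E (.block (.op .add .lo .v .one :: lookupStart)) st₃ fun T st' =>
          ∃ φ', (∃ a v, st'.reg .v = v ∧ st'.reg .y = v + m ∧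
      IsFirst (fun d => Survives p f t m i (i + d)) a t v ∧ 1 ≤ a ∧ a ≤ t ∧
      φ' = 60 * fullMatches p f m X (i + a) ∧ st'.out = occList p f n m (i + a) ∧
      (∀ s' < i + a, i + t ≤ s' + m → ¬ Agrees p f s' (i + t)) ∧
      Keeps [.lo, .v, .y, .z, .q] st st' ∧ st'.mem = st.mem) ∧
      φ' + (T₀ + T) + 2 ≤ 60 * fullMatches p f m X (i + a) := by
      intro st₃ hK₃ hM₃ hO₃ T₀ hT₀
      set st₄ := execAll E [Basic.op .add .lo .v .one] st₃ with hst₄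
      have hK₄ : Keeps [.lo, .v, .y, .z, .q] st st₄ :=
        hK₂.trans (hK₃.trans (keeps_execAll E _ st₃ (L := [.lo]) (by simp [target]))
          (L := [.z, .lo]) (by simp) (by simp)) (by simp) (by simp)
      have e1 : BinOp.eval E.w .add v 1 = v + 1 := eval_add (by omega)
      have hv₃ : st₃.reg .v = v := by rw [hK₃ _ (by simp), hv₂]
      have h1₃ : st₃.reg .one = 1 := by rw [hK₃ _ (by simp), hB₂.reg_one]
      obtain ⟨hsafe, v', hv', hy', hfirst'⟩ := lookupStart_exec hI hF
        (hB.congr (by simp; simp [hK₄ _])) (hl.congr (by simp; simp [hK₄ _])) (st := st₄)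
        (by simpa [hst₄, hM₃, hM₂] using hT) (a := v + 1) (i := i)
        (by simp [hst₄, hv₃, h1₃, e1]) (by omega) (by rw [hK₄ _ (by simp), hu])
      refine Ends.block ⟨by simp, hsafe⟩ ⟨_, ⟨v + 1, v', hv', hy', hfirst', by omega, by omega,
        rfl, ?_, hdead', ?_, ?_⟩, ?_⟩
      · rw [← hO₃]; simp [lookupStart]
      · exact hK₄.trans (keeps_execAll E lookupStart st₄ (L := [.v, .y])
          (by simp [lookupStart, target])) (by simp) (by simp)
      · simp [lookupStart, hM₃, hM₂]
      · simp [lookupStart]; omega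
    refine Ends.seq (Ends.ite (fun hc' => Ends.block (by simp) ?_)
      (fun hc' => Ends.block (by simp) ?_))
    · simp only [Cond.Holds, hrem₂, hy₂] at hc'
      refine step _ (Keeps.refl _ _) rfl ?_ _ (by simp)
      rw [← add_assoc, occList_succ, if_neg (fun h => by have := h.2; omega), hocc, ← hO₂]
    · simp only [Cond.Holds, hrem₂, hy₂] at hc'
      have e1 : BinOp.eval E.w .add i v = i + v := eval_add (by omega)
      refine step _ (keeps_execAll E _ st₂ (by simp [target])) (by simp) ?_ _ (by simp)
      rw [← add_assoc, occList_succ, if_pos ⟨hsur, by omega⟩, hocc, ← hO₂]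
      simp [hpos₂, hv₂, e1]
  · refine ⟨1, v, hv, hy, hfirst, le_rfl, ht1, rfl, ?_, hdead, ?_, ?_⟩
    · rw [← hout]; simp [lookupStart]
    · exact keeps_execAll E _ st (by simp [lookupStart, target])
    · simp [lookupStart]
  · rintro T φ' st₂ ⟨a, v, hv₂, hy₂, hf₂, ha1, hat, rfl, hO₂, hd₂, hK₂, hM₂⟩ hc hT'
    have hB₂ : Basics n m c k st₂ := hB.congr (by simp; simp [hK₂ _])
    have hl₂ : Layout m c t p st₂ := hl.congr (by simp; simp [hK₂ _])
    simp only [Cond.Holds, hy₂, hl₂.reg_t] at hc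
    have hvt := hf₂.1
    have hav : a ≤ v := by
      rcases hvt.lt_or_eq with h | h
      · exact (hf₂.2.1 h).1
      · omega
    have e1 : BinOp.eval E.w .sub t v = t - v := eval_sub hvt htw
    have hns : ∀ s', i + a ≤ s' → s' < i + v → ¬ Survives p f t m i s' := by
      intro s' h1 h2
      have : ¬ Survives p f t m i (i + (s' - i)) := hf₂.2.2 (s' - i) (by omega) (by omega)
      rwa [show i + (s' - i) = s' by omega] at this
    have hqv : (execAll E [Basic.op .sub .q .t .v] st₂).reg .q = t - v := by
      simp [hl₂.reg_t, hv₂, e1]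
    refine Ends.block (by simp) (hQ _ _ (i + v) ⟨by rw [hqv]; omega, by rw [hqv]; omega, ?_, ?_, ?_⟩
      (by omega) ?_ (by simp [hM₂]) ?_)
    · rcases hvt.lt_or_eq with h | h
      · have : Survives p f t m i (i + v) := (hf₂.2.1 h).2
        rwa [Survives, min_eq_left (by omega)] at this
      · rw [h]; exact agrees_self _ _ _
    · intro s' h1 h2
      rcases (show s' < i + a ∨ i + a ≤ s' by omega) with h3 | h3
      · exact hd₂ s' h3 h2
      · exact not_agrees_of_not_survives (hns s' h3 h1)
    · rw [occList_eq_of_le (S := i + a) (by omega) fun s' h1 h2 =>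
        not_occurs_of_not_survives (t := t) (i := i) (by omega) (hns s' h1 h2), ← hO₂]
      simp
    · exact hK₂.trans (keeps_execAll E _ st₂ (L := [.q]) (by simp [target])) (by simp) (by simp)
    · have := fullMatches_anti p f m X (show i + a ≤ i + v by omega)
      simp [lookupStart]; omega

end

/-! ### Processing one block and the amortised block search -/

section

variable {E : Env} {n m c k t : ℕ} {p f : ℕ → ℕ}

/-- Pass from the state before the block `u` to the state after it, and report the occurrences whose
ends are found on the way. -/
def processBlock : Com Var :=
  .seq (.block [.const .lo 0, .const .go 1])
    (.loop (.lt .zero .go)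
      (.seq lookupShift
        (.ite (.lt .v .t)
          (.seq (.block [.op .add .y .h .v])
            (.ite (.lt .y .t)
              (.seq (.ite (.lt .rem .y) (.block [])
                  (.block [.op .sub .z .pos .q, .op .add .z .z .v, .report .z]))
                (.block [.op .add .lo .v .one]))
              (.block [.op .sub .q .q .v, .op .add .q .q .t, .const .go 0])))
          (.ite (.lt .q .t)
            (.seq startScan (.block [.const .go 0]))
            (.block [.op .add .z .baseJ .q, .load .q .z, .const .lo 0])))))

/-- The registers that are changed while a block is processed. -/
def blockScratch : List Var := [.lo, .go, .h, .x, .y, .z, .dm, .v, .q, .f₁, .f₂, .f₃]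

/-- While the block at position `i` is processed: in the state `q` before the block, the shifts
below `lo` have been dealt with. -/
structure Pending (p f : ℕ → ℕ) (n m t i : ℕ) (st : Store Var) (s : ℕ) : Prop where
  add_eq : s + st.reg .q = i
  q_le : st.reg .q ≤ m
  lo_le : st.reg .lo ≤ t
  lo_le_q : st.reg .lo ≤ st.reg .q + 1
  agrees : Agrees p f s i
  dead : ∀ s' < s + st.reg .lo, i + t ≤ s' + m → ¬ Agrees p f s' (i + t)
  out_eq : st.out = occList p f n m (s + st.reg .lo)

/-- The invariant of the loop over the shifts. -/
def BlockInv (p f : ℕ → ℕ) (n m t i X : ℕ) (st₀ : Store Var) (φ : ℕ) (st : Store Var) : Prop :=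
  Keeps blockScratch st₀ st ∧ st.mem = st₀.mem ∧
    ((st.reg .go = 1 ∧ ∃ s, Pending p f n m t i st s ∧
      φ = 60 * ((X - s) / t + fullMatches p f m X (s + st.reg .lo) + 1)) ∨
    (st.reg .go = 0 ∧ ∃ s, State p f n m (i + t) st s ∧ s ≤ i + t ∧
      φ = 60 * ((X - s) / t + fullMatches p f m X s)))

/-- Each round performs one lookup and costs at most 60 apart from the scan for starts. It is paid
for by a full match, by a fallback, which lowers `(X - s) / t`, or by the additional unit of the
pending state when the block is finished. -/
theorem processBlock_round (hI : Instance E n m c k p f) (hF : Fits E m k c t) {st₀ : Store Var}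
    (hB : Basics n m c k st₀) (hl : Layout m c t p st₀) (hT : Tables m c t p st₀.mem) {i X : ℕ}
    (hu : st₀.reg .u = chunk c f i t) (hin : i ≤ n) (hX : i + t < X) (hpos : st₀.reg .pos = i)
    (hrem : st₀.reg .rem = n - i) {st : Store Var} (hK : Keeps blockScratch st₀ st)
    (hM : st.mem = st₀.mem) {s : ℕ} (hgo : st.reg .go = 1) (hP : Pending p f n m t i st s) :
    Ends E (.seq lookupShift
        (.ite (.lt .v .t)
          (.seq (.block [.op .add .y .h .v])
            (.ite (.lt .y .t)
              (.seq (.ite (.lt .rem .y) (.block [])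
                  (.block [.op .sub .z .pos .q, .op .add .z .z .v, .report .z]))
                (.block [.op .add .lo .v .one]))
              (.block [.op .sub .q .q .v, .op .add .q .q .t, .const .go 0])))
          (.ite (.lt .q .t)
            (.seq startScan (.block [.const .go 0]))
            (.block [.op .add .z .baseJ .q, .load .q .z, .const .lo 0])))) st
      fun T st' => ∃ φ', BlockInv p f n m t i X st₀ φ' st' ∧
        φ' + T + 2 ≤ 60 * ((X - s) / t + fullMatches p f m X (s + st.reg .lo) + 1) := by
  classical
  have htw := hF.t_lt hI
  have hnw := hI.n_lt
  have hmn := hI.m_le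
  have ht1 := hF.one_le_t
  have htk := hF.two_t_le
  have hbw := hI.bound_le
  have hbd := hF.bound_eq
  have htS : t < shiftSize c t :=
    lt_of_lt_of_le Nat.lt_two_pow_self (Nat.pow_le_pow_right (by norm_num) (by omega))
  obtain ⟨hsi, hqm, hlt, hlq, hag, hdead, hout⟩ := hP
  set q := st.reg .q with hq
  set a := st.reg .lo with ha
  have hB₁ : Basics n m c k st := hB.congr (by simp; simp [hK _, blockScratch])
  have hl₁ : Layout m c t p st := hl.congr (by simp; simp [hK _, blockScratch])
  refine Ends.seq (lookupShift_ends hI hF hB₁ hl₁ (hM ▸ hT) hq.symm hqm ha.symm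
    (by rw [hK _ (by simp [blockScratch]), hu]) hsi hag ?_)
  intro T st₂ v hv hh hf hK₂ hM₂ hO₂ hT₂
  have r1 : st₂.reg .t = t := by rw [hK₂ _ (by simp), hl₁.reg_t]
  have r2 : st₂.reg .q = q := by rw [hK₂ _ (by simp)]
  have r3 : st₂.reg .rem = n - i := by
    rw [hK₂ _ (by simp), hK _ (by simp [blockScratch]), hrem]
  have r4 : st₂.reg .pos = i := by rw [hK₂ _ (by simp), hK _ (by simp [blockScratch]), hpos]
  have r5 : st₂.reg .one = 1 := by rw [hK₂ _ (by simp), hB₁.reg_one]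
  have r6 : st₂.reg .baseJ = 2 * (m + 1) := by rw [hK₂ _ (by simp), hl₁.reg_baseJ]
  have r7 : st₂.reg .go = 1 := by rw [hK₂ _ (by simp), hgo]
  have hKK : Keeps blockScratch st₀ st₂ := hK.trans hK₂ (by simp) (by simp [blockScratch])
  have hMM : st₂.mem = st₀.mem := by rw [hM₂, hM]
  have hOO : st₂.out = occList p f n m (s + a) := by rw [hO₂, hout]
  have hvt := hf.1
  have hns : ∀ s', s + a ≤ s' → s' < s + v → s' ≤ i → ¬ Survives p f t m i s' := by
    intro s' h1 h2 h3 h4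
    refine hf.2.2 (s' - s) (by omega) (by omega) ?_
    show s + (s' - s) ≤ i ∧ Survives p f t m i (s + (s' - s))
    rw [show s + (s' - s) = s' by omega]
    exact ⟨h3, h4⟩
  refine Ends.ite (fun hc => Ends.seq (Ends.block (by simp) ?_)) (fun hc => ?_)
  · simp only [Cond.Holds, hv, r1] at hc
    obtain ⟨hav, hvi, hsur⟩ := hf.2.1 hc
    have hocc : occList p f n m (s + v) = occList p f n m (s + a) :=
      occList_eq_of_le (by omega) fun s' h1 h2 => not_occurs_of_not_survives (t := t) (i := i)
        (by omega) (hns s' h1 h2 (by omega))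
    have hdead' : ∀ s' < s + v, i + t ≤ s' + m → ¬ Agrees p f s' (i + t) := by
      intro s' h1 h2
      rcases (show s' < s + a ∨ s + a ≤ s' by omega) with h3 | h3
      · exact hdead s' h3 h2
      · exact not_agrees_of_not_survives (hns s' h3 h1 (by omega))
    have e1 : BinOp.eval E.w .add (min t (m - q)) v = min t (m - q) + v := eval_add (by omega)
    refine Ends.ite (fun hc' => Ends.seq ?_) (fun hc' => ?_)
    -- The pattern ends strictly inside the block, so it has been compared completely.
    · simp [hh, hv, r1, e1] at hc'
      rw [Survives, min_eq_right (by omega)] at hsur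
      have hcnt : fullMatches p f m X (s + (v + 1)) + 1 ≤ fullMatches p f m X (s + a) :=
        (fullMatches_succ (by omega) hsur).trans (fullMatches_anti _ _ _ _ (by omega))
      have step : ∀ st₃ : Store Var, Keeps [.z, .y] st₂ st₃ → st₃.mem = st₂.mem →
          st₃.out = occList p f n m (s + (v + 1)) → ∀ T₀ ≤ 47,
          Ends E (.block [.op .add .lo .v .one]) st₃ fun T st' =>
            ∃ φ', BlockInv p f n m t i X st₀ φ' st' ∧
              φ' + (T₀ + T) + 2 ≤ 60 * ((X - s) / t + fullMatches p f m X (s + a) + 1) := by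
        intro st₃ hK₃ hM₃ hO₃ T₀ hT₀
        have e2 : BinOp.eval E.w .add v 1 = v + 1 := eval_add (by omega)
        have hlo : (execAll E [Basic.op .add .lo .v .one] st₃).reg .lo = v + 1 := by
          simp [hK₃ .v (by simp), hK₃ .one (by simp), hv, r5, e2]
        have hqq : (execAll E [Basic.op .add .lo .v .one] st₃).reg .q = q := by
          simp [hK₃ .q (by simp), r2]
        refine Ends.block (by simp) ⟨60 * ((X - s) / t + fullMatches p f m X (s + (v + 1)) + 1),
          ⟨?_, by simp [hM₃, hMM], Or.inl ⟨?_, s, ⟨?_, ?_, ?_, ?_, hag, ?_, ?_⟩, ?_⟩⟩, ?_⟩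
        · exact (hKK.trans hK₃ (List.Subset.refl _) (by simp [blockScratch])).trans
            (keeps_execAll E _ st₃ (L := [.lo]) (by simp [target])) (List.Subset.refl _)
            (by simp [blockScratch])
        · simp [hK₃ .go (by simp), r7]
        · rw [hqq, hsi]
        · rw [hqq]; exact hqm
        · rw [hlo]; omega
        · rw [hlo, hqq]; omega
        · rw [hlo]
          intro s' h1 h2
          rcases (show s' < s + v ∨ s' = s + v by omega) with h3 | h3
          · exact hdead' s' h3 h2
          · omega
        · rw [hlo, ← hO₃]; simp
        · rw [hlo]
        · simp; omega
      refine Ends.ite (fun hc'' => Ends.block (by simp) ?_)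
        (fun hc'' => Ends.block (by simp) ?_)
      · simp [hh, hv, r3, e1] at hc''
        refine (step _ (keeps_execAll E [Basic.op .add .y .h .v] st₂ (by simp [target])) (by simp)
          ?_ (T + 4) (by omega)).mono ?_
        · rw [← add_assoc, occList_succ, if_neg (fun h => by have := h.2; omega), hocc, ← hOO]
          simp
        · rintro T' st' ⟨φ', h1, h2⟩
          exact ⟨φ', h1, by simp at h2 ⊢; omega⟩
      · simp [hh, hv, r3, e1] at hc''
        have e2 : BinOp.eval E.w .sub i q = s := by
          rw [eval_sub (by omega) (by omega)]; omega
        have e3 : BinOp.eval E.w .add s v = s + v := eval_add (by omega)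
        refine (step (execAll E [Basic.op .sub .z .pos .q, .op .add .z .z .v, .report .z]
            (execAll E [Basic.op .add .y .h .v] st₂)) ?_ (by simp) ?_
          (T + 8) (by omega)).mono ?_
        · exact (keeps_execAll E [Basic.op .add .y .h .v] st₂ (L := [.y]) (by simp [target])).trans
            (keeps_execAll E _ _ (L := [.z]) (by simp [target])) (by simp) (by simp)
        · rw [← add_assoc, occList_succ, if_pos ⟨hsur, by omega⟩, hocc, ← hOO]
          simp [r4, r2, hv, e2, e3]
        · rintro T' st' ⟨φ', h1, h2⟩
          exact ⟨φ', h1, by simp at h2 ⊢; omega⟩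
    -- The alignment reaches the end of the block. A match that ends exactly there gives the state
    -- `m` and is reported with the next block.
    · simp [hh, hv, r1, e1] at hc'
      rw [Survives, min_eq_left (by omega)] at hsur
      have e2 : BinOp.eval E.w .sub q v = q - v := eval_sub (by omega) (by omega)
      have e3 : BinOp.eval E.w .add (q - v) t = q - v + t := eval_add (by omega)
      have hqq : (execAll E [Basic.op .sub .q .q .v, .op .add .q .q .t, .const .go 0]
          (execAll E [Basic.op .add .y .h .v] st₂)).reg .q = q - v + t := by
        simp [r2, hv, r1, e2, e3]
      have hdm := Nat.div_le_div_right (c := t) (show X - (s + v) ≤ X - s by omega)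
      have hcm := fullMatches_anti p f m X (show s + a ≤ s + v by omega)
      refine Ends.block (by simp) ⟨60 * ((X - (s + v)) / t + fullMatches p f m X (s + v)),
        ⟨?_, by simp [hMM], Or.inr ⟨by simp, s + v, ⟨?_, ?_, hsur, hdead', ?_⟩, by omega, rfl⟩⟩, ?_⟩
      · exact (hKK.trans (keeps_execAll E _ st₂ (L := [.y]) (by simp [target]))
          (List.Subset.refl _) (by simp [blockScratch])).trans
            (keeps_execAll E _ _ (L := [.q, .go]) (by simp [target])) (List.Subset.refl _)
            (by simp [blockScratch])
      · rw [hqq]; omega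
      · rw [hqq]; omega
      · rw [hocc, ← hOO]; simp
      · simp; omega
  · simp only [Cond.Holds, hv, r1] at hc
    obtain rfl : v = t := by omega
    refine Ends.ite (fun hc' => Ends.seq ?_) (fun hc' => ?_)
    -- As `q < t`, all alignments up to `i` are shifts below `t` and have been dealt with.
    · simp only [Cond.Holds, r1, r2] at hc'
      have hcm := fullMatches_anti p f m X (show s + a ≤ i + 1 by omega)
      refine startScan_ends hI hF (hB₁.congr (by simp; simp [hK₂ _]))
        (hl₁.congr (by simp; simp [hK₂ _])) (hMM ▸ hT) (X := X)
        (by rw [hK₂ _ (by simp), hK _ (by simp [blockScratch]), hu]) hin (by omega) r4 r3 ?_ ?_ ?_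
      · rw [hOO]
        exact (occList_eq_of_le (by omega) fun s' h1 h2 =>
          not_occurs_of_not_survives (t := v) (i := i) (by omega)
            (hns s' h1 (by omega) (by omega))).symm
      · intro s' h1 h2
        rcases (show s' < s + a ∨ s + a ≤ s' by omega) with h3 | h3
        · exact hdead s' h3 h2
        · exact not_agrees_of_not_survives (hns s' h3 (by omega) (by omega))
      · intro T' st₃ s₃ hS hs₃ hK₃ hM₃ hT₃
        have hdm := Nat.div_le_div_right (c := v) (show X - s₃ ≤ X - s by omega)
        have hadd := hS.add_eq
        refine Ends.block (by simp) ⟨60 * ((X - s₃) / v + fullMatches p f m X s₃),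
          ⟨?_, by simp [hM₃, hMM], Or.inr ⟨by simp, s₃, ⟨by simpa using hadd, by simpa using hS.q_le,
            hS.agrees, hS.dead, by simpa using hS.out_eq⟩, by omega, rfl⟩⟩, ?_⟩
        · exact (hKK.trans hK₃ (List.Subset.refl _) (by simp [blockScratch])).trans
            (keeps_execAll E _ st₃ (L := [.go]) (by simp [target])) (List.Subset.refl _)
            (by simp [blockScratch])
        · simp; omega
    · simp only [Cond.Holds, r1, r2] at hc'
      have hbo := hT.borders q (by omega) hqm
      rw [← hMM] at hbo
      set q' := st₂.mem (2 * (m + 1) + q) with hq'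
      obtain ⟨hb1, hb2, hb3⟩ := hbo
      have e2 : BinOp.eval E.w .add (2 * (m + 1)) q = 2 * (m + 1) + q := eval_add (by omega)
      -- Shifts below `t` are excluded by the table, and larger ones before the new alignment by the
      -- maximality of the border.
      have hns' : ∀ s', s + a ≤ s' → s' < i - q' → ¬ Survives p f v m i s' := by
        intro s' h1 h2 h3
        rcases (show s' < s + v ∨ s + v ≤ s' by omega) with h4 | h4
        · exact hns s' h1 h4 (by omega) h3
        · refine hb3 (s' - s) (by omega) (by omega) ?_
          have := (hag.shift_iff (show s ≤ s' by omega)).mp (h3.anti (by omega) (by omega))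
          rwa [show i - s = q by omega] at this
      have hlo : (execAll E [Basic.op .add .z .baseJ .q, .load .q .z, .const .lo 0] st₂).reg .lo
          = 0 := by simp
      have hqq : (execAll E [Basic.op .add .z .baseJ .q, .load .q .z, .const .lo 0] st₂).reg .q
          = q' := by simp [r6, r2, e2, hq']
      -- The new border is shorter by at least the block length, so the quotient drops by one.
      have hdm : (X - (i - q')) / v + 1 ≤ (X - s) / v := by
        rw [← Nat.add_div_right _ (by omega)]
        exact Nat.div_le_div_right (by omega)
      have hcm := fullMatches_anti p f m X (show s + a ≤ i - q' by omega)
      refine Ends.block ?_ ⟨60 * ((X - (i - q')) / v + fullMatches p f m X (i - q') + 1),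
        ⟨?_, by simp [hMM], Or.inl ⟨by simp [r7], i - q', ⟨?_, ?_, ?_, ?_, ?_, ?_, ?_⟩, ?_⟩⟩, ?_⟩
      · simp [r6, r2, e2]; omega
      · exact hKK.trans (keeps_execAll E _ st₂ (L := [.z, .q, .lo]) (by simp [target]))
          (List.Subset.refl _) (by simp [blockScratch])
      · rw [hqq]; omega
      · rw [hqq]; omega
      · rw [hlo]; omega
      · rw [hlo]; omega
      · rw [hag.shift_iff (by omega), show i - q' - s = q - q' by omega, show i - s = q by omega]
        exact hb2
      · rw [hlo]
        intro s' h1 h2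
        rcases (show s' < s + a ∨ s + a ≤ s' by omega) with h3 | h3
        · exact hdead s' h3 h2
        · exact not_agrees_of_not_survives (hns' s' h3 (by omega))
      · rw [hlo, add_zero, occList_eq_of_le (S := s + a) (by omega) fun s' h1 h2 =>
          not_occurs_of_not_survives (t := v) (i := i) (by omega) (hns' s' h1 h2), ← hOO]
        simp
      · rw [hlo, add_zero]
      · simp; omega

theorem processBlock_ends (hI : Instance E n m c k p f) (hF : Fits E m k c t) {st : Store Var}
    (hB : Basics n m c k st) (hl : Layout m c t p st) (hT : Tables m c t p st.mem) {i X s : ℕ}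
    (hu : st.reg .u = chunk c f i t) (hin : i ≤ n) (hX : i + t < X) (hpos : st.reg .pos = i)
    (hrem : st.reg .rem = n - i) (hS : State p f n m i st s) {Q : ℕ → Store Var → Prop}
    (hQ : ∀ T st' s', State p f n m (i + t) st' s' → s' ≤ i + t →
      Keeps blockScratch st st' → st'.mem = st.mem →
      T + 60 * ((X - s') / t + fullMatches p f m X s') ≤
        60 * ((X - s) / t + fullMatches p f m X s) + 64 → Q T st') :
    Ends E processBlock st Q := by
  have h2w : 1 < 2 ^ E.w := Nat.one_lt_two_pow (by have := hI.w_pos; omega)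
  refine Ends.seq (Ends.block (by simp) ?_)
  refine Ends.loop (I := BlockInv p f n m t i X st)
    (φ := 60 * ((X - s) / t + fullMatches p f m X s + 1)) ?_ ?_ ?_
  · rintro φ st₁ ⟨hK, hM, ⟨hgo, s₁, hP, rfl⟩ | ⟨hgo, -⟩⟩ hc
    · exact processBlock_round hI hF hB hl hT hu hin hX hpos hrem hK hM hgo hP
    · have hz : st₁.reg .zero = 0 := by rw [hK _ (by simp [blockScratch]), hB.reg_zero]
      simp [hz, hgo] at hc
  · have hlo : (execAll E [Basic.const .lo 0, .const .go 1] st).reg .lo = 0 := by simp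
    refine ⟨keeps_execAll E _ st (by simp [target, blockScratch]), by simp,
      Or.inl ⟨by simp [Nat.mod_eq_of_lt h2w], s, ⟨by simpa using hS.add_eq, by simpa using hS.q_le,
        by simp, by simp, hS.agrees, ?_, ?_⟩, ?_⟩⟩
    · rw [hlo]
      intro s' h1 h2 h3
      have := hS.add_eq
      exact hS.dead s' h1 (by omega) (h3.anti (by omega) (by omega))
    · rw [hlo, add_zero, ← hS.out_eq]; simp
    · rw [hlo, add_zero]
  · rintro T φ' st₁ ⟨hK, hM, ⟨hgo, -⟩ | ⟨hgo, s₁, hS₁, hle, rfl⟩⟩ hc hT'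
    · have hz : st₁.reg .zero = 0 := by rw [hK _ (by simp [blockScratch]), hB.reg_zero]
      simp [hz, hgo] at hc
    · exact hQ _ _ s₁ hS₁ hle hK hM (by simp; omega)

/-- Search with all tables computed. -/
def blockSearch : Com Var :=
  .seq (.block [.const .pos 0, .op .add .rem .zero .n, .const .q 0, .const .more 1])
    (.loop (.lt .zero .more)
      (.seq (fetch .text .u .pos .maskT)
        (.seq processBlock
          (.ite (.lt .rem .t) (.block [.const .more 0])
            (.block [.op .sub .rem .rem .t, .op .add .pos .pos .t])))))

/-- Each block costs a constant beyond the potential, which starts at `X / t` plus the number of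
full matches and is never replenished. -/
theorem blockSearch_ends (hI : Instance E n m c k p f) (hF : Fits E m k c t) {st : Store Var}
    (hB : Basics n m c k st) (hl : Layout m c t p st) (hT : Tables m c t p st.mem)
    (hout : st.out = []) {Q : ℕ → Store Var → Prop}
    (hQ : ∀ T st', st'.out = occList p f n m (n + 1) →
      T ≤ 90 * (n / t + 1) + 60 * ((n + t + 1) / t + fullMatches p f m (n + t + 1) 0) + 6 →
      Q T st') :
    Ends E blockSearch st Q := by
  have h2w : 1 < 2 ^ E.w := Nat.one_lt_two_pow (by have := hI.w_pos; omega)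
  have htw := hF.t_lt hI
  have hnw := hI.n_lt
  have hmn := hI.m_le
  have ht1 := hF.one_le_t
  have htk := hF.two_t_le
  have e0 : BinOp.eval E.w .add 0 n = n := by rw [eval_add] <;> omega
  -- This exceeds the end of every block, hence every alignment that occurs.
  set X := n + t + 1 with hX
  set scratch : List Var := [.u, .lo, .go, .h, .x, .y, .z, .dm, .v, .q, .f₁, .f₂, .f₃, .pos, .rem,
    .more] with hscr
  refine Ends.seq (Ends.block (by simp) ?_)
  refine Ends.loop (I := fun φ st' => Keeps scratch st st' ∧ st'.mem = st.mem ∧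
      ((st'.reg .more = 1 ∧ ∃ i s, st'.reg .pos = i ∧ i ≤ n ∧ st'.reg .rem = n - i ∧
        State p f n m i st' s ∧
        φ = 90 * ((n - i) / t + 1) + 60 * ((X - s) / t + fullMatches p f m X s)) ∨
      (st'.reg .more = 0 ∧ st'.out = occList p f n m (n + 1))))
    (φ := 90 * (n / t + 1) + 60 * (X / t + fullMatches p f m X 0)) ?_ ?_ ?_
  · rintro φ st₁ ⟨hK, hM, ⟨hmore, i, s, hpos, hin, hrem, hS, rfl⟩ | ⟨hmore, -⟩⟩ hc
    · have hB₁ : Basics n m c k st₁ := hB.congr (by simp; simp [hK _, hscr])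
      have hl₁ : Layout m c t p st₁ := hl.congr (by simp; simp [hK _, hscr])
      refine Ends.seq (fetch_ends hB₁ rfl hI.f_lt hI.text hI.one_le_k hI.one_le_c hI.word hpos
        (by omega) hl₁.reg_maskT (by omega) (by simp) (by simp) (by simp)
        fun st₂ hu hK₂ hM₂ hO₂ => ?_)
      have hS₂ : State p f n m i st₂ s := by
        obtain ⟨h1, h2, h3, h4, h5⟩ := hS
        exact ⟨by rw [hK₂ _ (by simp), h1], by rw [hK₂ _ (by simp)]; exact h2, h3, h4,
          by rw [hO₂, h5]⟩
      refine Ends.seq (processBlock_ends hI hF (hB₁.congr (by simp; simp [hK₂ _]))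
        (hl₁.congr (by simp; simp [hK₂ _])) (by rw [hM₂, hM]; exact hT) hu hin (X := X) (by omega)
        (by rw [hK₂ _ (by simp), hpos]) (by rw [hK₂ _ (by simp), hrem]) hS₂ ?_)
      intro T st₃ s₃ hS₃ hle hK₃ hM₃ hT₃
      have r1 : st₃.reg .t = t := by
        rw [hK₃ _ (by simp [blockScratch]), hK₂ _ (by simp), hl₁.reg_t]
      have r2 : st₃.reg .rem = n - i := by
        rw [hK₃ _ (by simp [blockScratch]), hK₂ _ (by simp), hrem]
      have r3 : st₃.reg .pos = i := by
        rw [hK₃ _ (by simp [blockScratch]), hK₂ _ (by simp), hpos]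
      have r4 : st₃.reg .more = 1 := by
        rw [hK₃ _ (by simp [blockScratch]), hK₂ _ (by simp), hmore]
      have hKK : Keeps scratch st st₃ :=
        (hK.trans hK₂ (L := scratch) (List.Subset.refl _) (by simp [hscr])).trans hK₃
          (List.Subset.refl _) (by simp [hscr, blockScratch])
      have hMM : st₃.mem = st.mem := by rw [hM₃, hM₂, hM]
      refine Ends.ite (fun hc' => ?_) (fun hc' => ?_)
      · simp only [Cond.Holds, r1, r2] at hc'
        refine Ends.block (by simp) ⟨0, ⟨?_, by simp [hMM], Or.inr ⟨by simp, ?_⟩⟩, ?_⟩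
        · exact hKK.trans (keeps_execAll E _ st₃ (L := [.more]) (by simp [target]))
            (List.Subset.refl _) (by simp [hscr])
        · have hqm := hS₃.q_le
          have hadd := hS₃.add_eq
          -- The last block ends strictly after position `n`. Since `q ≤ m`, every alignment from
          -- `s₃` on ends beyond the text; in particular no match is left unreported in the state
          -- `m`.
          have heq : occList p f n m s₃ = occList p f n m (n + 1) := by
            rcases le_total s₃ (n + 1) with h | h
            · exact (occList_eq_of_le h fun s' h1 h2 h3 => by have := h3.2; omega).symm
            · exact occList_eq_of_le h fun s' h1 h2 h3 => by have := h3.2; omega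
          rw [← heq, ← hS₃.out_eq]; simp
        · generalize (n - i) / t = A, (X - s) / t = B, (X - s₃) / t = B' at hT₃ ⊢
          simp; omega
      · simp only [Cond.Holds, r1, r2] at hc'
        have e1 : BinOp.eval E.w .sub (n - i) t = n - i - t := eval_sub (by omega) (by omega)
        have e2 : BinOp.eval E.w .add i t = i + t := eval_add (by omega)
        have hdiv : (n - (i + t)) / t + 1 = (n - i) / t := by
          rw [← Nat.add_div_right _ (by omega)]; congr 1; omega
        refine Ends.block (by simp) ⟨90 * ((n - (i + t)) / t + 1) +
          60 * ((X - s₃) / t + fullMatches p f m X s₃), ⟨?_, by simp [hMM],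
            Or.inl ⟨by simp [r4], i + t, s₃, ?_, by omega, ?_, ?_, rfl⟩⟩, ?_⟩
        · exact hKK.trans (keeps_execAll E _ st₃ (L := [.rem, .pos]) (by simp [target]))
            (List.Subset.refl _) (by simp [hscr])
        · simp [r3, r1, e2]
        · simp [r2, r1, e1]; omega
        · exact ⟨by simpa using hS₃.add_eq, by simpa using hS₃.q_le, hS₃.agrees, hS₃.dead,
            by simpa using hS₃.out_eq⟩
        · rw [← hdiv]; simp; omega
    · have hz : st₁.reg .zero = 0 := by rw [hK _ (by simp [hscr]), hB.reg_zero]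
      simp [hz, hmore] at hc
  · refine ⟨keeps_execAll E _ st (by simp [target, hscr]), by simp,
      Or.inl ⟨by simp [Nat.mod_eq_of_lt h2w], 0, 0, by simp, by omega,
        by simp [hB.reg_zero, hB.reg_n, e0], ⟨by simp, by simp, agrees_self _ _ _, by simp, ?_⟩, ?_⟩⟩
    · simp [hout, occList]
    · simp
  · rintro T φ' st₁ ⟨hK, hM, ⟨hmore, -⟩ | ⟨hmore, hO⟩⟩ hc hT'
    · have hz : st₁.reg .zero = 0 := by rw [hK _ (by simp [hscr]), hB.reg_zero]
      simp [hz, hmore] at hc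
    · exact hQ _ _ hO (by simp; omega)

end

section

variable {E : Env} {n m c k t : ℕ} {p f : ℕ → ℕ}

/-! ### The program -/

/-- Compute the block length `t` as `k / 2 ^ a`. -/
def computeBlockLength (a : ℕ) : Com Var :=
  .seq (.block [.op .add .t .zero .k]) (.block (List.replicate a (.op .shr .t .t .one)))

/-- Repeated shifts by one avoid loading the constant `a`, which might not fit into a short word. -/
theorem execAll_replicate_shr (E : Env) (a : ℕ) {st : Store Var} (h1 : st.reg .one = 1)
    (ht : st.reg .t < 2 ^ E.w) :
    SafeAll E (List.replicate a (.op .shr .t .t .one)) st ∧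
      execAll E (List.replicate a (.op .shr .t .t .one)) st = st.set .t (st.reg .t / 2 ^ a) := by
  induction a generalizing st with
  | zero => simp
  | succ a ih =>
    have e : BinOp.eval E.w .shr (st.reg .t) 1 = st.reg .t / 2 := by rw [eval_shr ht, pow_one]
    obtain ⟨h2, h3⟩ := ih (st := (Basic.op .shr .t .t .one).exec E st) (by simp [h1])
      (by simp [h1, e]; omega)
    rw [List.replicate_succ]
    refine ⟨⟨trivial, h2⟩, ?_⟩
    rw [execAll, h3]
    simp [h1, e, Nat.div_div_eq_div_mul, pow_succ']

theorem computeBlockLength_ends (hI : Instance E n m c k p f) {st : Store Var}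
    (hB : Basics n m c k st) (a : ℕ) {Q : ℕ → Store Var → Prop}
    (hQ : ∀ st', st'.reg .t = k / 2 ^ a → Keeps [.t] st st' → st'.mem = st.mem →
      st'.out = st.out → Q (1 + a) st') :
    Ends E (computeBlockLength a) st Q := by
  have hk : k < 2 ^ E.w := by
    have := (hI.mul_lt le_rfl).2
    have := hI.one_le_c
    nlinarith
  have e : BinOp.eval E.w .add 0 k = k := by rw [eval_add] <;> omega
  have hr : (execAll E [Basic.op .add .t .zero .k] st).reg .t = k := by
    simp [hB.reg_zero, hB.reg_k, e]
  obtain ⟨h1, h2⟩ := execAll_replicate_shr E a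
    (st := execAll E [Basic.op .add .t .zero .k] st) (by simp [hB.reg_one]) (by rw [hr]; exact hk)
  refine Ends.seq (Ends.block (by simp) (Ends.block h1 ?_))
  rw [h2, hr, List.length_replicate]
  refine hQ _ (by simp) (fun r hr => ?_) (by simp) (by simp)
  simp only [List.mem_cons, List.not_mem_nil, or_false] at hr
  simp [hr]

/-- Set the registers that describe the memory layout. -/
def computeLayout : Com Var :=
  .seq (.block [.op .mul .ct .c .t, .op .add .y .t .t, .op .mul .cw .c .y,
      .op .shl .maskT .one .ct, .op .sub .maskT .maskT .one,
      .op .shl .maskW .one .cw, .op .sub .maskW .maskW .one,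
      .op .shl .maskD .one .t, .op .sub .maskD .maskD .one,
      .op .add .baseD .m .one, .op .add .baseJ .baseD .baseD, .op .add .baseT .baseJ .baseD,
      .op .add .y .ct .cw, .op .add .y .y .t, .op .add .y .y .t, .op .shl .lim .one .y,
      .op .add .baseU .baseT .lim])
    (fetch .pattern .head .zero .maskT)

theorem computeLayout_ends (hI : Instance E n m c k p f) (hF : Fits E m k c t) {st : Store Var}
    (hB : Basics n m c k st) (ht : st.reg .t = t) {Q : ℕ → Store Var → Prop}
    (hQ : ∀ st', Basics n m c k st' → Layout m c t p st' → st'.reg .lim = shiftSize c t →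
      st'.mem = st.mem → st'.out = st.out → Q 29 st') :
    Ends E computeLayout st Q := by
  have h2tw := hF.two_t_le_word hI
  have htw := hF.t_lt hI
  have htk := hF.two_t_le
  have hbw := hI.bound_le
  have hbd := hF.bound_eq
  have hw1 := hI.w_pos
  have hS : 0 < startSize c t := by unfold startSize; positivity
  have hS' : 0 < shiftSize c t := by unfold shiftSize; positivity
  have hexp : c * t + c * (2 * t) + t + t < 2 ^ E.w := by
    refine lt_of_lt_of_le Nat.lt_two_pow_self (?_ : shiftSize c t ≤ _); omega
  have h2t : 2 * t < 2 ^ E.w := lt_of_le_of_lt h2tw Nat.lt_two_pow_self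
  have l1 := hI.mul_lt (show t ≤ k by omega)
  have l2 := hI.mul_lt htk
  have e1 : BinOp.eval E.w .mul c t = c * t := eval_mul l1.2
  have e2 : BinOp.eval E.w .add t t = 2 * t := by rw [eval_add] <;> omega
  have e3 : BinOp.eval E.w .mul c (2 * t) = c * (2 * t) := eval_mul l2.2
  have e4 := eval_mask hw1 l1.1
  have e5 := eval_mask hw1 l2.1
  have e6 := eval_mask hw1 (show t ≤ E.w by omega)
  have e7 : BinOp.eval E.w .add m 1 = m + 1 := eval_add (by omega)
  have e8 : BinOp.eval E.w .add (m + 1) (m + 1) = 2 * (m + 1) := by rw [eval_add] <;> omega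
  have e9 : BinOp.eval E.w .add (2 * (m + 1)) (m + 1) = 3 * (m + 1) := by
    rw [eval_add] <;> omega
  have e10 : BinOp.eval E.w .add (c * t) (c * (2 * t)) = c * t + c * (2 * t) := eval_add (by omega)
  have e11 : BinOp.eval E.w .add (c * t + c * (2 * t)) t = c * t + c * (2 * t) + t :=
    eval_add (by omega)
  have e12 : BinOp.eval E.w .add (c * t + c * (2 * t) + t) t = c * t + c * (2 * t) + t + t :=
    eval_add (by omega)
  have e13 : BinOp.eval E.w .shl 1 (c * t + c * (2 * t) + t + t) = shiftSize c t := by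
    rw [eval_shl, one_mul, shiftSize]
    rw [one_mul]; show shiftSize c t < _; omega
  have e14 : BinOp.eval E.w .add (3 * (m + 1)) (shiftSize c t) = 3 * (m + 1) + shiftSize c t :=
    eval_add (by omega)
  refine Ends.seq (Ends.block (by simp) ?_)
  set b : List (Basic Var) := [.op .mul .ct .c .t, .op .add .y .t .t, .op .mul .cw .c .y,
      .op .shl .maskT .one .ct, .op .sub .maskT .maskT .one,
      .op .shl .maskW .one .cw, .op .sub .maskW .maskW .one,
      .op .shl .maskD .one .t, .op .sub .maskD .maskD .one,
      .op .add .baseD .m .one, .op .add .baseJ .baseD .baseD, .op .add .baseT .baseJ .baseD,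
      .op .add .y .ct .cw, .op .add .y .y .t, .op .add .y .y .t, .op .shl .lim .one .y,
      .op .add .baseU .baseT .lim] with hb
  have hK : Keeps [.ct, .y, .cw, .maskT, .maskW, .maskD, .baseD, .baseJ, .baseT, .lim, .baseU] st
    (execAll E b st) := keeps_execAll E b st (by simp [hb, target])
  have hB₁ : Basics n m c k (execAll E b st) := hB.congr (by simp; simp [hK _])
  have hM₁ : (execAll E b st).mem = st.mem := by simp [hb]
  have hO₁ : (execAll E b st).out = st.out := by simp [hb]
  have q0 : (execAll E b st).reg .t = t := by rw [hK _ (by simp), ht]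
  have q1 : (execAll E b st).reg .ct = c * t := by simp [hb, hB.reg_c, ht, e1]
  have q2 : (execAll E b st).reg .cw = c * (2 * t) := by simp [hb, hB.reg_c, ht, e2, e3]
  have q3 : (execAll E b st).reg .maskT = 2 ^ (c * t) - 1 := by
    simp [hb, hB.reg_c, hB.reg_one, ht, e1, e4]
  have q4 : (execAll E b st).reg .maskW = 2 ^ (c * (2 * t)) - 1 := by
    simp [hb, hB.reg_c, hB.reg_one, ht, e2, e3, e5]
  have q5 : (execAll E b st).reg .maskD = 2 ^ t - 1 := by simp [hb, hB.reg_one, ht, e6]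
  have q6 : (execAll E b st).reg .baseD = m + 1 := by simp [hb, hB.reg_m, hB.reg_one, e7]
  have q7 : (execAll E b st).reg .baseJ = 2 * (m + 1) := by
    simp [hb, hB.reg_m, hB.reg_one, e7, e8]
  have q8 : (execAll E b st).reg .baseT = 3 * (m + 1) := by
    simp [hb, hB.reg_m, hB.reg_one, e7, e8, e9]
  have q9 : (execAll E b st).reg .lim = shiftSize c t := by
    simp [hb, hB.reg_c, hB.reg_one, ht, e1, e2, e3, e10, e11, e12, e13]
  have q10 : (execAll E b st).reg .baseU = 3 * (m + 1) + shiftSize c t := by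
    simp [hb, hB.reg_m, hB.reg_c, hB.reg_one, ht, e1, e2, e3, e7, e8, e9, e10, e11, e12, e13, e14]
  have hlen : b.length = 17 := by simp [hb]
  clear_value b
  refine fetch_ends hB₁ rfl hI.p_lt hI.pattern hI.one_le_k hI.one_le_c hI.word hB₁.reg_zero
    (by positivity) q3 (by omega) (by simp) (by simp) (by simp) fun st₂ hx hK₂ hM₂ hO₂ => ?_
  rw [hlen]
  refine hQ _ (hB₁.congr (by simp; simp [hK₂ _])) ⟨?_, ?_, ?_, ?_, ?_, ?_, ?_, ?_, ?_, ?_, hx⟩ ?_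
    (by rw [hM₂, hM₁]) (by rw [hO₂, hO₁])
  all_goals rw [hK₂ _ (by simp)]; assumption

/-- The algorithm for short patterns and blocks of positive length. -/
def blockAlgorithm : Com Var :=
  .seq computeLayout
    (.seq periodTable
      (.seq (.block [.op .add .base .zero .baseJ, .op .add .i .zero .t])
        (.seq borderTable
          (.seq (.block [.op .add .base .zero .baseT])
            (.seq (fill shiftEntry)
              (.seq (.block [.op .add .base .zero .baseU, .op .add .y .ct .t, .op .shl .lim .one .y])
                (.seq (fill startEntry) blockSearch)))))))

/-- The memory holds the failure function, the period masks and the fallback borders, `m + 1` cells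
each, and then the two tables. The order of construction respects the dependencies, and no later
stage destroys an earlier result. -/
theorem blockAlgorithm_ends (hI : Instance E n m c k p f) (hF : Fits E m k c t) {st : Store Var}
    (hB : Basics n m c k st) (ht : st.reg .t = t)
    (hπ : ∀ j, 1 ≤ j → j ≤ m → Border p 1 j (st.mem j)) (hout : st.out = [])
    {Q : ℕ → Store Var → Prop}
    (hQ : ∀ T st', st'.out = occList p f n m (n + 1) →
      T ≤ 72 * m + 60 + (21 * t + 15) * (shiftSize c t + startSize c t) +
        90 * (n / t + 1) + 60 * ((n + t + 1) / t + fullMatches p f m (n + t + 1) 0) → Q T st') :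
    Ends E blockAlgorithm st Q := by
  have h2tw := hF.two_t_le_word hI
  have htw := hF.t_lt hI
  have ht1 := hF.one_le_t
  have hbw := hI.bound_le
  have hbd := hF.bound_eq
  have hS : 0 < startSize c t := by unfold startSize; positivity
  have htS : t < shiftSize c t :=
    lt_of_lt_of_le Nat.lt_two_pow_self (Nat.pow_le_pow_right (by norm_num) (by omega))
  have hexp : c * t + t < 2 ^ E.w := by
    refine lt_of_lt_of_le Nat.lt_two_pow_self (?_ : startSize c t ≤ _); omega
  have ez : ∀ x, x < 2 ^ E.w → BinOp.eval E.w .add 0 x = x := fun x hx => by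
    rw [eval_add] <;> omega
  refine Ends.seq (computeLayout_ends hI hF hB ht fun st₁ hB₁ hl₁ hlim₁ hM₁ hO₁ => ?_)
  refine Ends.seq (periodTable_ends hI hB₁ ht1 (by omega) (by omega) hl₁.reg_baseD hl₁.reg_maskD
    (by rw [hM₁]; exact hπ) fun T₂ st₂ hmasks₂ hM₂ hK₂ hO₂ hT₂ => ?_)
  have hB₂ : Basics n m c k st₂ := hB₁.congr (by simp; simp [hK₂ _])
  have hl₂ : Layout m c t p st₂ := hl₁.congr (by simp; simp [hK₂ _])
  refine Ends.seq (Ends.block (by simp) ?_)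
  set st₃ := execAll E [Basic.op .add .base .zero .baseJ, .op .add .i .zero .t] st₂ with hst₃
  have hK₃ : Keeps [.base, .i] st₂ st₃ := keeps_execAll E _ st₂ (by simp [target])
  have hB₃ : Basics n m c k st₃ := hB₂.congr (by simp; simp [hK₃ _])
  have hl₃ : Layout m c t p st₃ := hl₂.congr (by simp; simp [hK₃ _])
  have hM₃ : st₃.mem = st₂.mem := by simp [hst₃]
  have hO₃ : st₃.out = st₂.out := by simp [hst₃]
  -- If `t > m`, the single entry written here may fall into the region of the shift table, which is
  -- filled only afterwards.
  refine Ends.seq (borderTable_ends hI hB₃ (o := t) (bs := 2 * (m + 1))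
    (by simp [hst₃, hB₂.reg_zero, hl₂.reg_t, ez t htw])
    (by simp [hst₃, hB₂.reg_zero, hl₂.reg_baseJ, ez (2 * (m + 1)) (by omega)]) ht1 (by omega)
    (Or.inr ⟨by omega, fun j h1 h2 => by rw [hM₃, hM₂ j h2, hM₁]; exact hπ j h1 h2⟩)
    fun T₄ st₄ hborders₄ hM₄ hK₄ hO₄ hT₄ => ?_)
  have hB₄ : Basics n m c k st₄ := hB₃.congr (by simp; simp [hK₄ _])
  have hl₄ : Layout m c t p st₄ := hl₃.congr (by simp; simp [hK₄ _])
  refine Ends.seq (Ends.block (by simp) ?_)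
  set st₅ := execAll E [Basic.op .add .base .zero .baseT] st₄ with hst₅
  have hK₅ : Keeps [.base] st₄ st₅ := keeps_execAll E _ st₄ (by simp [target])
  have hB₅ : Basics n m c k st₅ := hB₄.congr (by simp; simp [hK₅ _])
  have hl₅ : Layout m c t p st₅ := hl₄.congr (by simp; simp [hK₅ _])
  have hM₅ : st₅.mem = st₄.mem := by simp [hst₅]
  have hO₅ : st₅.out = st₄.out := by simp [hst₅]
  refine Ends.seq (fill_ends (R := ShiftEntry c t) (bs := 3 * (m + 1)) (N := shiftSize c t)
    (K := 21 * t + 10) (L := [.u, .z, .x, .dm, .h, .lo, .d, .res, .len, .y]) hB₅.reg_one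
    (by simp [hst₅, hB₄.reg_zero, hl₄.reg_baseT, ez (3 * (m + 1)) (by omega)])
    (by rw [hK₅ _ (by simp), hK₄ _ (by simp), hK₃ _ (by simp), hK₂ _ (by simp), hlim₁])
    (by omega) hbw (by omega) (by simp)
    (fun st' a hK' ha haN => shiftEntry_ends hI hF (hB₅.congr (by simp; simp [hK' _]))
      (hl₅.congr (by simp; simp [hK' _])) ha haN)
    fun T₆ st₆ hshifts₆ hM₆ hK₆ hO₆ hT₆ => ?_)
  have hB₆ : Basics n m c k st₆ := hB₅.congr (by simp; simp [hK₆ _])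
  have hl₆ : Layout m c t p st₆ := hl₅.congr (by simp; simp [hK₆ _])
  have e1 : BinOp.eval E.w .add (c * t) t = c * t + t := eval_add hexp
  have e2 : BinOp.eval E.w .shl 1 (c * t + t) = startSize c t := by
    rw [eval_shl, one_mul, startSize]
    rw [one_mul]; show startSize c t < _; omega
  refine Ends.seq (Ends.block (by simp) ?_)
  set st₇ := execAll E [Basic.op .add .base .zero .baseU, .op .add .y .ct .t,
    .op .shl .lim .one .y] st₆ with hst₇
  have hK₇ : Keeps [.base, .y, .lim] st₆ st₇ := keeps_execAll E _ st₆ (by simp [target])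
  have hB₇ : Basics n m c k st₇ := hB₆.congr (by simp; simp [hK₇ _])
  have hl₇ : Layout m c t p st₇ := hl₆.congr (by simp; simp [hK₇ _])
  have hM₇ : st₇.mem = st₆.mem := by simp [hst₇]
  have hO₇ : st₇.out = st₆.out := by simp [hst₇]
  refine Ends.seq (fill_ends (R := StartEntry c t m (chunk c p 0 t))
    (bs := 3 * (m + 1) + shiftSize c t) (N := startSize c t)
    (K := 21 * t + 10) (L := [.u, .z, .x, .dm, .h, .lo, .d, .res, .len, .y]) hB₇.reg_one
    (by simp [hst₇, hB₆.reg_zero, hl₆.reg_baseU, ez (3 * (m + 1) + shiftSize c t) (by omega)])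
    (by simp [hst₇, hB₆.reg_one, hl₆.reg_ct, hl₆.reg_t, e1, e2])
    (by omega) hbw (by omega) (by simp)
    (fun st' a hK' ha haN => startEntry_ends hI hF (hB₇.congr (by simp; simp [hK' _]))
      (hl₇.congr (by simp; simp [hK' _])) ha haN)
    fun T₈ st₈ hstarts₈ hM₈ hK₈ hO₈ hT₈ => ?_)
  have hback : ∀ a < 3 * (m + 1), st₈.mem a = st₄.mem a := fun a ha => by
    rw [hM₈ a (by omega), hM₇, hM₆ a ha, hM₅]
  refine blockSearch_ends hI hF (hB₇.congr (by simp; simp [hK₈ _]))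
    (hl₇.congr (by simp; simp [hK₈ _])) ⟨?_, ?_, ?_, hstarts₈⟩
    (by rw [hO₈, hO₇, hO₆, hO₅, hO₄, hO₃, hO₂, hO₁, hout]) ?_
  · intro j hj
    rw [hback _ (by omega), hM₄ _ (by omega), hM₃]
    exact hmasks₂ j hj
  · intro j h1 h2
    rw [hback _ (by omega)]
    exact hborders₄ j h1 h2
  · intro a ha
    rw [hM₈ _ (by omega), hM₇]
    exact hshifts₆ a ha
  · intro T₉ st₉ hO₉ hT₉
    refine hQ _ _ hO₉ ?_
    have : (21 * t + 15) * (shiftSize c t + startSize c t) =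
      (21 * t + 10 + 5) * shiftSize c t + (21 * t + 10 + 5) * startSize c t := by ring
    rw [this]
    simp only [List.length_cons, List.length_nil]
    omega

/-- The whole algorithm; blocks have length `k / 2 ^ a`. -/
def algorithm (a : ℕ) : Com Var :=
  .seq (.block [.const .one 1, .op .shl .maskC .one .c, .op .sub .maskC .maskC .one, .const .i 1])
    (.seq borderTable
      (.seq (computeBlockLength a)
        (.ite (.eq .t .zero) charSearch
          (.seq (.block [.const .y 4, .op .shr .x .n .y])
            (.ite (.lt .x .m) charSearch blockAlgorithm)))))

/-- The memory demand for blocks is a premise only where the block search is entered; elsewhere room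
for the failure function suffices. -/
theorem algorithm_ends (hI : Instance E n m c k p f) {a : ℕ} (ha : 2 ≤ a)
    (hF : 1 ≤ k / 2 ^ a → m ≤ n / 16 → Fits E m k c (k / 2 ^ a)) {st : Store Var}
    (hn : st.reg .n = n) (hm : st.reg .m = m) (hc : st.reg .c = c) (hk : st.reg .k = k)
    (hz : st.reg .zero = 0) (hbase : st.reg .base = 0) (hout : st.out = []) :
    Ends E (algorithm a) st fun T st' => st'.out = occList p f n m (n + 1) ∧
      (k / 2 ^ a = 0 ∨ n / 16 < m → T ≤ 60 * m + 62 * n + a + 20) ∧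
      (1 ≤ k / 2 ^ a → m ≤ n / 16 →
        T ≤ 132 * m + 80 + a + (21 * (k / 2 ^ a) + 15) *
            (shiftSize c (k / 2 ^ a) + startSize c (k / 2 ^ a)) +
          90 * (n / (k / 2 ^ a) + 1) + 60 * ((n + k / 2 ^ a + 1) / (k / 2 ^ a) +
          fullMatches p f m (n + k / 2 ^ a + 1) 0)) := by
  have h2w : 1 < 2 ^ E.w := Nat.one_lt_two_pow (by have := hI.w_pos; omega)
  have hcw : c ≤ E.w := by simpa using (hI.mul_lt hI.one_le_k).1
  have hm1 := hI.one_le_m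
  refine Ends.seq (Ends.block (by simp) ?_)
  set st₁ := execAll E [Basic.const .one 1, .op .shl .maskC .one .c, .op .sub .maskC .maskC .one,
    .const .i 1] st with hst₁
  have hB₁ : Basics n m c k st₁ := ⟨by simp [hst₁, hn], by simp [hst₁, hm], by simp [hst₁, hc],
    by simp [hst₁, hk], by simp [hst₁, hz], by simp [hst₁, Nat.mod_eq_of_lt h2w], by
      simp [hst₁, hc, Nat.mod_eq_of_lt h2w, eval_mask hI.w_pos hcw]⟩
  have hO₁ : st₁.out = [] := by simp [hst₁, hout]
  refine Ends.seq (borderTable_ends hI hB₁ (o := 1) (bs := 0)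
    (by simp [hst₁, Nat.mod_eq_of_lt h2w]) (by simp [hst₁, hbase]) le_rfl
    (by have := hI.m_lt_bound; omega) (Or.inl ⟨rfl, rfl⟩)
    fun T₂ st₂ hπ₂ hM₂ hK₂ hO₂ hT₂ => ?_)
  have hB₂ : Basics n m c k st₂ := hB₁.congr (by simp; simp [hK₂ _])
  refine Ends.seq (computeBlockLength_ends hI hB₂ a fun st₃ ht₃ hK₃ hM₃ hO₃ => ?_)
  have hB₃ : Basics n m c k st₃ := hB₂.congr (by simp; simp [hK₃ _])
  have hπ₃ : ∀ j, 1 ≤ j → j ≤ m → Border p 1 j (st₃.mem j) := fun j h1 h2 => by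
    rw [hM₃]; simpa using hπ₂ j h1 h2
  have hO₃' : st₃.out = [] := by rw [hO₃, hO₂, hO₁]
  set t := k / 2 ^ a with htd
  refine Ends.ite (fun hc' => ?_) (fun hc' => Ends.seq (Ends.block (by simp) ?_))
  · simp only [Cond.Holds, ht₃, hB₃.reg_zero] at hc'
    refine charSearch_ends hI hB₃ hπ₃ hO₃' fun T₄ st₄ hO₄ hT₄ => ⟨hO₄, fun _ => ?_, fun h => ?_⟩
    · simp; omega
    · omega
  · simp only [Cond.Holds, ht₃, hB₃.reg_zero] at hc'
    have hkw : k ≤ E.w := by have := hI.word; have := hI.one_le_c; nlinarith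
    have hak : 2 ^ 2 ≤ k := by
      have h1 : 2 ^ a ≤ k := by
        by_contra h
        exact hc' (Nat.div_eq_of_lt (by omega))
      exact le_trans (Nat.pow_le_pow_right (by norm_num) ha) h1
    -- Constants are reduced modulo `2 ^ w`; a nonzero block length with `a ≥ 2` forces words of at
    -- least four bits.
    have h4 : 4 < 2 ^ E.w := lt_of_le_of_lt (show 4 ≤ E.w by omega) Nat.lt_two_pow_self
    set st₄ := execAll E [Basic.const .y 4, .op .shr .x .n .y] st₃ with hst₄
    have hK₄ : Keeps [.y, .x] st₃ st₄ := keeps_execAll E _ st₃ (by simp [target])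
    have hB₄ : Basics n m c k st₄ := hB₃.congr (by simp; simp [hK₄ _])
    have hM₄ : st₄.mem = st₃.mem := by simp [hst₄]
    have hO₄ : st₄.out = [] := by simp [hst₄, hO₃']
    have hx₄ : st₄.reg .x = n / 16 := by
      simp [hst₄, hB₃.reg_n, Nat.mod_eq_of_lt h4, eval_shr hI.n_lt]
    have ht₄ : st₄.reg .t = t := by rw [hK₄ _ (by simp), ht₃]
    refine Ends.ite (fun hc'' => ?_) (fun hc'' => ?_)
    · simp only [Cond.Holds, hx₄, hB₄.reg_m] at hc''
      refine charSearch_ends hI hB₄ (by rw [hM₄]; exact hπ₃) hO₄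
        fun T₄ st₄ hO₄ hT₄ => ⟨hO₄, fun _ => ?_, fun h => ?_⟩
      · simp; omega
      · omega
    · simp only [Cond.Holds, hx₄, hB₄.reg_m] at hc''
      refine blockAlgorithm_ends hI (hF (by omega) (by omega)) hB₄ ht₄ (by rw [hM₄]; exact hπ₃) hO₄
        fun T₄ st₄ hO₄ hT₄ => ⟨hO₄, fun _ => ?_, fun _ _ => ?_⟩
      · omega
      · simp only [List.length_cons, List.length_nil]
        omega

end

/-! ### Packed strings -/

/-- The characters of a string, continued by zeros. -/
def char {σ : ℕ} (A : List (Fin σ)) (i : ℕ) : ℕ := (A.map Fin.val).getD i 0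

theorem char_lt {σ : ℕ} (A : List (Fin σ)) (i : ℕ) : char A i < 2 ^ Nat.clog 2 σ := by
  unfold char
  by_cases h : i < A.length
  · rw [List.getD_eq_getElem _ _ (by simpa using h), List.getElem_map]
    exact lt_of_lt_of_le A[i].isLt (Nat.le_pow_clog (by norm_num) σ)
  · rw [List.getD_eq_default _ _ (by simpa using h)]
    positivity

theorem occurs_iff {σ : ℕ} (P Q : List (Fin σ)) (i : ℕ) (hi : i ≤ Q.length) :
    Occurs (char P) (char Q) Q.length P.length i ↔ P <+: Q.drop i := by
  have key : ∀ (A : List (Fin σ)) r (h : r < A.length), char A r = (A[r] : ℕ) := fun A r h => by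
    rw [char, List.getD_eq_getElem _ _ (by simpa using h), List.getElem_map]
  rw [List.prefix_iff_getElem]
  constructor
  · rintro ⟨⟨-, h⟩, hle⟩
    refine ⟨by simp; omega, fun r hr => ?_⟩
    have := h r (by omega)
    rw [key Q _ (by omega), key P _ hr] at this
    rw [List.getElem_drop]
    exact Fin.ext this.symm
  · rintro ⟨hle, h⟩
    rw [List.length_drop] at hle
    refine ⟨⟨by omega, fun r hr => ?_⟩, by omega⟩
    have := h r (by omega)
    rw [key Q _ (by omega), key P _ (by omega), this, List.getElem_drop]

theorem occList_nodup (p f : ℕ → ℕ) (n m S : ℕ) : (occList p f n m S).Nodup :=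
  List.Nodup.filter _ List.nodup_range

theorem occList_toFinset {σ : ℕ} (P Q : List (Fin σ)) :
    (occList (char P) (char Q) Q.length P.length (Q.length + 1)).toFinset = occurrences P Q := by
  ext i
  simp only [occList, occurrences, List.mem_toFinset, List.mem_filter, List.mem_range,
    decide_eq_true_eq, Finset.mem_filter, Finset.mem_range]
  exact and_congr_right fun h => occurs_iff P Q i (by omega)

/-- Few alignments match only beyond the end of the text. -/
theorem fullMatches_le {σ : ℕ} (P Q : List (Fin σ)) (t : ℕ) :
    fullMatches (char P) (char Q) P.length (Q.length + t + 1) 0 ≤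
      (occurrences P Q).card + P.length + t := by
  classical
  -- A full match that is not an occurrence must extend beyond the text, which confines its start to
  -- `m + t` positions.
  have hsub : (Finset.Ico 0 (Q.length + t + 1)).filter
      (fun s => Agrees (char P) (char Q) s (s + P.length)) ⊆
      occurrences P Q ∪ Finset.Ico (Q.length + 1 - P.length) (Q.length + t + 1) := by
    intro s hs
    rw [Finset.mem_filter, Finset.mem_Ico] at hs
    rw [Finset.mem_union, Finset.mem_Ico]
    by_cases h : s + P.length ≤ Q.length
    · left
      rw [occurrences, Finset.mem_filter, Finset.mem_range]
      exact ⟨by omega, (occurs_iff P Q s (by omega)).mp ⟨hs.2, h⟩⟩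
    · right; omega
  have h1 : fullMatches (char P) (char Q) P.length (Q.length + t + 1) 0 ≤
      (occurrences P Q ∪ Finset.Ico (Q.length + 1 - P.length) (Q.length + t + 1)).card := by
    unfold fullMatches
    convert Finset.card_le_card hsub
  refine h1.trans ((Finset.card_union_le _ _).trans ?_)
  rw [Nat.card_Ico]
  omega

theorem solvesWithin_of_ends {σ w k B T : ℕ} {P Q : List (Fin σ)} {a : ℕ}
    {R : ℕ → Prop}
    (h : Ends ⟨w, packedInput k P Q, B⟩ (algorithm a)
      ⟨fun v => (parameters k P Q).getD (Var.equiv v) 0, fun _ => 0, []⟩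
      fun T' st => st.out = occList (char P) (char Q) Q.length P.length (Q.length + 1) ∧ R T')
    (hR : ∀ T', R T' → T' ≤ T) :
    SolvesWithin ((algorithm a).compile Var.equiv 0) w k P Q T (41 + B) := by
  obtain ⟨T', st, hq, hout, hhalt, hspace⟩ := h.machine Var.equiv (T := T) fun T' st hq => hR T' hq.2
  refine ⟨hhalt, hspace, ?_, ?_⟩
  · rw [hout, hq.1]; exact occList_nodup _ _ _ _ _
  · rw [hout, hq.1]; exact occList_toFinset P Q

theorem instance_of_packed {σ w k B : ℕ} {P Q : List (Fin σ)} (hσ : 2 ≤ σ) (hk : 1 ≤ k)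
    (hkw : k * Nat.clog 2 σ ≤ w) (hP : 1 ≤ P.length) (hPQ : P.length ≤ Q.length)
    (hQ : Q.length < 2 ^ w) (hB : P.length < B) (hBw : B ≤ 2 ^ w) :
    Instance ⟨w, packedInput k P Q, B⟩ Q.length P.length (Nat.clog 2 σ) k (char P) (char Q) where
  p_lt := char_lt P
  f_lt := char_lt Q
  pattern _ := rfl
  text _ := rfl
  one_le_c := Nat.clog_pos (by norm_num) hσ
  one_le_k := hk
  word := hkw
  one_le_m := hP
  m_le := hPQ
  n_lt := hQ
  m_lt_bound := hB
  bound_le := hBw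

/-! ### Bounds -/

/-- Since `t ≤ c * t`, the index lengths are at most `5 * (c * t)`. One more factor `2 ^ (c * t)`
absorbs the linear time per entry. -/
theorem table_sizes {c t : ℕ} (hc : 1 ≤ c) (ht : 1 ≤ t) :
    shiftSize c t ≤ 2 ^ (5 * (c * t)) ∧ startSize c t ≤ 2 ^ (5 * (c * t)) ∧
      (21 * t + 15) * (shiftSize c t + startSize c t) ≤ 72 * 2 ^ (6 * (c * t)) := by
  have hct : t ≤ c * t := Nat.le_mul_of_pos_left _ hc
  have h1 : shiftSize c t ≤ 2 ^ (5 * (c * t)) :=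
    Nat.pow_le_pow_right (by norm_num) (by rw [mul_left_comm]; omega)
  have h2 : startSize c t ≤ 2 ^ (5 * (c * t)) := Nat.pow_le_pow_right (by norm_num) (by omega)
  refine ⟨h1, h2, ?_⟩
  have h3 : t < 2 ^ (c * t) := lt_of_le_of_lt hct Nat.lt_two_pow_self
  calc (21 * t + 15) * (shiftSize c t + startSize c t)
      ≤ (36 * 2 ^ (c * t)) * (2 * 2 ^ (5 * (c * t))) := Nat.mul_le_mul (by omega) (by omega)
    _ = 72 * (2 ^ (c * t) * 2 ^ (5 * (c * t))) := by ring
    _ = 72 * 2 ^ (6 * (c * t)) := by rw [← pow_add]; congr 2; ring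

/-- The tables and the arrays of length `m + 1` together take at most half of the address space;
this is what the restriction to `m ≤ n / 16` is for. -/
theorem fits_bound {w m n c t : ℕ} (hc : 1 ≤ c) (ht : 1 ≤ t) (hw : 16 * (c * t) ≤ w)
    (hm : m ≤ n / 16) (hn : n < 2 ^ w) :
    3 * (m + 1) + shiftSize c t + startSize c t ≤ 2 ^ w := by
  obtain ⟨h1, h2, -⟩ := table_sizes hc ht
  have hct : 1 ≤ c * t := Nat.mul_pos hc ht
  have h3 : 16 * 2 ^ (5 * (c * t)) ≤ 2 ^ w := by
    rw [show 16 = 2 ^ 4 by norm_num, ← pow_add]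
    exact Nat.pow_le_pow_right (by norm_num) (by omega)
  have h4 : 1 ≤ 2 ^ (5 * (c * t)) := Nat.one_le_two_pow
  omega

/-- This follows from `log n ≤ 2 * √n` and `log σ ≥ log 2 > 1 / 2`. -/
theorem sqrt_le_div_logb {n σ : ℕ} (hn : 2 ≤ n) (hσ : 2 ≤ σ) :
    (n : ℝ) ^ (1 / 2 : ℝ) ≤ 4 * (n / Real.logb σ n) := by
  have hn1 : (1 : ℝ) < n := by exact_mod_cast hn
  have hn0 : (0 : ℝ) < n := by linarith
  have hσ1 : (2 : ℝ) ≤ σ := by exact_mod_cast hσ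
  have hl : 0 < Real.log n := Real.log_pos hn1
  have hlσ : Real.log 2 ≤ Real.log σ := Real.log_le_log (by norm_num) hσ1
  have hl2 : (1 / 2 : ℝ) < Real.log 2 := by have := Real.log_two_gt_d9; linarith
  have h1 : Real.log n ≤ (n : ℝ) ^ (1 / 2 : ℝ) / (1 / 2) :=
    Real.log_le_rpow_div hn0.le (by norm_num)
  have hr : 0 < (n : ℝ) ^ (1 / 2 : ℝ) := Real.rpow_pos_of_pos hn0 _
  have hsq : (n : ℝ) ^ (1 / 2 : ℝ) * (n : ℝ) ^ (1 / 2 : ℝ) = n := by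
    rw [← Real.rpow_add hn0]; norm_num
  have hlb : Real.logb σ n ≤ 4 * (n : ℝ) ^ (1 / 2 : ℝ) := by
    rw [Real.logb, div_le_iff₀ (by linarith)]
    nlinarith
  have hlbp : 0 < Real.logb σ n := Real.logb_pos (by linarith) hn1
  rw [← mul_div_assoc, le_div_iff₀ hlbp]
  nlinarith

/-- A block occupies at most the fraction `1 / 2 ^ a` of a word of `O(log n)` bits, so the choice of
`a` turns the exponential table cost into a small power of `n`. The 6 is the exponent from
`table_sizes`. -/
theorem two_pow_le_rpow {n w c k t a : ℕ} {b e : ℝ} (hn : 2 ≤ n)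
    (hw : (w : ℝ) ≤ b * Real.logb 2 n) (ha : 6 * b ≤ e * 2 ^ a) (hkw : k * c ≤ w)
    (ht : t * 2 ^ a ≤ k) : ((2 ^ (6 * (c * t)) : ℕ) : ℝ) ≤ (n : ℝ) ^ e := by
  have hn1 : (1 : ℝ) < n := by exact_mod_cast hn
  have hl : 0 < Real.logb 2 n := Real.logb_pos (by norm_num) hn1
  have h1 : ((c * t * 2 ^ a : ℕ) : ℝ) ≤ w := by
    exact_mod_cast (show c * t * 2 ^ a ≤ w by nlinarith)
  push_cast at h1
  have ha0 : (0 : ℝ) < 2 ^ a := by positivity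
  have h2 : 6 * ((c : ℝ) * t) ≤ e * Real.logb 2 n := by
    refine le_of_mul_le_mul_right ?_ ha0
    nlinarith
  calc ((2 ^ (6 * (c * t)) : ℕ) : ℝ) = (2 : ℝ) ^ (6 * ((c : ℝ) * t)) := by
        rw [show 6 * ((c : ℝ) * t) = ((6 * (c * t) : ℕ) : ℝ) by push_cast; ring,
          Real.rpow_natCast, Nat.cast_pow, Nat.cast_ofNat]
    _ ≤ (2 : ℝ) ^ (e * Real.logb 2 n) := Real.rpow_le_rpow_of_exponent_le (by norm_num) h2
    _ = (n : ℝ) ^ e := by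
        rw [mul_comm, Real.rpow_mul (by norm_num), Real.rpow_logb (by norm_num) (by norm_num)
          (by linarith)]

/-- Too few characters per word, or a long pattern: the search proceeds character by character. -/
theorem solvesWithin_charSearch {σ w k a : ℕ} {P Q : List (Fin σ)} (hσ : 2 ≤ σ) (hk : 1 ≤ k)
    (hkw : k * Nat.clog 2 σ ≤ w) (hP : 1 ≤ P.length) (hPQ : P.length ≤ Q.length)
    (hQ : Q.length < 2 ^ w) (ha : 2 ≤ a) (h : k / 2 ^ a = 0 ∨ Q.length / 16 < P.length) :
    SolvesWithin ((algorithm a).compile Var.equiv 0) w k P Q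
      (60 * P.length + 62 * Q.length + a + 20) (41 + (P.length + 1)) :=
  solvesWithin_of_ends
    (algorithm_ends
      (instance_of_packed (B := P.length + 1) hσ hk hkw hP hPQ hQ (by omega) (by omega))
      ha (fun h1 h2 => by omega) rfl rfl rfl rfl rfl rfl rfl)
    fun _ hT => hT.1 h

/-- Otherwise the search proceeds block by block. -/
theorem solvesWithin_blockSearch {σ w k a t : ℕ} {P Q : List (Fin σ)} (hσ : 2 ≤ σ)
    (hkw : k * Nat.clog 2 σ ≤ w) (hP : 1 ≤ P.length) (hPQ : P.length ≤ Q.length)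
    (hQ : Q.length < 2 ^ w) (ha : 4 ≤ a) (ht : k / 2 ^ a = t) (ht1 : 1 ≤ t)
    (hm : P.length ≤ Q.length / 16) :
    SolvesWithin ((algorithm a).compile Var.equiv 0) w k P Q
      (132 * P.length + 80 + a +
        (21 * t + 15) * (shiftSize (Nat.clog 2 σ) t + startSize (Nat.clog 2 σ) t) +
        90 * (Q.length / t + 1) +
        60 * ((Q.length + t + 1) / t + ((occurrences P Q).card + P.length + t)))
      (41 + (3 * (P.length + 1) + shiftSize (Nat.clog 2 σ) t + startSize (Nat.clog 2 σ) t)) := by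
  have htk : t * 2 ^ a ≤ k := ht ▸ Nat.div_mul_le_self k (2 ^ a)
  have h16 : 16 ≤ 2 ^ a := by
    simpa using Nat.pow_le_pow_right (n := 2) (by norm_num) ha
  have htk' : 16 * t ≤ k := by nlinarith
  have hc : 1 ≤ Nat.clog 2 σ := Nat.clog_pos (by norm_num) hσ
  have hw : 16 * (Nat.clog 2 σ * t) ≤ w := by nlinarith
  refine solvesWithin_of_ends
    (algorithm_ends (instance_of_packed hσ (by omega) hkw hP hPQ hQ (by omega)
      (fits_bound hc ht1 hw hm hQ)) (by omega)
      (fun _ _ => ⟨by omega, by omega, by rw [ht]⟩) rfl rfl rfl rfl rfl rfl rfl)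
    fun _ hT => (hT.2 (by omega) hm).trans ?_
  rw [ht]
  have := fullMatches_le P Q t
  omega

/-- If `k < 2 ^ a`, then `l < 2 ^ a / κ`, so `n` is at most a constant times `n / l`; otherwise `n ≤
16 * m`. -/
theorem charSearch_time_le {n m k a : ℕ} {κ l o C : ℝ} (hκ : 0 < κ) (hl : 0 < l) (hlk : κ * l ≤ k)
    (hm : 1 ≤ m) (ho : 0 ≤ o) (h : k / 2 ^ a = 0 ∨ n / 16 < m)
    (hC : C = 2000 + a + 150 * (2 ^ (a + 1) / κ)) :
    ((60 * m + 62 * n + a + 20 : ℕ) : ℝ) ≤ C * (n / l + m + o) := by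
  have hA : 0 < (2 : ℝ) ^ (a + 1) / κ := by positivity
  have hN : 0 ≤ (n : ℝ) / l := by positivity
  have hm1 : (1 : ℝ) ≤ m := by exact_mod_cast hm
  have ha0 : (0 : ℝ) ≤ a := by positivity
  have hn : (62 * n : ℝ) ≤ 992 * m + 150 * (2 ^ (a + 1) / κ) * (n / l) := by
    rcases h with h | h
    · have hk : k < 2 ^ a := (Nat.div_eq_zero_iff.mp h).resolve_left (by positivity)
      have hk' : (k : ℝ) < 2 ^ a := by exact_mod_cast hk
      have h1 : l ≤ 2 ^ (a + 1) / κ := by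
        rw [le_div_iff₀ hκ, pow_succ]; nlinarith
      have h2 : (n : ℝ) ≤ 2 ^ (a + 1) / κ * (n / l) := by
        calc (n : ℝ) = l * (n / l) := by field_simp
          _ ≤ _ := mul_le_mul_of_nonneg_right h1 hN
      nlinarith
    · have : (n : ℝ) ≤ 16 * m := by exact_mod_cast (show n ≤ 16 * m by omega)
      have := mul_nonneg hA.le hN
      linarith
  have h1 : 0 ≤ (a : ℝ) * (m - 1) := mul_nonneg ha0 (by linarith)
  have h2 : 0 ≤ ((2000 : ℝ) + a) * (n / l) := by positivity
  have h3 : 0 ≤ ((2000 : ℝ) + a + 150 * (2 ^ (a + 1) / κ)) * o := by positivity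
  have h4 : 0 ≤ 150 * ((2 : ℝ) ^ (a + 1) / κ) * m := by positivity
  push_cast
  rw [hC]
  linarith

/-- Rounding costs at most a factor two: `k < 2 ^ a * (t + 1) ≤ 2 ^ (a + 1) * t`. Hence `n / t` is
at most `2 ^ (a + 1) / κ` times `n / l`, and it enters with the factor `150 = 90 + 60`. -/
theorem blockSearch_time_le {n m k a t s o : ℕ} {κ l x C : ℝ} (hκ : 0 < κ) (hl : 0 < l)
    (hlk : κ * l ≤ k) (hm : 1 ≤ m) (ht : k / 2 ^ a = t) (ht1 : 1 ≤ t)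
    (hs : (s : ℝ) ≤ 72 * x) (htx : (t : ℝ) ≤ x) (hx : x ≤ 4 * (n / l))
    (hC : C = 2000 + a + 150 * (2 ^ (a + 1) / κ)) :
    ((132 * m + 80 + a + s + 90 * (n / t + 1) + 60 * ((n + t + 1) / t + (o + m + t)) : ℕ) : ℝ) ≤
      C * (n / l + m + o) := by
  have hA : 0 < (2 : ℝ) ^ (a + 1) / κ := by positivity
  have hN : 0 ≤ (n : ℝ) / l := by positivity
  have hm1 : (1 : ℝ) ≤ m := by exact_mod_cast hm
  have ha0 : (0 : ℝ) ≤ a := by positivity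
  have ht0 : (0 : ℝ) < t := by exact_mod_cast ht1
  have hkt : (k : ℝ) ≤ 2 ^ (a + 1) * t := by
    have h1 : k < 2 ^ a * (t + 1) := by
      rw [← ht]; exact Nat.lt_mul_div_succ k (by positivity)
    have h2 : 2 ^ a * (t + 1) ≤ 2 ^ (a + 1) * t := by
      rw [pow_succ, mul_assoc]; exact Nat.mul_le_mul_left _ (by omega)
    exact_mod_cast (h1.trans_le h2).le
  have hnt : ((n / t : ℕ) : ℝ) ≤ 2 ^ (a + 1) / κ * (n / l) := by
    refine Nat.cast_div_le.trans ?_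
    rw [div_mul_div_comm, div_le_div_iff₀ ht0 (by positivity)]
    have : (n : ℝ) * (κ * l) ≤ n * (2 ^ (a + 1) * t) :=
      mul_le_mul_of_nonneg_left (hlk.trans hkt) (by positivity)
    linarith
  have hnt' : (n + t + 1) / t ≤ n / t + 2 := by
    rw [← Nat.add_mul_div_right _ _ ht1]
    exact Nat.div_le_div_right (by omega)
  have hnt'' : (((n + t + 1) / t : ℕ) : ℝ) ≤ ((n / t : ℕ) : ℝ) + 2 := by exact_mod_cast hnt'
  have h1 : 0 ≤ (a : ℝ) * (m - 1) := mul_nonneg ha0 (by linarith)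
  have h2 : 0 ≤ (a : ℝ) * (n / l) := by positivity
  have h3 : 0 ≤ ((1940 : ℝ) + a + 150 * (2 ^ (a + 1) / κ)) * o := by positivity
  have h4 : 0 ≤ 150 * ((2 : ℝ) ^ (a + 1) / κ) * m := by positivity
  rw [hC]
  simp only [Nat.cast_add, Nat.cast_mul, Nat.cast_ofNat, Nat.cast_one]
  linarith

end PackedMatching

/-! ### The theorem -/

open PackedMatching

/-- `b` and `κ` are the constants in "word length `Θ(log n)`" and "`Θ(log n / log σ)` characters per
word" (the matching bounds are `n < 2 ^ w` and `k * ⌈log₂ σ⌉ ≤ w`). One program works for all inputs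
and all word lengths in this range. -/
theorem theorem1 (ε : ℝ) (hε0 : 0 < ε) (hε1 : ε < 1) (b κ : ℝ) (hκ : 0 < κ) :
    ∃ (s : ℕ) (prog : WordRAM.Program s) (C : ℝ),
      ∀ (n m w σ k : ℕ) (P Q : List (Fin σ)),
        P.length = m → Q.length = n → 2 ≤ σ → 1 ≤ m → m ≤ n → 2 ≤ n →
        n < 2 ^ w → (w : ℝ) ≤ b * Real.logb 2 n →
        κ * Real.logb σ n ≤ k → k * Nat.clog 2 σ ≤ w →
        ∃ T S : ℕ, PackedMatching.SolvesWithin prog w k P Q T S ∧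
          (T : ℝ) ≤ C * (n / Real.logb σ n + m + (PackedMatching.occurrences P Q).card) ∧
          (S : ℝ) ≤ C * ((n : ℝ) ^ ε + m) := by
  have he : 0 < min ε (1 / 2) := lt_min hε0 (by norm_num)
  -- The bound `4 ≤ a` gives `16 * (c * t) ≤ w`, which makes the tables addressable and provides
  -- room for windows of `2 * t` characters.
  obtain ⟨a, ha4, ha⟩ : ∃ a : ℕ, 4 ≤ a ∧ 6 * b ≤ min ε (1 / 2) * 2 ^ a := by
    obtain ⟨a, ha⟩ := pow_unbounded_of_one_lt (6 * b / min ε (1 / 2)) (one_lt_two (α := ℝ))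
    refine ⟨max 4 a, le_max_left _ _, ?_⟩
    rw [div_lt_iff₀ he] at ha
    have : (2 : ℝ) ^ a ≤ 2 ^ max 4 a := pow_le_pow_right₀ (by norm_num) (le_max_right _ _)
    nlinarith
  refine ⟨41, (algorithm a).compile Var.equiv 0, 2000 + a + 150 * (2 ^ (a + 1) / κ), ?_⟩
  rintro n m w σ k P Q rfl rfl hσ hm hmn hn hw hwb hkκ hkw
  have hn1 : (1 : ℝ) < Q.length := by exact_mod_cast hn
  have hl : 0 < Real.logb σ Q.length := Real.logb_pos (by exact_mod_cast hσ) hn1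
  have hk : 1 ≤ k := by
    have : (0 : ℝ) < k := lt_of_lt_of_le (mul_pos hκ hl) hkκ
    exact_mod_cast this
  have hc : 1 ≤ Nat.clog 2 σ := Nat.clog_pos (by norm_num) hσ
  have hC : (2000 : ℝ) ≤ 2000 + a + 150 * (2 ^ (a + 1) / κ) := by
    have : (0 : ℝ) ≤ a + 150 * (2 ^ (a + 1) / κ) := by positivity
    linarith
  have hm1 : (1 : ℝ) ≤ P.length := by exact_mod_cast hm
  have hr : 0 < (Q.length : ℝ) ^ ε := Real.rpow_pos_of_pos (by linarith) _
  have hspace : ∀ S : ℝ, S ≤ 2000 * ((Q.length : ℝ) ^ ε + P.length) →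
      S ≤ (2000 + a + 150 * (2 ^ (a + 1) / κ)) * ((Q.length : ℝ) ^ ε + P.length) := fun S hS =>
    hS.trans (mul_le_mul_of_nonneg_right hC (by linarith))
  -- The program makes the same distinction at run time; here it selects the bounds for time and
  -- space.
  by_cases h : k / 2 ^ a = 0 ∨ Q.length / 16 < P.length
  · refine ⟨_, _, solvesWithin_charSearch hσ hk hkw hm hmn hw (by omega) h,
      charSearch_time_le hκ hl hkκ hm (by positivity) h rfl, hspace _ ?_⟩
    push_cast
    linarith
  · obtain ⟨t, ht⟩ : ∃ t, k / 2 ^ a = t := ⟨_, rfl⟩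
    obtain ⟨h1, h2⟩ := not_or.mp h
    have ht1 : 1 ≤ t := by omega
    obtain ⟨hs1, hs2, hs3⟩ := table_sizes hc ht1
    have hx := two_pow_le_rpow hn hwb ha hkw (ht ▸ Nat.div_mul_le_self k (2 ^ a))
    -- The exponent `min ε (1 / 2)` serves both bounds: `1 / 2` for the time to fill the tables, `ε`
    -- for their space.
    have hxN : (Q.length : ℝ) ^ min ε (1 / 2) ≤ 4 * (Q.length / Real.logb σ Q.length) :=
      (Real.rpow_le_rpow_of_exponent_le hn1.le (min_le_right _ _)).trans (sqrt_le_div_logb hn hσ)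
    have hxε : (Q.length : ℝ) ^ min ε (1 / 2) ≤ (Q.length : ℝ) ^ ε :=
      Real.rpow_le_rpow_of_exponent_le hn1.le (min_le_left _ _)
    have hct : t ≤ 2 ^ (6 * (Nat.clog 2 σ * t)) :=
      (show t ≤ 6 * (Nat.clog 2 σ * t) by nlinarith).trans Nat.lt_two_pow_self.le
    have hpow : 2 ^ (5 * (Nat.clog 2 σ * t)) ≤ 2 ^ (6 * (Nat.clog 2 σ * t)) :=
      Nat.pow_le_pow_right (by norm_num) (by omega)
    refine ⟨_, _, solvesWithin_blockSearch hσ hkw hm hmn hw ha4 ht ht1 (by omega),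
      blockSearch_time_le hκ hl hkκ hm ht ht1 ?_ ?_ hxN rfl, hspace _ ?_⟩
    · have : (((21 * t + 15) * (shiftSize (Nat.clog 2 σ) t + startSize (Nat.clog 2 σ) t) : ℕ) : ℝ) ≤
          72 * ((2 ^ (6 * (Nat.clog 2 σ * t)) : ℕ) : ℝ) := by exact_mod_cast hs3
      linarith
    · exact le_trans (by exact_mod_cast hct) hx
    · have h3 : (shiftSize (Nat.clog 2 σ) t : ℝ) ≤ ((2 ^ (6 * (Nat.clog 2 σ * t)) : ℕ) : ℝ) := by
        exact_mod_cast hs1.trans hpow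
      have h4 : (startSize (Nat.clog 2 σ) t : ℝ) ≤ ((2 ^ (6 * (Nat.clog 2 σ * t)) : ℕ) : ℝ) := by
        exact_mod_cast hs2.trans hpow
      simp only [Nat.cast_add, Nat.cast_mul, Nat.cast_ofNat, Nat.cast_one]
      linarith
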